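/- Let $1\le k\le n$ be integers. Let $A\in C^1(0,\infty)$ be positive and such that $p\mapsto pA(p)$ extends continuously to $[0,\infty)$ with value $0$ at $p=0$ and is strictly increasing on $(0,\infty)$. Let $f:\mathbb R\to\mathbb R$ be positive, continuous and non-decreasing. For $\lambda\in\mathbb R^n$ let $\sigma_l(\lambda)$ be the $l$-th elementary symmetric function and $\Gamma_k=\{\lambda\in\mathbb R^n:\sigma_l(\lambda)>0,\ l=1,\dots,k\}$. For a matrix $M$ write $\lambda(M)$ for its eigenvalues counted with algebraic multiplicity. The field $A(|Du|)Du$ is taken to be $0$ where $Du=0$. Let $\Phi^k(\mathbb R^n)$ be the set of $u\in C^1(\mathbb R^n)$ such that $A(|Du|)Du\in C^1(\mathbb R^n)$ and, at every point of $\mathbb R^n$, the eigenvalues $\lambda(D_i(A(|Du|)D_ju))$ are all real and lie in $\Gamma_k$. Call $u$ a *solution* if $u\in C^2(\mathbb R^n\setminus\{0\})\cap\Phi^k(\mathbb R^n)$ and $$\sigma_k^{1/k}\bigl(\lambda\bigl(D_i(A(|Du|)D_ju)\bigr)\bigr)\ \ge\ f(u)\quad\text{at every point of }\mathbb R^n .$$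 (Solutions are not required to be positive.) Let $\Psi(p)=p\,(pA(p))^k-\int_0^p(tA(t))^k\,dt$ for $p\ge0$; when $\lim_{p\to\infty}pA(p)=\infty$, it is a bijection of $[0,\infty)$ onto itself, with inverse $\Psi^{-1}$. Let $0<c\le b$ be arbitrary. 1. If $\lim_{p\to\infty}pA(p)<\infty$, there is no solution. 2. Suppose $\lim_{p\to\infty}pA(p)=\infty$. If a solution exists, then $$\int_b^\infty\Bigl(\Psi^{-1}\Bigl(\int_c^s f^k(t)\,dt\Bigr)\Bigr)^{-1}ds=\infty .\qquad(\ast)$$ Conversely, if $(pA(p))'>0$ for all $p>0$ and $(\ast)$ holds, then a solution exists. In particular, when $(pA(p))'>0$ on $(0,\infty)$, a solution exists if and only if $(\ast)$ holds. 3. Suppose that $0<\liminf_{p\to\infty}\frac{A(p)}{p^{m-2}}\le\limsup_{p\to\infty}\frac{A(p)}{p^{m-2}}<\infty$ for some $m>1$. If a solution exists, then $$\int_b^\infty\Bigl(\int_c^s f^k(t)\,dt\Bigr)^{-\frac1{k(m-1)+1}}ds=\infty .\qquad(\ast\ast)$$ Conversely, if $(pA(p))'>0$ for all $p>0$ and $(\ast\ast)$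 holds, then a solution exists. In particular, when $(pA(p))'>0$ on $(0,\infty)$, a solution exists if and only if $(\ast\ast)$ holds. -/

import Mathlib

open Set Filter Topology MeasureTheory

noncomputable section

/-- The vector field `A(|Du|) Du` on `ℝⁿ`. It vanishes wherever `Du = 0`, so the value of `A` at `0`
is irrelevant. -/
def fluxField {n : ℕ} (A : ℝ → ℝ) (u : EuclideanSpace ℝ (Fin n) → ℝ) :
    EuclideanSpace ℝ (Fin n) → EuclideanSpace ℝ (Fin n) :=
  fun x => A ‖gradient u x‖ • gradient u x

/-- The matrix `(D_i (A(|Du|) D_j u))_{i,j}` at the point `x`. -/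
def fluxMatrix {n : ℕ} (A : ℝ → ℝ) (u : EuclideanSpace ℝ (Fin n) → ℝ)
    (x : EuclideanSpace ℝ (Fin n)) : Matrix (Fin n) (Fin n) ℝ :=
  Matrix.of fun i j => (fderiv ℝ (fluxField A u) x (EuclideanSpace.single i 1)) j

/-- The real eigenvalues of a matrix, counted with algebraic multiplicity. -/
def eigenvalueMultiset {n : ℕ} (M : Matrix (Fin n) (Fin n) ℝ) : Multiset ℝ :=
  M.charpoly.roots

/-- The cone `Γ_k`: the (unordered) `n`-tuples `λ` of real numbers whose elementary symmetric
functions `σ_l(λ)`, `l = 1, …, k`, are all positive. -/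
def gammaCone (n k : ℕ) : Set (Multiset ℝ) :=
  {lam | Multiset.card lam = n ∧ ∀ l : ℕ, 1 ≤ l → l ≤ k → 0 < lam.esymm l}

/-- The class `Φᵏ(ℝⁿ)`. -/
def PhiClass (n k : ℕ) (A : ℝ → ℝ) : Set (EuclideanSpace ℝ (Fin n) → ℝ) :=
  {u | ContDiff ℝ 1 u ∧ ContDiff ℝ 1 (fluxField A u) ∧
    ∀ x, eigenvalueMultiset (fluxMatrix A u x) ∈ gammaCone n k}

/-- `u ∈ C²(ℝⁿ \ {0}) ∩ Φᵏ(ℝⁿ)` and `σ_k^{1/k}(λ(D_i(A(|Du|) D_j u))) ≥ f(u)` at every point of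
`ℝⁿ`. -/
def IsEntireSolution (n k : ℕ) (A f : ℝ → ℝ) (u : EuclideanSpace ℝ (Fin n) → ℝ) : Prop :=
  ContDiffOn ℝ 2 u {0}ᶜ ∧ u ∈ PhiClass n k A ∧
    ∀ x, f (u x) ≤ ((eigenvalueMultiset (fluxMatrix A u x)).esymm k) ^ (1 / (k : ℝ))

/-- `Ψ(p) = p (p A(p))ᵏ - ∫₀ᵖ (t A(t))ᵏ dt`. -/
def Psi (A : ℝ → ℝ) (k : ℕ) (p : ℝ) : ℝ :=
  p * (p * A p) ^ k - ∫ t in (0 : ℝ)..p, (t * A t) ^ k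

/-- The inverse function of `Ψ : [0, ∞) → [0, ∞)`. -/
def PsiInv (A : ℝ → ℝ) (k : ℕ) : ℝ → ℝ :=
  Function.invFunOn (Psi A k) (Ici 0)

/-- `∫_b^∞ (Ψ⁻¹(∫_c^s fᵏ(t) dt))⁻¹ ds = ∞`. -/
def PsiKellerOsserman (A f : ℝ → ℝ) (k : ℕ) (c b : ℝ) : Prop :=
  ∫⁻ s in Ioi b, ENNReal.ofReal ((PsiInv A k (∫ t in c..s, f t ^ k))⁻¹) = ⊤

/-- `∫_b^∞ (∫_c^s fᵏ(t) dt)^{-1/(k(m-1)+1)} ds = ∞`. -/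
def PowerKellerOsserman (f : ℝ → ℝ) (k : ℕ) (m c b : ℝ) : Prop :=
  ∫⁻ s in Ioi b,
    ENNReal.ofReal ((∫ t in c..s, f t ^ k) ^ (-(1 / ((k : ℝ) * (m - 1) + 1)))) = ⊤

/-- `0 < liminf_{p → ∞} A(p)/p^{m-2} ≤ limsup_{p → ∞} A(p)/p^{m-2} < ∞`, in the extended reals. -/
def PowerGrowth (A : ℝ → ℝ) (m : ℝ) : Prop :=
  0 < liminf (fun p : ℝ => ((A p / p ^ (m - 2) : ℝ) : EReal)) atTop ∧
    limsup (fun p : ℝ => ((A p / p ^ (m - 2) : ℝ) : EReal)) atTop < ⊤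

end

/-! ### Elementary symmetric functions on the cone `Γ_k`: Newton, monotonicity, Maclaurin. -/

section SymmetricFunctions

open Polynomial

/-! Write `e(p) = p A(p)` and `G = eᵏ`. The comparison functions are radial, `v(|x|)` with flux `g =
e(v')`; where `g` is differentiable their flux matrix has the eigenvalue `g'` once and `g/r` with
multiplicity `n - 1`. Because `Ψ(q) - Ψ(p)` is the Stieltjes integral of `t dG(t)` over `[p, q]`,
the function `G ∘ Ψ⁻¹` has derivative `1/Ψ⁻¹` even where `e' = 0` (`IsLegendrePair.hasDerivAt`).
Hence `Ψ(v') = z(v)` implies `(gᵏ)' = z'(v)`, and separation of variables shows that the profile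
needs the radius `∫ ds / Ψ⁻¹(z(s))` to climb. For `z' ~ fᵏ` this is the integral in `(∗)`: it
decides between blow-up at a finite radius and a global profile.

Necessity (`IsEntireSolution.psiKellerOsserman`). If the integral converges, a profile with `z' = ε
fᵏ` overtakes a given solution `u` within a bounded radius, so `u - v` has a positive interior
maximum. Away from the origin the second-order conditions there (`RadialContact.rel_eigenvalues`)
and the monotonicity of `σ_k` on `Γ_k` make `σ_k` smaller than `f(u)ᵏ`. Near the origin `u` need not
be `C²`; there `v` has flux `μ x`, Maclaurin gives a flux divergence above `n μ`, and an integral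
comparison (`weak_comparison`) excludes the maximum. When `p A(p)` is bounded, the same comparison
applies on a ball chosen so that `v'` exceeds `|Du|` on its boundary.

Sufficiency (`exists_isEntireSolution`). A radial solution needs `(gᵏ)' ≥ k rᵏ⁻¹ f(v)ᵏ`, which
involves `r` as a function of the height `v`. That function is Lipschitz, so `r` may be replaced by
its value one unit of height earlier plus a constant; the resulting delay equation is solved
interval by interval, and divergence of the integral makes its solution reach every radius.

Under power growth `Ψ⁻¹(z)` is comparable to `z^{1/(k(m-1)+1)}` for large `z`, so `(∗)` and `(∗∗)`
agree. -/

lemma Multiset.esymm_zero_eq_one {R : Type*} [CommSemiring R] (s : Multiset R) :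
    s.esymm 0 = 1 := by
  simp [Multiset.esymm]

lemma Multiset.esymm_cons_succ {R : Type*} [CommSemiring R] (a : R) (s : Multiset R) (k : ℕ) :
    (a ::ₘ s).esymm (k + 1) = s.esymm (k + 1) + a * s.esymm k := by
  simp only [Multiset.esymm, Multiset.powersetCard_cons, Multiset.map_add, Multiset.sum_add,
    Multiset.map_map, Function.comp_def, Multiset.prod_cons, Multiset.sum_map_mul_left]

lemma Multiset.esymm_eq_zero_of_card_lt {R : Type*} [CommSemiring R] (s : Multiset R) {k : ℕ}
    (h : Multiset.card s < k) : s.esymm k = 0 := by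
  simp [Multiset.esymm, Multiset.powersetCard_eq_empty _ h]

lemma Multiset.esymm_one_eq_sum {R : Type*} [CommSemiring R] (s : Multiset R) :
    s.esymm 1 = s.sum := by
  induction s using Multiset.induction_on with
  | empty => rw [Multiset.esymm_eq_zero_of_card_lt _ (by simp), Multiset.sum_zero]
  | cons a s ih =>
    rw [Multiset.esymm_cons_succ, ih, Multiset.esymm_zero_eq_one, Multiset.sum_cons]; ring

/-- With `Δ = c₁² - 2 c₀ c₂`, an extra factor `X + a` turns `Δ` into `c₀² + a² Δ`, so `Δ` stays
nonnegative. -/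
lemma prod_X_add_C_coeff_ineq (s : Multiset ℝ) :
    2 * ((s.map fun r => X + C r).prod.coeff 0 * (s.map fun r => X + C r).prod.coeff 2) ≤
      (s.map fun r => X + C r).prod.coeff 1 ^ 2 := by
  induction s using Multiset.induction_on with
  | empty => simp [coeff_one]
  | cons a s ih =>
    rw [Multiset.map_cons, Multiset.prod_cons]
    set P := (s.map fun r => X + C r).prod
    have h0 : ((X + C a) * P).coeff 0 = a * P.coeff 0 := by simp [add_mul]
    have h1 : ((X + C a) * P).coeff 1 = P.coeff 0 + a * P.coeff 1 := by simp [add_mul, coeff_X_mul]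
    have h2 : ((X + C a) * P).coeff 2 = P.coeff 1 + a * P.coeff 2 := by simp [add_mul, coeff_X_mul]
    rw [h0, h1, h2]
    nlinarith [mul_le_mul_of_nonneg_left ih (sq_nonneg a), sq_nonneg (P.coeff 0)]

lemma coeff_ineq_of_card_roots {q : ℝ[X]} (h : q.natDegree ≤ Multiset.card q.roots) :
    2 * (q.coeff 0 * q.coeff 2) ≤ q.coeff 1 ^ 2 := by
  have h' := C_leadingCoeff_mul_prod_multiset_X_sub_C (le_antisymm (card_roots' q) h)
  have h2 : (q.roots.map fun a => X - C a) = ((q.roots.map fun a => -a).map fun r => X + C r) := by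
    simp [Multiset.map_map, sub_eq_add_neg]
  rw [← h', h2]
  simp only [coeff_C_mul]
  nlinarith [mul_le_mul_of_nonneg_left (prod_X_add_C_coeff_ineq (q.roots.map fun a => -a))
    (sq_nonneg q.leadingCoeff)]

lemma card_roots_le_iterate_derivative (p : ℝ[X]) (m : ℕ) :
    Multiset.card p.roots ≤ Multiset.card (derivative^[m] p).roots + m := by
  induction m with
  | zero => simp
  | succ m ih =>
    have := card_roots_le_derivative (derivative^[m] p)
    rw [Function.iterate_succ_apply']
    omega

/-- A weak form of Newton's inequalities. -/
lemma Multiset.esymm_mul_esymm_le_sq (s : Multiset ℝ) (k : ℕ) :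
    s.esymm k * s.esymm (k + 2) ≤ s.esymm (k + 1) ^ 2 := by
  by_cases hk : Multiset.card s < k + 2
  · rw [Multiset.esymm_eq_zero_of_card_lt s hk, mul_zero]; positivity
  push Not at hk
  obtain ⟨m, hm⟩ := Nat.exists_eq_add_of_le hk
  set p : ℝ[X] := (s.map fun r => X + C r).prod with hp
  have hdeg : p.natDegree = Multiset.card s := by
    rw [hp, natDegree_multiset_prod_of_monic]
    · simp [Multiset.map_map]
    · simp only [Multiset.mem_map]; rintro f ⟨a, -, rfl⟩; exact monic_X_add_C a
  have hroots : Multiset.card p.roots = Multiset.card s := by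
    have h2 : (s.map fun r => X + C r) = ((s.map fun a => -a).map fun r => X - C r) := by
      simp [Multiset.map_map, sub_eq_add_neg]
    rw [hp, h2, roots_multiset_prod_X_sub_C, Multiset.card_map]
  -- By Rolle, differentiation keeps all roots real. After `m = card s - k - 2` derivatives the
  -- three lowest coefficients are multiples of `σ_{k+2}`, `σ_{k+1}`, `σ_k`.
  have hq := coeff_ineq_of_card_roots (q := derivative^[m] p) (by
    have h1 := card_roots_le_iterate_derivative p m
    have h2 := natDegree_iterate_derivative p m
    omega)
  simp only [coeff_iterate_derivative, zero_add, nsmul_eq_mul] at hq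
  rw [hp, Multiset.prod_X_add_C_coeff s (by omega), Multiset.prod_X_add_C_coeff s (by omega),
    Multiset.prod_X_add_C_coeff s (by omega)] at hq
  rw [show Multiset.card s - m = k + 2 by omega, show Multiset.card s - (2 + m) = k by omega,
    show Multiset.card s - (1 + m) = k + 1 by omega] at hq
  have e0 : (m.descFactorial m : ℝ) = m.factorial := by rw [Nat.descFactorial_self]
  have e1 : ((1 + m).descFactorial m : ℝ) = (m + 1) * m.factorial := by
    have := Nat.factorial_mul_descFactorial (show m ≤ 1 + m by omega)
    rw [show 1 + m - m = 1 by omega, Nat.factorial_one, one_mul, add_comm, Nat.factorial_succ] at this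
    rw [add_comm, this]; push_cast; ring
  have e2 : 2 * ((2 + m).descFactorial m : ℝ) = (m + 2) * ((m + 1) * m.factorial) := by
    have := Nat.factorial_mul_descFactorial (show m ≤ 2 + m by omega)
    rw [show 2 + m - m = 2 by omega, Nat.factorial_two, add_comm, Nat.factorial_succ,
      Nat.factorial_succ] at this
    rw [add_comm 2 m]; exact_mod_cast this
  have hm0 : (0 : ℝ) < m.factorial := by exact_mod_cast m.factorial_pos
  rw [e0, e1] at hq
  set F : ℝ := (m.factorial : ℝ)
  set D : ℝ := ((2 + m).descFactorial m : ℝ)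
  -- The factorials leave the ratio `(m + 1)/(m + 2) < 1`, which is more than is needed.
  have h3 : ((m : ℝ) + 1) * F ^ 2 * ((m + 2) * (s.esymm k * s.esymm (k + 2))) ≤
      (m + 1) * F ^ 2 * ((m + 1) * s.esymm (k + 1) ^ 2) := by
    calc _ = F * s.esymm (k + 2) * (((m : ℝ) + 2) * ((m + 1) * F)) * s.esymm k := by ring
      _ = 2 * (F * s.esymm (k + 2) * (D * s.esymm k)) := by rw [← e2]; ring
      _ ≤ _ := hq
      _ = _ := by ring
  have h4 := le_of_mul_le_mul_left h3 (by positivity)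
  by_contra hcon
  push Not at hcon
  have hpos : 0 ≤ s.esymm k * s.esymm (k + 2) := le_trans (sq_nonneg _) hcon.le
  nlinarith [mul_lt_mul_of_pos_left hcon (show (0 : ℝ) < m + 1 by positivity)]

/-- The elementary symmetric functions of orders `1, …, k` are positive. -/
def EsymmPos (k : ℕ) (s : Multiset ℝ) : Prop := ∀ l : ℕ, 1 ≤ l → l ≤ k → 0 < s.esymm l

lemma EsymmPos.of_le {k : ℕ} {s : Multiset ℝ} (h : EsymmPos k s) {l : ℕ} (hl : l ≤ k) :
    0 < s.esymm l := by
  rcases Nat.eq_zero_or_pos l with rfl | h0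
  · rw [Multiset.esymm_zero_eq_one]; exact one_pos
  · exact h l h0 hl

/-- Positivity of `∂σ_{l+1}/∂λ_i` on `Γ_{k+1}` for `l ≤ k`, the source of monotonicity. If `x =
σ_{k+1}(s) ≤ 0`, positivity of the two top functions of `a ::ₘ s` gives `a w > -x` and `y > a(-x)`,
hence `w y > x²`, against Newton. -/
lemma EsymmPos.of_cons {k : ℕ} {a : ℝ} {s : Multiset ℝ} (h : EsymmPos (k + 1) (a ::ₘ s)) :
    EsymmPos k s := by
  induction k with
  | zero => intro l h1 h2; omega
  | succ k ih =>
    have hs : EsymmPos k s := ih fun l h1 h2 => h l h1 (by omega)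
    intro l h1 h2
    rcases Nat.lt_or_ge l (k + 1) with hl | hl
    · exact hs l h1 (by omega)
    obtain rfl : l = k + 1 := by omega
    have h3 := h (k + 1) (by omega) (by omega)
    have h4 := h (k + 1 + 1) (by omega) le_rfl
    rw [Multiset.esymm_cons_succ] at h3 h4
    have h5 := hs.of_le le_rfl
    have h6 := s.esymm_mul_esymm_le_sq k
    rw [show k + 1 + 1 = k + 2 by omega] at h4
    by_contra hneg
    push Not at hneg
    set x := s.esymm (k + 1)
    set y := s.esymm (k + 2)
    set w := s.esymm k
    have h7 : 0 < a * w := by linarith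
    have ha : 0 < a := pos_of_mul_pos_left h7 h5.le
    have hy : a * (-x) < y := by linarith
    have hy0 : 0 < y := lt_of_le_of_lt (mul_nonneg ha.le (by linarith)) hy
    nlinarith [mul_lt_mul_of_pos_left hy h5, mul_nonneg (sub_nonneg.2 (by linarith : -x ≤ a * w))
      (by linarith : 0 ≤ -x)]

lemma EsymmPos.cons_mono {k : ℕ} {a b : ℝ} {s : Multiset ℝ} (hab : a ≤ b)
    (h : EsymmPos k (a ::ₘ s)) {l : ℕ} (hl : l ≤ k) : (a ::ₘ s).esymm l ≤ (b ::ₘ s).esymm l := by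
  rcases l with _ | l
  · simp [Multiset.esymm_zero_eq_one]
  obtain ⟨k, rfl⟩ : ∃ j, k = j + 1 := ⟨k - 1, by omega⟩
  rw [Multiset.esymm_cons_succ, Multiset.esymm_cons_succ]
  have := h.of_cons.of_le (show l ≤ k by omega)
  gcongr

/-- The entries are raised one at a time; `w` collects those already replaced. -/
lemma EsymmPos.rel_mono_aux {k : ℕ} {s t : Multiset ℝ} (h : Multiset.Rel (· ≤ ·) s t) :
    ∀ w, EsymmPos k (s + w) → EsymmPos k (t + w) ∧ (s + w).esymm k ≤ (t + w).esymm k := by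
  induction h with
  | zero => intro w h; exact ⟨h, le_rfl⟩
  | @cons a b as bs hab _ ih =>
    intro w hw
    rw [Multiset.cons_add] at hw
    have h1 : EsymmPos k (b ::ₘ (as + w)) := fun l h1 h2 =>
      (hw l h1 h2).trans_le (hw.cons_mono hab h2)
    have h2 := hw.cons_mono hab le_rfl
    rw [← Multiset.add_cons] at h1
    obtain ⟨h3, h4⟩ := ih _ h1
    rw [Multiset.add_cons, ← Multiset.cons_add] at h3
    rw [Multiset.add_cons, Multiset.add_cons, ← Multiset.cons_add] at h4
    rw [← Multiset.cons_add] at h2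
    exact ⟨h3, h2.trans (by simpa [Multiset.cons_add] using h4)⟩

/-- `σ_k` is monotone on `Γ_k`. -/
lemma EsymmPos.esymm_le_of_rel {k : ℕ} {s t : Multiset ℝ} (hs : EsymmPos k s)
    (h : Multiset.Rel (· ≤ ·) s t) : s.esymm k ≤ t.esymm k := by
  simpa using (EsymmPos.rel_mono_aux h 0 (by simpa using hs)).2

/-- Newton says that the quotients `σ_{j+1}/σ_j` do not increase while they are positive; the first
one is `σ_1`. -/
lemma EsymmPos.esymm_succ_le {k : ℕ} {s : Multiset ℝ} (hs : EsymmPos k s) :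
    ∀ j, j + 1 ≤ k → s.esymm (j + 1) ≤ s.esymm 1 * s.esymm j := by
  intro j
  induction j with
  | zero => intro _; simp [Multiset.esymm_zero_eq_one]
  | succ j ih =>
    intro hj
    have h1 := ih (by omega)
    have h2 := hs.of_le (show j ≤ k by omega)
    have h3 := hs.of_le (show j + 1 ≤ k by omega)
    have h4 := s.esymm_mul_esymm_le_sq j
    have : s.esymm j * s.esymm (j + 1 + 1) ≤ s.esymm j * (s.esymm 1 * s.esymm (j + 1)) := by
      nlinarith [mul_le_mul_of_nonneg_left h1 h3.le]
    exact le_of_mul_le_mul_left this h2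

/-- A weak form of Maclaurin's inequality. -/
lemma EsymmPos.esymm_le_pow {k : ℕ} {s : Multiset ℝ} (hs : EsymmPos k s) (hk : 1 ≤ k) :
    s.esymm k ≤ s.esymm 1 ^ k := by
  have h1 := hs.of_le hk
  have : ∀ j, j ≤ k → s.esymm j ≤ s.esymm 1 ^ j := by
    intro j
    induction j with
    | zero => intro _; simp [Multiset.esymm_zero_eq_one]
    | succ j ih =>
      intro hj
      calc s.esymm (j + 1) ≤ s.esymm 1 * s.esymm j := hs.esymm_succ_le j hj
        _ ≤ s.esymm 1 * s.esymm 1 ^ j := by gcongr; exact ih (by omega)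
        _ = _ := by ring
  exact this k le_rfl

lemma Multiset.esymm_replicate (n l : ℕ) (d : ℝ) :
    (Multiset.replicate n d).esymm l = n.choose l * d ^ l := by
  induction n generalizing l with
  | zero =>
    cases l with
    | zero => simp [Multiset.esymm_zero_eq_one]
    | succ l => rw [Multiset.esymm_eq_zero_of_card_lt _ (by simp)]; simp
  | succ n ih =>
    cases l with
    | zero => simp [Multiset.esymm_zero_eq_one]
    | succ l =>
      rw [Multiset.replicate_succ, Multiset.esymm_cons_succ, ih, ih, Nat.choose_succ_succ]
      push_cast; ring

lemma Multiset.esymm_cons_replicate (n l : ℕ) (D d : ℝ) :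
    (D ::ₘ Multiset.replicate n d).esymm (l + 1) =
      n.choose (l + 1) * d ^ (l + 1) + n.choose l * (D * d ^ l) := by
  rw [Multiset.esymm_cons_succ, Multiset.esymm_replicate, Multiset.esymm_replicate]; ring

end SymmetricFunctions

/-! ### Eigenvalues of symmetric and rank-one perturbed matrices. -/

section MatrixSpectrum

open Polynomial Matrix

/-- Courant–Fischer in its simplest case: two eigenvalues above `d` would span a plane on which the
form exceeds `d`, and this plane meets the hyperplane orthogonal to `e`. -/
lemma rel_roots_charpoly_of_quadratic_bound {n : ℕ} (hn : 1 ≤ n) {S : Matrix (Fin n) (Fin n) ℝ}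
    (hS : S.IsHermitian) (e : Fin n → ℝ) {d D : ℝ}
    (h1 : ∀ y : Fin n → ℝ, e ⬝ᵥ y = 0 → y ⬝ᵥ (S *ᵥ y) ≤ d * (y ⬝ᵥ y))
    (h2 : ∀ y : Fin n → ℝ, y ⬝ᵥ (S *ᵥ y) ≤ D * (y ⬝ᵥ y)) :
    Multiset.Rel (· ≤ ·) S.charpoly.roots (D ::ₘ Multiset.replicate (n - 1) d) := by
  classical
  set v : Fin n → Fin n → ℝ := fun i => ⇑(hS.eigenvectorBasis i) with hv
  have hvv : ∀ i j, v i ⬝ᵥ v j = if i = j then 1 else 0 := by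
    intro i j
    have := (orthonormal_iff_ite.1 hS.eigenvectorBasis.orthonormal) j i
    rw [EuclideanSpace.inner_eq_star_dotProduct] at this
    simp only [star_trivial] at this
    rw [hv]
    simp only
    rw [this]
    simp [eq_comm]
  have hSv : ∀ i, S *ᵥ v i = hS.eigenvalues i • v i := fun i => hS.mulVec_eigenvectorBasis i
  have hD : ∀ i, hS.eigenvalues i ≤ D := by
    intro i
    have := h2 (v i)
    rw [hSv, dotProduct_smul, hvv] at this
    simpa using this
  have hd : ∃ i₀, ∀ j, j ≠ i₀ → hS.eigenvalues j ≤ d := by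
    by_cases hex : ∃ i₀, d < hS.eigenvalues i₀
    · obtain ⟨i₀, hi₀⟩ := hex
      refine ⟨i₀, fun j hj => ?_⟩
      by_contra hcon
      push Not at hcon
      set a := e ⬝ᵥ v j with ha
      set b := e ⬝ᵥ v i₀ with hb
      -- This combination of the two eigenvectors is orthogonal to `e`; if `a = 0`, then `v j` alone
      -- already is.
      have h3 := h1 (a • v i₀ - b • v j) (by
        rw [dotProduct_sub, dotProduct_smul, dotProduct_smul, ← ha, ← hb]; simp [mul_comm])
      have h4 := h1 (v j)
      rw [mulVec_sub, mulVec_smul, mulVec_smul, hSv, hSv] at h3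
      simp only [dotProduct_sub, sub_dotProduct, dotProduct_smul, smul_dotProduct, hvv,
        if_neg hj, if_neg hj.symm, if_true, smul_eq_mul] at h3
      rw [hSv, dotProduct_smul, hvv] at h4
      by_cases ha0 : a = 0
      · have := h4 ha0
        simp at this
        linarith
      · have : 0 < a ^ 2 := by positivity
        nlinarith [mul_pos this (sub_pos.2 hi₀), mul_nonneg (sq_nonneg b) (sub_pos.2 hcon).le]
    · push Not at hex
      exact ⟨⟨0, hn⟩, fun j _ => hex j⟩
  obtain ⟨i₀, hi₀⟩ := hd
  rw [hS.roots_charpoly_eq_eigenvalues]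
  have huniv : (Finset.univ : Finset (Fin n)).val = i₀ ::ₘ (Finset.univ.erase i₀).val := by
    rw [Finset.erase_val, Multiset.cons_erase (Finset.mem_univ i₀)]
  rw [huniv, Multiset.map_cons]
  refine Multiset.Rel.cons (hD i₀) ?_
  rw [Multiset.rel_replicate_right]
  refine ⟨by simp, ?_⟩
  intro x hx
  rw [Multiset.mem_map] at hx
  obtain ⟨j, hj, rfl⟩ := hx
  exact hi₀ j (Finset.ne_of_mem_erase (show j ∈ Finset.univ.erase i₀ from hj))

lemma roots_charpoly_scalar_add_rankOne {n : ℕ} (hn : 1 ≤ n) (e : Fin n → ℝ) (he : e ⬝ᵥ e = 1)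
    (c d : ℝ) :
    (d • (1 : Matrix (Fin n) (Fin n) ℝ) + c • vecMulVec e e).charpoly.roots =
      (d + c) ::ₘ Multiset.replicate (n - 1) d := by
  have h1 : d • (1 : Matrix (Fin n) (Fin n) ℝ) + c • vecMulVec e e =
      vecMulVec (c • e) e - scalar (Fin n) (-d) := by
    ext i j
    simp [vecMulVec_apply, Matrix.one_apply, Matrix.diagonal_apply]
    split_ifs <;> ring
  rw [h1, charpoly_sub_scalar, charpoly_vecMulVec]
  obtain ⟨m, rfl⟩ : ∃ m, n = m + 1 := ⟨n - 1, by omega⟩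
  have h2 : ((X : ℝ[X]) ^ Fintype.card (Fin (m + 1)) -
      ((c • e) ⬝ᵥ e) • X ^ (Fintype.card (Fin (m + 1)) - 1)).comp (X + C (-d)) =
      (((d + c) ::ₘ Multiset.replicate m d).map fun a => X - C a).prod := by
    simp [he, smul_dotProduct, sub_eq_add_neg, smul_eq_C_mul]
    ring
  rw [h2, roots_multiset_prod_X_sub_C]
  rfl

lemma trace_eq_esymm_one_roots {n : ℕ} {M : Matrix (Fin n) (Fin n) ℝ}
    (h : Multiset.card M.charpoly.roots = n) : M.trace = M.charpoly.roots.esymm 1 := by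
  rw [Multiset.esymm_one_eq_sum, Matrix.trace_eq_sum_roots_charpoly_of_splits]
  rw [splits_iff_card_roots, h, charpoly_natDegree_eq_dim, Fintype.card_fin]

end MatrixSpectrum

/-! ### First and second order conditions at a contact with a radial function. -/

section RadialCalculus

open scoped InnerProductSpace

variable {E : Type*} [NormedAddCommGroup E] [InnerProductSpace ℝ E]

lemma hasFDerivAt_norm_of_ne_zero {x : E} (hx : x ≠ 0) :
    HasFDerivAt (fun y : E => ‖y‖) (‖x‖⁻¹ • innerSL ℝ x) x := by
  have h1 : HasFDerivAt (fun y : E => ‖y‖ ^ 2) (2 • innerSL ℝ x) x :=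
    (hasStrictFDerivAt_norm_sq x).hasFDerivAt
  have h2 := h1.sqrt (by positivity)
  simp only [Real.sqrt_sq (norm_nonneg _)] at h2
  convert h2 using 1
  rw [← Nat.cast_smul_eq_nsmul ℝ, smul_smul]
  congr 1
  have : ‖x‖ ≠ 0 := norm_ne_zero_iff.2 hx
  push_cast
  field_simp

lemma hasGradientAt_radial [CompleteSpace E] {v : ℝ → ℝ} {v' : ℝ} {x : E} (hx : x ≠ 0)
    (hv : HasDerivAt v v' ‖x‖) : HasGradientAt (fun y : E => v ‖y‖) ((v' / ‖x‖) • x) x := by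
  rw [hasGradientAt_iff_hasFDerivAt]
  have := hv.comp_hasFDerivAt x (hasFDerivAt_norm_of_ne_zero hx)
  refine HasFDerivAt.congr_fderiv (f := fun y : E => v ‖y‖) this ?_
  ext y
  simp [div_eq_mul_inv, mul_assoc]

/-- Second-order necessary condition from the right only: the profiles below have one-sided second
derivatives, so the usual two-sided test does not apply. -/
lemma deriv_nonpos_of_localMax_right {l l' : ℝ → ℝ} {L : ℝ}
    (hmax : ∀ᶠ t in 𝓝[≥] (0 : ℝ), l t ≤ l 0) (hd : ∀ᶠ t in 𝓝[≥] (0 : ℝ), HasDerivAt l (l' t) t)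
    (h0 : l' 0 = 0) (hL : HasDerivWithinAt l' L (Ici 0) 0) : L ≤ 0 := by
  by_contra hcon
  push Not at hcon
  have h1 : Tendsto (slope l' 0) (𝓝[>] 0) (𝓝 L) := by
    have := hasDerivWithinAt_iff_tendsto_slope.1 hL
    simpa using this
  have h2 : ∀ᶠ t in 𝓝[>] (0 : ℝ), 0 < l' t := by
    filter_upwards [h1.eventually_const_lt hcon, self_mem_nhdsWithin] with t ht ht0
    rw [slope_def_field, h0, sub_zero, sub_zero] at ht
    have ht0 : (0 : ℝ) < t := ht0
    exact (div_pos_iff_of_pos_right ht0).1 ht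
  rw [eventually_nhdsWithin_iff] at hmax hd h2
  obtain ⟨δ, hδ, hball⟩ := Metric.eventually_nhds_iff.1 (hmax.and (hd.and h2))
  have hmem : ∀ t ∈ Icc (0 : ℝ) (δ / 2), dist t 0 < δ := by
    intro t ht
    rw [Real.dist_eq, sub_zero, abs_of_nonneg ht.1]
    linarith [ht.2]
  have hmono : StrictMonoOn l (Icc 0 (δ / 2)) := by
    refine strictMonoOn_of_deriv_pos (convex_Icc _ _) ?_ ?_
    · intro t ht
      exact ((hball (hmem t ht)).2.1 ht.1).continuousAt.continuousWithinAt
    · intro t ht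
      rw [interior_Icc] at ht
      have := hball (hmem t ⟨ht.1.le, ht.2.le⟩)
      rw [(this.2.1 ht.1.le).deriv]
      exact this.2.2 ht.1
  have h3 := hmono (left_mem_Icc.2 (by linarith)) (right_mem_Icc.2 (by linarith))
    (by linarith : (0 : ℝ) < δ / 2)
  have h4 := (hball (hmem (δ / 2) ⟨by linarith, le_rfl⟩)).1 (by simp; linarith)
  linarith

/-- The factor `t` makes continuity of `c` enough. Along tangential lines `c` contains `v'`, which
need not be differentiable. -/
lemma hasDerivAt_id_mul_of_continuousAt {c : ℝ → ℝ} (hc : ContinuousAt c 0) :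
    HasDerivAt (fun t => t * c t) (c 0) 0 := by
  rw [hasDerivAt_iff_tendsto_slope]
  have : Tendsto c (𝓝[≠] 0) (𝓝 (c 0)) := hc.tendsto.mono_left nhdsWithin_le_nhds
  refine this.congr' ?_
  filter_upwards [self_mem_nhdsWithin] with t ht
  have ht : t ≠ 0 := ht
  rw [slope_def_field]
  field_simp
  ring

lemma eventually_line {P : E → Prop} {x : E} (z : E) (h : ∀ᶠ y in 𝓝 x, P y) :
    ∀ᶠ t in 𝓝 (0 : ℝ), P (x + t • z) := by
  have : ContinuousAt (fun t : ℝ => x + t • z) 0 := by fun_prop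
  apply this.eventually
  simpa using h

variable [CompleteSpace E]

lemma gradient_eq_of_isLocalMax_sub_radial {u : E → ℝ} {v : ℝ → ℝ} {v' : ℝ} {x : E} (hx : x ≠ 0)
    (hu : DifferentiableAt ℝ u x) (hv : HasDerivAt v v' ‖x‖)
    (hmax : IsLocalMax (fun y => u y - v ‖y‖) x) : gradient u x = (v' / ‖x‖) • x := by
  have h1 := hu.hasGradientAt.hasFDerivAt
  have h2 := (hasGradientAt_radial hx hv).hasFDerivAt
  have h3 := hmax.hasFDerivAt_eq_zero (h1.sub h2)
  rw [sub_eq_zero] at h3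
  exact (InnerProductSpace.toDual ℝ E).injective h3

lemma hasDerivAt_line {u : E → ℝ} {v : ℝ → ℝ} {v' : ℝ} {x z : E} {t : ℝ}
    (hx : x + t • z ≠ 0) (hu : DifferentiableAt ℝ u (x + t • z))
    (hv : HasDerivAt v v' ‖x + t • z‖) :
    HasDerivAt (fun t : ℝ => u (x + t • z) - v ‖x + t • z‖)
      (⟪gradient u (x + t • z), z⟫_ℝ - v' / ‖x + t • z‖ * ⟪x + t • z, z⟫_ℝ) t := by
  have hl : HasDerivAt (fun t : ℝ => x + t • z) z t := by
    simpa using ((hasDerivAt_id t).smul_const z).const_add x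
  have h1 := (hu.hasGradientAt.hasFDerivAt).comp_hasDerivAt t hl
  have h2 := ((hasGradientAt_radial hx hv).hasFDerivAt).comp_hasDerivAt t hl
  refine HasDerivAt.congr_deriv (f := fun t : ℝ => u (x + t • z) - v ‖x + t • z‖) (h1.sub h2) ?_
  simp only [InnerProductSpace.toDual_apply_apply, inner_smul_left, conj_trivial]

/-- The data of a contact of `u` from below by a radial function. -/
structure RadialContact (u : E → ℝ) (v vp : ℝ → ℝ) (H : E →L[ℝ] E) (x : E) : Prop where
  ne_zero : x ≠ 0
  diff : ∀ᶠ y in 𝓝 x, DifferentiableAt ℝ u y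
  hess : HasFDerivAt (gradient u) H x
  profile : ∀ᶠ ρ in 𝓝 ‖x‖, HasDerivAt v (vp ρ) ρ
  cont : ContinuousAt vp ‖x‖
  max : IsLocalMax (fun y => u y - v ‖y‖) x

namespace RadialContact

variable {u : E → ℝ} {v vp : ℝ → ℝ} {H : E →L[ℝ] E} {x : E}

lemma gradient_eq (h : RadialContact u v vp H x) : gradient u x = (vp ‖x‖ / ‖x‖) • x :=
  gradient_eq_of_isLocalMax_sub_radial h.ne_zero h.diff.self_of_nhds h.profile.self_of_nhds h.max

lemma line_deriv (h : RadialContact u v vp H x) (z : E) :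
    ∀ᶠ t in 𝓝 (0 : ℝ), HasDerivAt (fun t : ℝ => u (x + t • z) - v ‖x + t • z‖)
      (⟪gradient u (x + t • z), z⟫_ℝ - vp ‖x + t • z‖ / ‖x + t • z‖ * ⟪x + t • z, z⟫_ℝ) t := by
  have h1 : ∀ᶠ y in 𝓝 x, HasDerivAt v (vp ‖y‖) ‖y‖ :=
    continuous_norm.continuousAt.eventually h.profile
  have h2 : ∀ᶠ y in 𝓝 x, y ≠ 0 := isOpen_ne.mem_nhds h.ne_zero
  filter_upwards [eventually_line z h1, eventually_line z h2, eventually_line z h.diff]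
    with t ht1 ht2 ht3
  exact hasDerivAt_line ht2 ht3 ht1

lemma hess_line (h : RadialContact u v vp H x) (z : E) :
    HasDerivAt (fun t : ℝ => ⟪gradient u (x + t • z), z⟫_ℝ) ⟪H z, z⟫_ℝ 0 := by
  have hl : HasDerivAt (fun t : ℝ => x + t • z) z 0 := by
    simpa using ((hasDerivAt_id (0 : ℝ)).smul_const z).const_add x
  have hH : HasFDerivAt (gradient u) H (x + (0 : ℝ) • z) := by simpa using h.hess
  have h1 := hH.comp_hasDerivAt (0 : ℝ) hl
  simpa using h1.inner ℝ (hasDerivAt_const (0 : ℝ) z)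

lemma deriv_zero (h : RadialContact u v vp H x) (z : E) :
    ⟪gradient u (x + (0 : ℝ) • z), z⟫_ℝ -
      vp ‖x + (0 : ℝ) • z‖ / ‖x + (0 : ℝ) • z‖ * ⟪x + (0 : ℝ) • z, z⟫_ℝ = 0 := by
  simp [h.gradient_eq, inner_smul_left]

lemma max_line (h : RadialContact u v vp H x) (z : E) :
    ∀ᶠ t in 𝓝[≥] (0 : ℝ), u (x + t • z) - v ‖x + t • z‖ ≤
      u (x + (0 : ℝ) • z) - v ‖x + (0 : ℝ) • z‖ := by
  have := eventually_line z h.max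
  simp only [zero_smul, add_zero]
  exact this.filter_mono nhdsWithin_le_nhds

/-- No derivative of `vp` is required, since the radius changes only to second order along `z`. This
covers points where `e' = 0`, at which `vp` may fail to be differentiable. -/
lemma hess_tangential_le (h : RadialContact u v vp H x) {z : E} (hz : ⟪x, z⟫_ℝ = 0) :
    ⟪H z, z⟫_ℝ ≤ vp ‖x‖ / ‖x‖ * ‖z‖ ^ 2 := by
  have hx : ‖x‖ ≠ 0 := norm_ne_zero_iff.2 h.ne_zero
  have hc : ContinuousAt (fun t : ℝ => vp ‖x + t • z‖ / ‖x + t • z‖ * ‖z‖ ^ 2) 0 := by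
    have h1 : ContinuousAt (fun t : ℝ => ‖x + t • z‖) 0 := by fun_prop
    have h2 : ContinuousAt (fun t : ℝ => vp ‖x + t • z‖) 0 :=
      ContinuousAt.comp (f := fun t : ℝ => ‖x + t • z‖) (g := vp) (by simpa using h.cont) h1
    exact (h2.div h1 (by simpa using h.ne_zero)).mul continuousAt_const
  have h2 := (h.hess_line z).sub (hasDerivAt_id_mul_of_continuousAt hc)
  have h3 := deriv_nonpos_of_localMax_right (h.max_line z)
    ((h.line_deriv z).filter_mono nhdsWithin_le_nhds) (h.deriv_zero z)
    (L := ⟪H z, z⟫_ℝ - vp ‖x‖ / ‖x‖ * ‖z‖ ^ 2) (by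
      refine HasDerivAt.hasDerivWithinAt ?_
      convert h2 using 1
      · ext t
        simp only [Pi.sub_apply, inner_add_left, hz, inner_smul_left, real_inner_self_eq_norm_sq,
          zero_add]
        simp only [conj_trivial]
        ring
      · simp)
  linarith

lemma hess_le (h : RadialContact u v vp H x) {w : ℝ}
    (hw : HasDerivWithinAt vp w (Ici ‖x‖) ‖x‖) (z : E) :
    ⟪H z, z⟫_ℝ ≤ w * (⟪x, z⟫_ℝ / ‖x‖) ^ 2 +
      vp ‖x‖ / ‖x‖ * (‖z‖ ^ 2 - (⟪x, z⟫_ℝ / ‖x‖) ^ 2) := by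
  -- The bound is even in `z`. With this sign the line moves outward for `t ≥ 0`, where the right
  -- derivative of `vp` can be used.
  wlog hz : 0 ≤ ⟪x, z⟫_ℝ generalizing z
  · have := this (-z) (by rw [inner_neg_right]; linarith)
    simpa [inner_neg_right, neg_div] using this
  have hx : ‖x‖ ≠ 0 := norm_ne_zero_iff.2 h.ne_zero
  have hl : HasDerivAt (fun t : ℝ => x + t • z) z 0 := by
    simpa using ((hasDerivAt_id (0 : ℝ)).smul_const z).const_add x
  have hn : HasDerivAt (fun t : ℝ => ‖x + t • z‖) (⟪x, z⟫_ℝ / ‖x‖) 0 := by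
    have h0 : HasFDerivAt (fun y : E => ‖y‖) (‖x‖⁻¹ • innerSL ℝ x) (x + (0 : ℝ) • z) := by
      simpa using hasFDerivAt_norm_of_ne_zero h.ne_zero
    refine HasDerivAt.congr_deriv (f := fun t : ℝ => ‖x + t • z‖) (h0.comp_hasDerivAt (0 : ℝ) hl) ?_
    simp [div_eq_inv_mul]
  have hmaps : MapsTo (fun t : ℝ => ‖x + t • z‖) (Ici 0) (Ici ‖x‖) := by
    intro t ht
    have ht : 0 ≤ t := ht
    have h1 : ‖x‖ ^ 2 ≤ ‖x + t • z‖ ^ 2 := by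
      rw [norm_add_sq_real, inner_smul_right]
      nlinarith [mul_nonneg ht hz, sq_nonneg ‖t • z‖]
    exact (pow_le_pow_iff_left₀ (norm_nonneg _) (norm_nonneg _) two_ne_zero).1 h1
  have hq : HasDerivWithinAt (fun ρ => vp ρ / ρ) ((w * ‖x‖ - vp ‖x‖ * 1) / ‖x‖ ^ 2)
      (Ici ‖x‖) ‖x‖ := hw.div (hasDerivWithinAt_id _ _) hx
  have hq' : HasDerivWithinAt (fun t : ℝ => vp ‖x + t • z‖ / ‖x + t • z‖)
      ((w * ‖x‖ - vp ‖x‖ * 1) / ‖x‖ ^ 2 * (⟪x, z⟫_ℝ / ‖x‖)) (Ici 0) 0 := by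
    refine HasDerivWithinAt.comp (h₂ := fun ρ => vp ρ / ρ) (h := fun t : ℝ => ‖x + t • z‖)
      (s' := Ici ‖x‖) 0 ?_ hn.hasDerivWithinAt hmaps
    simpa using hq
  have hin : HasDerivAt (fun t : ℝ => ⟪x + t • z, z⟫_ℝ) (‖z‖ ^ 2) 0 := by
    have := hl.inner ℝ (hasDerivAt_const (0 : ℝ) z)
    simpa using this
  have h2 := (h.hess_line z).hasDerivWithinAt.sub (hq'.mul hin.hasDerivWithinAt)
  have h3 := deriv_nonpos_of_localMax_right (h.max_line z)
    ((h.line_deriv z).filter_mono nhdsWithin_le_nhds) (h.deriv_zero z) h2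
  simp only [zero_smul, add_zero] at h3
  have h4 : (w * ‖x‖ - vp ‖x‖ * 1) / ‖x‖ ^ 2 * (⟪x, z⟫_ℝ / ‖x‖) * ⟪x, z⟫_ℝ +
      vp ‖x‖ / ‖x‖ * ‖z‖ ^ 2 = w * (⟪x, z⟫_ℝ / ‖x‖) ^ 2 +
      vp ‖x‖ / ‖x‖ * (‖z‖ ^ 2 - (⟪x, z⟫_ℝ / ‖x‖) ^ 2) := by
    field_simp
    ring
  linarith

end RadialContact

end RadialCalculus

/-! ### Comparison of the flux eigenvalues at a contact point. -/

section Contact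

open scoped InnerProductSpace

lemma eigenvalueMultiset_fluxMatrix_eq {n : ℕ} {A : ℝ → ℝ} {u : EuclideanSpace ℝ (Fin n) → ℝ}
    {x : EuclideanSpace ℝ (Fin n)} {L : EuclideanSpace ℝ (Fin n) →L[ℝ] EuclideanSpace ℝ (Fin n)}
    (hL : HasFDerivAt (fluxField A u) L x) :
    eigenvalueMultiset (fluxMatrix A u x) =
      (LinearMap.toMatrix (EuclideanSpace.basisFun (Fin n) ℝ).toBasis
        (EuclideanSpace.basisFun (Fin n) ℝ).toBasis (L : EuclideanSpace ℝ (Fin n) →ₗ[ℝ]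
          EuclideanSpace ℝ (Fin n))).charpoly.roots := by
  -- `fluxMatrix` is the transpose of the Jacobian, since its row index is the direction of
  -- differentiation.
  rw [eigenvalueMultiset, ← Matrix.charpoly_transpose]
  congr 2
  ext i j
  simp [fluxMatrix, LinearMap.toMatrix_apply, hL.fderiv]

/-- The square root of the matrix `α I + (β - α) e ⊗ e`. -/
noncomputable def rankOneRoot {E : Type*} [NormedAddCommGroup E] [InnerProductSpace ℝ E]
    (α β : ℝ) (e : E) : E →ₗ[ℝ] E :=
  √α • LinearMap.id + (√β - √α) • ((innerₛₗ ℝ e).smulRight e)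

section Root

variable {E : Type*} [NormedAddCommGroup E] [InnerProductSpace ℝ E] {α β : ℝ} {e : E}

lemma rankOneRoot_apply (y : E) :
    rankOneRoot α β e y = √α • y + ((√β - √α) * ⟪e, y⟫_ℝ) • e := by
  simp [rankOneRoot, smul_smul]

lemma inner_rankOneRoot (he : ‖e‖ = 1) (y : E) : ⟪e, rankOneRoot α β e y⟫_ℝ = √β * ⟪e, y⟫_ℝ := by
  rw [rankOneRoot_apply, inner_add_right, inner_smul_right, inner_smul_right,
    real_inner_self_eq_norm_sq, he]
  ring

lemma rankOneRoot_rankOneRoot (hα : 0 ≤ α) (hβ : 0 ≤ β) (he : ‖e‖ = 1) (y : E) :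
    rankOneRoot α β e (rankOneRoot α β e y) = α • y + ((β - α) * ⟪e, y⟫_ℝ) • e := by
  rw [rankOneRoot_apply, inner_rankOneRoot he, rankOneRoot_apply, smul_add, smul_smul, smul_smul,
    add_assoc, ← add_smul]
  congr 2
  · exact Real.mul_self_sqrt hα
  · have h1 := Real.mul_self_sqrt hα
    have h2 := Real.mul_self_sqrt hβ
    linear_combination ⟪e, y⟫_ℝ * h2 - ⟪e, y⟫_ℝ * h1

lemma norm_sq_rankOneRoot (hα : 0 ≤ α) (hβ : 0 ≤ β) (he : ‖e‖ = 1) (y : E) :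
    ‖rankOneRoot α β e y‖ ^ 2 = α * (‖y‖ ^ 2 - ⟪e, y⟫_ℝ ^ 2) + β * ⟪e, y⟫_ℝ ^ 2 := by
  rw [rankOneRoot_apply, norm_add_sq_real, norm_smul, norm_smul, inner_smul_left, inner_smul_right,
    he, mul_one, mul_pow, Real.norm_eq_abs, Real.norm_eq_abs, sq_abs, sq_abs, Real.sq_sqrt hα,
    real_inner_comm e y]
  have h1 := Real.sq_sqrt hα
  have h2 := Real.sq_sqrt hβ
  simp only [conj_trivial]
  linear_combination ⟪e, y⟫_ℝ ^ 2 * h2 - ⟪e, y⟫_ℝ ^ 2 * h1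

lemma rankOneRoot_isSymmetric : (rankOneRoot α β e).IsSymmetric := by
  intro y z
  simp only [rankOneRoot_apply, inner_add_left, inner_add_right, inner_smul_left, inner_smul_right,
    conj_trivial, real_inner_comm e y]
  ring

end Root

lemma hasFDerivAt_gradient {n : ℕ} {u : EuclideanSpace ℝ (Fin n) → ℝ}
    {x : EuclideanSpace ℝ (Fin n)} (hu : ContDiffAt ℝ 2 u x) :
    ∃ H : EuclideanSpace ℝ (Fin n) →L[ℝ] EuclideanSpace ℝ (Fin n),
      HasFDerivAt (gradient u) H x ∧ ∀ y z, ⟪H y, z⟫_ℝ = ⟪y, H z⟫_ℝ := by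
  set T : (EuclideanSpace ℝ (Fin n) →L[ℝ] ℝ) →L[ℝ] EuclideanSpace ℝ (Fin n) :=
    LinearMap.toContinuousLinearMap
      { toFun := (InnerProductSpace.toDual ℝ (EuclideanSpace ℝ (Fin n))).symm
        map_add' := fun y z => map_add _ y z
        map_smul' := fun c y => by simp } with hT
  have h1 : DifferentiableAt ℝ (fderiv ℝ u) x :=
    (hu.fderiv_right (m := 1) (by norm_num)).differentiableAt (by norm_num)
  have h2 : HasFDerivAt (gradient u)
      (T.comp (fderiv ℝ (fderiv ℝ u) x)) x :=
    T.hasFDerivAt.comp x h1.hasFDerivAt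
  refine ⟨_, h2, fun y z => ?_⟩
  have hs : IsSymmSndFDerivAt ℝ u x := hu.isSymmSndFDerivAt (by simp)
  rw [real_inner_comm _ y]
  have h3 : ∀ y z, ⟪T (fderiv ℝ (fderiv ℝ u) x y), z⟫_ℝ = fderiv ℝ (fderiv ℝ u) x y z := by
    intro y z
    exact InnerProductSpace.toDual_symm_apply
  exact (h3 y z).trans ((hs y z).trans (h3 z y).symm)

/-- The coefficient is left as `(A p + p * a) - A p`, the difference `β - α` of the eigenvalues of
the derivative of `q ↦ A(|q|) q`, to match `rankOneRoot_rankOneRoot`. -/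
lemma hasFDerivAt_fluxField {n : ℕ} {A : ℝ → ℝ} {u : EuclideanSpace ℝ (Fin n) → ℝ}
    {x e : EuclideanSpace ℝ (Fin n)} {H : EuclideanSpace ℝ (Fin n) →L[ℝ] EuclideanSpace ℝ (Fin n)}
    {p a : ℝ} (hH : HasFDerivAt (gradient u) H x) (he : ‖e‖ = 1) (hp : 0 < p)
    (hgrad : gradient u x = p • e) (hA : HasDerivAt A a p) :
    ∃ L : EuclideanSpace ℝ (Fin n) →L[ℝ] EuclideanSpace ℝ (Fin n),
      HasFDerivAt (fluxField A u) L x ∧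
      ∀ y, L y = A p • H y + ((A p + p * a - A p) * ⟪e, H y⟫_ℝ) • e := by
  have hnorm : ‖gradient u x‖ = p := by rw [hgrad, norm_smul, he, mul_one, Real.norm_of_nonneg hp.le]
  have h0 : gradient u x ≠ 0 := norm_ne_zero_iff.1 (by rw [hnorm]; exact hp.ne')
  have h1 := (hasFDerivAt_norm_of_ne_zero h0).comp x hH
  have h2 : HasFDerivAt (fun y => A ‖gradient u y‖) _ x :=
    HasDerivAt.comp_hasFDerivAt (h₂ := A) x (by simpa [hnorm] using hA) h1
  refine ⟨_, h2.smul hH, fun y => ?_⟩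
  simp only [_root_.add_apply, _root_.smul_apply,
    ContinuousLinearMap.smulRight_apply, ContinuousLinearMap.comp_apply, innerSL_apply_apply, hgrad,
    inner_smul_left, smul_smul, smul_eq_mul, conj_trivial]
  rw [show ‖p • e‖ = p by rw [← hgrad, hnorm]]
  congr 2
  field_simp
  ring

/-- The Jacobian `R² H` is not symmetric, but it has the characteristic polynomial of the symmetric
`R H R`, whose quadratic form is that of `H` at `R y`. The contact conditions bound it by `d`
radially and by `g/r` tangentially, with `g = e (vp ‖x‖)`. -/
theorem RadialContact.rel_eigenvalues {n : ℕ} (hn : 1 ≤ n) {A : ℝ → ℝ}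
    {u : EuclideanSpace ℝ (Fin n) → ℝ} {v vp : ℝ → ℝ} {x : EuclideanSpace ℝ (Fin n)} {a d : ℝ}
    (e : ℝ ≃o ℝ) (hx : x ≠ 0) (hu : ContDiffAt ℝ 2 u x)
    (hv : ∀ᶠ ρ in 𝓝 ‖x‖, HasDerivAt v (vp ρ) ρ) (hvc : ContinuousAt vp ‖x‖)
    (hp : 0 < vp ‖x‖) (hApos : 0 < A (vp ‖x‖)) (hA : HasDerivAt A a (vp ‖x‖))
    (he : ∀ᶠ p in 𝓝 (vp ‖x‖), e p = p * A p)
    (hd : HasDerivWithinAt (fun ρ => e (vp ρ)) d (Ici ‖x‖) ‖x‖) (hd0 : 0 ≤ d)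
    (hmax : IsLocalMax (fun y => u y - v ‖y‖) x) :
    Multiset.Rel (· ≤ ·) (eigenvalueMultiset (fluxMatrix A u x))
      ((d + e (vp ‖x‖) / ‖x‖) ::ₘ Multiset.replicate (n - 1) (e (vp ‖x‖) / ‖x‖)) := by
  obtain ⟨H, hH, hsymm⟩ := hasFDerivAt_gradient hu
  have hr : 0 < ‖x‖ := norm_pos_iff.2 hx
  have hud : ∀ᶠ y in 𝓝 x, DifferentiableAt ℝ u y := by
    filter_upwards [hu.eventually (by norm_num)] with y hy
    exact hy.differentiableAt (by norm_num)
  have hc : RadialContact u v vp H x := ⟨hx, hud, hH, hv, hvc, hmax⟩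
  set p := vp ‖x‖ with hpdef
  set α := A p with hα
  set β := A p + p * a with hβ
  have hder : HasDerivAt e β p := by
    have : HasDerivAt (fun q => q * A q) (1 * A p + p * a) p := (hasDerivAt_id p).mul hA
    rw [one_mul] at this
    exact this.congr_of_eventuallyEq he
  have hβ0 : 0 ≤ β := by
    rw [← hder.deriv]
    exact e.monotone.deriv_nonneg
  set ê := ‖x‖⁻¹ • x with hê
  have hê1 : ‖ê‖ = 1 := by rw [hê, norm_smul, norm_inv, norm_norm, inv_mul_cancel₀ hr.ne']
  have hgrad : gradient u x = p • ê := by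
    rw [hc.gradient_eq, hê, smul_smul, div_eq_mul_inv]
  obtain ⟨L, hL, hLy⟩ := hasFDerivAt_fluxField hH hê1 hp hgrad hA
  set R := rankOneRoot α β ê with hR
  set b := (EuclideanSpace.basisFun (Fin n) ℝ) with hb
  have hLR : (L : EuclideanSpace ℝ (Fin n) →ₗ[ℝ] EuclideanSpace ℝ (Fin n)) =
      R ∘ₗ (R ∘ₗ (H : EuclideanSpace ℝ (Fin n) →ₗ[ℝ] EuclideanSpace ℝ (Fin n))) := by
    ext1 y
    simp only [LinearMap.comp_apply, ContinuousLinearMap.coe_coe]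
    rw [hR, rankOneRoot_rankOneRoot hApos.le hβ0 hê1, hLy]
  set S := LinearMap.toMatrix b.toBasis b.toBasis
    (R ∘ₗ ((H : EuclideanSpace ℝ (Fin n) →ₗ[ℝ] EuclideanSpace ℝ (Fin n)) ∘ₗ R)) with hS
  have hcp : eigenvalueMultiset (fluxMatrix A u x) = S.charpoly.roots := by
    rw [eigenvalueMultiset_fluxMatrix_eq hL, hLR, LinearMap.toMatrix_comp _ b.toBasis,
      Matrix.charpoly_mul_comm, ← LinearMap.toMatrix_comp, LinearMap.comp_assoc]
  rw [hcp]
  have hSsymm : S.IsHermitian := by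
    rw [hS, LinearMap.isHermitian_toMatrix_iff]
    intro y z
    simp only [LinearMap.comp_apply, ContinuousLinearMap.coe_coe]
    rw [hR, rankOneRoot_isSymmetric, hsymm, rankOneRoot_isSymmetric]
  have hquad : ∀ y : Fin n → ℝ, y ⬝ᵥ (S.mulVec y) =
      ⟪H (R (WithLp.toLp 2 y)), R (WithLp.toLp 2 y)⟫_ℝ := by
    intro y
    have h1 := LinearMap.toMatrix_mulVec_repr b.toBasis b.toBasis
      (R ∘ₗ ((H : EuclideanSpace ℝ (Fin n) →ₗ[ℝ] EuclideanSpace ℝ (Fin n)) ∘ₗ R)) (WithLp.toLp 2 y)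
    have h2 : ∀ w, (b.toBasis.repr w : Fin n → ℝ) = w := by intro w; ext i; simp [hb]
    rw [h2, h2, ← hS] at h1
    rw [h1, ← rankOneRoot_isSymmetric, real_inner_comm, EuclideanSpace.inner_eq_star_dotProduct]
    simp [dotProduct_comm]
    rfl
  have hnorm : ∀ y : Fin n → ℝ, y ⬝ᵥ y = ‖WithLp.toLp 2 y‖ ^ 2 := by
    intro y
    rw [← real_inner_self_eq_norm_sq, EuclideanSpace.inner_eq_star_dotProduct]
    simp
  have hxê : ∀ z, ⟪x, z⟫_ℝ / ‖x‖ = ⟪ê, z⟫_ℝ := by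
    intro z; rw [hê, inner_smul_left]; simp [div_eq_inv_mul]
  have hep : e p = p * α := he.self_of_nhds
  have hmain : ∀ y, ⟪H (R y), R y⟫_ℝ ≤ d * ⟪ê, y⟫_ℝ ^ 2 +
      e p / ‖x‖ * (‖y‖ ^ 2 - ⟪ê, y⟫_ℝ ^ 2) := by
    intro y
    -- If `β = e'(p) = 0`, then `R y` is tangential and the tangential bound suffices. If `β > 0`,
    -- then `e.symm` is differentiable at `e p`, and right differentiability passes from the flux to
    -- `vp`.
    rcases hβ0.eq_or_lt with h0 | h0
    · have h1 : ⟪x, R y⟫_ℝ = 0 := by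
        have : ⟪ê, R y⟫_ℝ = 0 := by rw [hR, inner_rankOneRoot hê1, ← h0]; simp
        rw [← hxê, div_eq_zero_iff] at this
        exact this.resolve_right hr.ne'
      have h2 := hc.hess_tangential_le h1
      rw [hR, norm_sq_rankOneRoot hApos.le hβ0 hê1, ← hR, ← hpdef, ← h0] at h2
      rw [hep]
      calc _ ≤ _ := h2
        _ = p * α / ‖x‖ * (‖y‖ ^ 2 - ⟪ê, y⟫_ℝ ^ 2) := by ring
        _ ≤ _ := by nlinarith [mul_nonneg hd0 (sq_nonneg ⟪ê, y⟫_ℝ)]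
    · have hinv : HasDerivAt e.symm β⁻¹ (e p) := by
        refine HasDerivAt.of_local_left_inverse (f := e) e.symm.continuous.continuousAt ?_ h0.ne'
          (Eventually.of_forall fun z => e.apply_symm_apply z)
        rwa [e.symm_apply_apply]
      have hw : HasDerivWithinAt vp (β⁻¹ * d) (Ici ‖x‖) ‖x‖ := by
        have := HasDerivAt.comp_hasDerivWithinAt (h₂ := e.symm) ‖x‖ hinv hd
        refine this.congr_of_mem (fun ρ _ => ?_) self_mem_Ici
        simp
      have h2 := hc.hess_le hw (R y)
      rw [hxê, hR, norm_sq_rankOneRoot hApos.le hβ0 hê1, inner_rankOneRoot hê1, mul_pow,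
        Real.sq_sqrt hβ0, ← hR, ← hpdef] at h2
      rw [hep]
      refine h2.trans (le_of_eq ?_)
      field_simp
      ring
  have hcs : ∀ y, ⟪ê, y⟫_ℝ ^ 2 ≤ ‖y‖ ^ 2 := by
    intro y
    have := abs_real_inner_le_norm ê y
    rw [hê1, one_mul] at this
    exact sq_le_sq' (abs_le.1 this).1 (abs_le.1 this).2
  have hep0 : 0 ≤ e p / ‖x‖ := by rw [hep]; positivity
  refine rel_roots_charpoly_of_quadratic_bound hn hSsymm (ê : Fin n → ℝ) ?_ ?_
  · intro y hy
    have h1 : ⟪ê, WithLp.toLp 2 y⟫_ℝ = 0 := by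
      rw [EuclideanSpace.inner_eq_star_dotProduct]; simpa [dotProduct_comm] using hy
    have h2 := hmain (WithLp.toLp 2 y)
    rw [h1] at h2
    rw [hquad, hnorm]
    simpa using h2
  · intro y
    rw [hquad, hnorm]
    refine (hmain _).trans ?_
    have := hcs (WithLp.toLp 2 y)
    nlinarith [mul_nonneg hep0 (sq_nonneg ⟪ê, WithLp.toLp 2 y⟫_ℝ), mul_le_mul_of_nonneg_left this hd0]

end Contact

/-! ### Integral comparison with a radial function of linear flux. -/

section WeakComparison

open scoped InnerProductSpace

/-- Squaring the positive part makes the test function of `weak_comparison` `C¹`, so classical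
integration by parts applies. -/
lemma hasDerivAt_max_sq (t : ℝ) : HasDerivAt (fun t : ℝ => (max t 0) ^ 2) (2 * max t 0) t := by
  rcases lt_trichotomy t 0 with h | rfl | h
  · have : (fun t : ℝ => (max t 0) ^ 2) =ᶠ[𝓝 t] fun _ => 0 := by
      filter_upwards [eventually_lt_nhds h] with s hs
      simp [max_eq_right hs.le]
    rw [max_eq_right h.le, mul_zero]
    exact (hasDerivAt_const t (0 : ℝ)).congr_of_eventuallyEq this
  · have h1 : ContinuousAt (fun t : ℝ => max t 0 * (max t 0 / t)) 0 := by
      have : (fun t : ℝ => max t 0 * (max t 0 / t)) = fun t => max t 0 := by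
        ext t
        rcases le_or_gt t 0 with h | h
        · simp [max_eq_right h]
        · rw [max_eq_left h.le, div_self h.ne', mul_one]
      rw [this]
      fun_prop
    have h2 := hasDerivAt_id_mul_of_continuousAt h1
    simp only [max_self, mul_zero, zero_mul] at h2 ⊢
    refine h2.congr_of_eventuallyEq (Eventually.of_forall fun t => ?_)
    rcases eq_or_ne t 0 with rfl | h
    · simp
    · field_simp
  · have : (fun t : ℝ => (max t 0) ^ 2) =ᶠ[𝓝 t] fun t => t ^ 2 := by
      filter_upwards [eventually_gt_nhds h] with s hs
      simp [max_eq_left hs.le]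
    rw [max_eq_left h.le]
    have h2 : HasDerivAt (fun t : ℝ => t ^ 2) (2 * t) t := by simpa using hasDerivAt_pow 2 t
    exact h2.congr_of_eventuallyEq this

lemma contDiff_max_sq : ContDiff ℝ 1 (fun t : ℝ => (max t 0) ^ 2) := by
  rw [contDiff_one_iff_deriv]
  refine ⟨fun t => (hasDerivAt_max_sq t).differentiableAt, ?_⟩
  rw [show deriv (fun t : ℝ => (max t 0) ^ 2) = fun t => 2 * max t 0 from
    funext fun t => (hasDerivAt_max_sq t).deriv]
  fun_prop

lemma hasGradientAt_radial_of_deriv_zero {E : Type*} [NormedAddCommGroup E] [InnerProductSpace ℝ E]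
    [CompleteSpace E] {v vp : ℝ → ℝ} (hv : ∀ r, 0 ≤ r → HasDerivAt v (vp r) r) (h0 : vp 0 = 0)
    (x : E) : HasGradientAt (fun y : E => v ‖y‖) ((vp ‖x‖ / ‖x‖) • x) x := by
  rcases eq_or_ne x 0 with rfl | hx
  · rw [smul_zero, hasGradientAt_iff_hasFDerivAt, map_zero, hasFDerivAt_iff_isLittleO_nhds_zero]
    have h1 := hv 0 le_rfl
    rw [h0, hasDerivAt_iff_isLittleO_nhds_zero] at h1
    have h2 : Tendsto (fun x : E => ‖x‖) (𝓝 0) (𝓝 0) := by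
      simpa using (continuous_norm (E := E)).tendsto 0
    have h3 := h1.comp_tendsto h2
    simp only [Function.comp_def, zero_add, smul_zero, sub_zero] at h3
    simpa using h3.of_norm_right
  · exact hasGradientAt_radial hx (hv _ (norm_nonneg x))

lemma continuous_radial_field {E : Type*} [NormedAddCommGroup E] [InnerProductSpace ℝ E]
    {vp : ℝ → ℝ} (hc : Continuous vp) (h0 : vp 0 = 0) :
    Continuous (fun x : E => (vp ‖x‖ / ‖x‖) • x) := by
  rw [continuous_iff_continuousAt]
  intro x
  rcases eq_or_ne x 0 with rfl | hx
  · rw [ContinuousAt, smul_zero, tendsto_zero_iff_norm_tendsto_zero]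
    have h2 : Tendsto (fun x : E => |vp ‖x‖|) (𝓝 0) (𝓝 0) := by
      have : Continuous (fun x : E => |vp ‖x‖|) := by fun_prop
      simpa [h0] using this.tendsto 0
    refine h2.congr fun x => ?_
    rcases eq_or_ne x 0 with rfl | hx
    · simp [h0]
    · rw [norm_smul, norm_div, norm_norm, Real.norm_eq_abs, div_mul_cancel₀]
      exact norm_ne_zero_iff.2 hx
  · have : ‖x‖ ≠ 0 := norm_ne_zero_iff.2 hx
    fun_prop (disch := assumption)

lemma contDiff_one_radial {E : Type*} [NormedAddCommGroup E] [InnerProductSpace ℝ E]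
    [CompleteSpace E] {v vp : ℝ → ℝ} (hv : ∀ r, 0 ≤ r → HasDerivAt v (vp r) r) (hc : Continuous vp)
    (h0 : vp 0 = 0) : ContDiff ℝ 1 (fun x : E => v ‖x‖) := by
  rw [contDiff_one_iff_fderiv]
  have h1 := fun x : E => (hasGradientAt_radial_of_deriv_zero hv h0 x).hasFDerivAt
  refine ⟨fun x => (h1 x).differentiableAt, ?_⟩
  rw [show fderiv ℝ (fun x : E => v ‖x‖) = fun x => InnerProductSpace.toDual ℝ E _ from
    funext fun x => (h1 x).fderiv]
  exact (InnerProductSpace.toDual ℝ E).continuous.comp (continuous_radial_field hc h0)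

lemma integral_mul_divergence {n : ℕ} {ψ : EuclideanSpace ℝ (Fin n) → ℝ}
    {Y : EuclideanSpace ℝ (Fin n) → EuclideanSpace ℝ (Fin n)} (hψ : ContDiff ℝ 1 ψ)
    (hψs : HasCompactSupport ψ) (hY : ContDiff ℝ 1 Y) :
    ∫ x, ψ x * ∑ i, (fderiv ℝ Y x (EuclideanSpace.single i 1)) i = -∫ x, fderiv ℝ ψ x (Y x) := by
  have hYi : ∀ i, ContDiff ℝ 1 (fun x => Y x i) := fun i => by fun_prop
  have hfd : ∀ i x v, fderiv ℝ (fun x => Y x i) x v = (fderiv ℝ Y x v) i := by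
    intro i x v
    have h1 : HasFDerivAt Y (fderiv ℝ Y x) x := (hY.differentiable (by norm_num) x).hasFDerivAt
    have h2 := (EuclideanSpace.proj (𝕜 := ℝ) i).hasFDerivAt.comp x h1
    have h3 : HasFDerivAt (fun x => Y x i) _ x := h2
    rw [h3.fderiv]
    rfl
  have hcψ' : Continuous (fderiv ℝ ψ) := hψ.continuous_fderiv (by norm_num)
  have hcY' : Continuous (fderiv ℝ Y) := hY.continuous_fderiv (by norm_num)
  have hi : ∀ i, Integrable (fun x => ψ x * fderiv ℝ (fun x => Y x i) x (EuclideanSpace.single i 1)) := by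
    intro i
    refine Continuous.integrable_of_hasCompactSupport ?_ hψs.mul_right
    have := (hYi i).continuous_fderiv (by norm_num)
    have := hψ.continuous
    fun_prop
  have hi' : ∀ i, Integrable (fun x => fderiv ℝ ψ x (EuclideanSpace.single i 1) * Y x i) := by
    intro i
    refine Continuous.integrable_of_hasCompactSupport ?_ ?_
    · have := (hYi i).continuous
      fun_prop
    · exact (hψs.fderiv_apply (𝕜 := ℝ) _).mul_right
  have hparts : ∀ i, ∫ x, ψ x * fderiv ℝ (fun x => Y x i) x (EuclideanSpace.single i 1) =
      -∫ x, fderiv ℝ ψ x (EuclideanSpace.single i 1) * Y x i := by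
    intro i
    refine integral_mul_fderiv_eq_neg_fderiv_mul_of_integrable (hi' i) (hi i) ?_
      (fun x _ => hψ.differentiable (by norm_num) x)
      (fun x _ => (hYi i).differentiable (by norm_num) x)
    refine Continuous.integrable_of_hasCompactSupport ?_ hψs.mul_right
    exact hψ.continuous.mul (hYi i).continuous
  calc ∫ x, ψ x * ∑ i, (fderiv ℝ Y x (EuclideanSpace.single i 1)) i
      = ∫ x, ∑ i, ψ x * fderiv ℝ (fun x => Y x i) x (EuclideanSpace.single i 1) := by
        simp only [Finset.mul_sum, hfd]
    _ = ∑ i, ∫ x, ψ x * fderiv ℝ (fun x => Y x i) x (EuclideanSpace.single i 1) :=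
        integral_finsetSum _ fun i _ => hi i
    _ = -∑ i, ∫ x, fderiv ℝ ψ x (EuclideanSpace.single i 1) * Y x i := by
        simp only [hparts, Finset.sum_neg_distrib]
    _ = -∫ x, ∑ i, fderiv ℝ ψ x (EuclideanSpace.single i 1) * Y x i := by
        rw [integral_finsetSum _ fun i _ => hi' i]
    _ = _ := by
        congr 2
        ext x
        conv_rhs => rw [← (EuclideanSpace.basisFun (Fin n) ℝ).sum_repr (Y x)]
        rw [map_sum]
        refine Finset.sum_congr rfl fun i _ => ?_
        simp [mul_comm]

/-- Monotonicity of the field `q ↦ A(|q|) q`, where `μ x` is the flux of the second gradient.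
Cauchy–Schwarz reduces it to `(e ‖q‖ - μ ‖x‖)(‖q‖ - p) ≥ 0`, which holds because `e` is increasing.
-/
lemma inner_flux_sub_nonneg {E : Type*} [NormedAddCommGroup E] [InnerProductSpace ℝ E]
    (e : ℝ ≃o ℝ) (he0 : e 0 = 0) {a μ : ℝ} {q x : E} (ha : q ≠ 0 → 0 ≤ a) (hμ : 0 ≤ μ)
    (hq : e ‖q‖ = ‖q‖ * a) :
    0 ≤ ⟪q - (e.symm (μ * ‖x‖) / ‖x‖) • x, a • q - μ • x⟫_ℝ := by
  have hs0 : e.symm 0 = 0 := e.symm_apply_eq.2 he0.symm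
  rcases eq_or_ne x 0 with rfl | hx
  · simp only [smul_zero, sub_zero, inner_smul_right, real_inner_self_eq_norm_sq]
    rcases eq_or_ne q 0 with rfl | hq0
    · simp
    · exact mul_nonneg (ha hq0) (sq_nonneg _)
  have hr : 0 < ‖x‖ := norm_pos_iff.2 hx
  set p := e.symm (μ * ‖x‖) with hp
  have hp0 : 0 ≤ p := by
    rw [← hs0]; exact e.symm.monotone (by positivity)
  have hcs : ⟪x, q⟫_ℝ ≤ ‖x‖ * ‖q‖ := real_inner_le_norm x q
  have h1 : ⟪q - (p / ‖x‖) • x, a • q - μ • x⟫_ℝ =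
      a * ‖q‖ ^ 2 - (μ + p / ‖x‖ * a) * ⟪x, q⟫_ℝ + p * μ * ‖x‖ := by
    simp only [inner_sub_left, inner_sub_right, inner_smul_left, inner_smul_right,
      real_inner_self_eq_norm_sq, conj_trivial, real_inner_comm x q]
    field_simp
    ring
  rw [h1]
  have ha' : 0 ≤ a * ‖q‖ := by
    rcases eq_or_ne q 0 with rfl | hq0
    · simp
    · exact mul_nonneg (ha hq0) (norm_nonneg _)
  have h2 : 0 ≤ (e ‖q‖ - μ * ‖x‖) * (‖q‖ - p) := by
    rcases le_total (e ‖q‖) (μ * ‖x‖) with h | h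
    · have : ‖q‖ ≤ p := by rw [hp]; exact (e.le_symm_apply).2 h
      nlinarith
    · have : p ≤ ‖q‖ := by rw [hp]; exact (e.symm_apply_le).2 h
      exact mul_nonneg (by linarith) (by linarith)
  have h3 : (μ + p / ‖x‖ * a) * ⟪x, q⟫_ℝ ≤ (μ + p / ‖x‖ * a) * (‖x‖ * ‖q‖) := by
    rcases eq_or_ne q 0 with rfl | hq0
    · simp
    · have := ha hq0
      gcongr
  have h4 : (μ + p / ‖x‖ * a) * (‖x‖ * ‖q‖) = μ * ‖x‖ * ‖q‖ + p * (a * ‖q‖) := by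
    field_simp
  rw [hq] at h2
  nlinarith

/-- Weak comparison on a ball with the radial function whose flux is `μ x`. -/
theorem weak_comparison {n : ℕ} {A : ℝ → ℝ} (hApos : ∀ p, 0 < p → 0 < A p)
    {u : EuclideanSpace ℝ (Fin n) → ℝ} (hu : ContDiff ℝ 1 u) (hX : ContDiff ℝ 1 (fluxField A u))
    (e : ℝ ≃o ℝ) (he0 : e 0 = 0) {μ ρ M : ℝ} (hμ : 0 ≤ μ) {v : ℝ → ℝ}
    (hv : ∀ r, 0 ≤ r → HasDerivAt v (e.symm (μ * r)) r)
    (heu : ∀ x, ‖x‖ < ρ → e ‖gradient u x‖ = ‖gradient u x‖ * A ‖gradient u x‖)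
    (hdiv : ∀ x, ‖x‖ < ρ → M < u x - v ‖x‖ → n * μ < (fluxMatrix A u x).trace)
    (hbd : ∀ x, ‖x‖ = ρ → u x - v ‖x‖ < M) {x₀ : EuclideanSpace ℝ (Fin n)} (hx₀ : ‖x₀‖ < ρ)
    (hM : M < u x₀ - v ‖x₀‖) : False := by
  have hs0 : e.symm 0 = 0 := e.symm_apply_eq.2 he0.symm
  have hvc : Continuous (fun r => e.symm (μ * r)) := e.symm.continuous.comp (by fun_prop)
  have hV : ContDiff ℝ 1 (fun x : EuclideanSpace ℝ (Fin n) => v ‖x‖) :=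
    contDiff_one_radial hv hvc (by simp [hs0])
  set w : EuclideanSpace ℝ (Fin n) → ℝ := fun x => u x - v ‖x‖ - M with hw
  have hwc : ContDiff ℝ 1 w := (hu.sub hV).sub contDiff_const
  -- Testing `div Y > 0` on `{w > 0}` against this `ψ` gives a positive integral, while integration
  -- by parts and monotonicity make it nonpositive. The cut-off is `C¹` since `w < 0` near the
  -- sphere.
  set ψ : EuclideanSpace ℝ (Fin n) → ℝ := fun x => if ‖x‖ < ρ then (max (w x) 0) ^ 2 else 0
    with hψdef
  have hin : ∀ x, ‖x‖ < ρ → ψ =ᶠ[𝓝 x] fun x => (max (w x) 0) ^ 2 := by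
    intro x hx
    filter_upwards [continuous_norm.continuousAt.eventually_lt continuousAt_const hx] with y hy
    simp [hψdef, hy]
  have hout : ∀ x, ρ ≤ ‖x‖ → ψ =ᶠ[𝓝 x] fun _ => 0 := by
    intro x hx
    rcases hx.eq_or_lt with h | h
    · have : w x < 0 := by have := hbd x h.symm; simp only [hw]; linarith
      filter_upwards [hwc.continuous.continuousAt.eventually_lt continuousAt_const this] with y hy
      simp [hψdef, max_eq_right hy.le]
    · filter_upwards [continuousAt_const.eventually_lt continuous_norm.continuousAt h] with y hy
      simp [hψdef, not_lt.2 hy.le]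
  have hψc : ContDiff ℝ 1 ψ := by
    rw [contDiff_iff_contDiffAt]
    intro x
    rcases lt_or_ge ‖x‖ ρ with h | h
    · exact ((contDiff_max_sq.comp hwc).contDiffAt).congr_of_eventuallyEq (hin x h)
    · exact contDiffAt_const.congr_of_eventuallyEq (hout x h)
  have hψs : HasCompactSupport ψ := by
    refine HasCompactSupport.intro (isCompact_closedBall 0 ρ) fun x hx => ?_
    rw [mem_closedBall_zero_iff, not_le] at hx
    simp [hψdef, not_lt.2 hx.le]
  set Y : EuclideanSpace ℝ (Fin n) → EuclideanSpace ℝ (Fin n) := fun x => fluxField A u x - μ • x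
    with hYdef
  have hY : ContDiff ℝ 1 Y := hX.sub (contDiff_id.const_smul μ)
  have hdivY : ∀ x, ∑ i, (fderiv ℝ Y x (EuclideanSpace.single i 1)) i =
      (fluxMatrix A u x).trace - n * μ := by
    intro x
    have h1 : HasFDerivAt Y (fderiv ℝ (fluxField A u) x -
        μ • ContinuousLinearMap.id ℝ (EuclideanSpace ℝ (Fin n))) x :=
      (hX.differentiable (by norm_num) x).hasFDerivAt.sub ((hasFDerivAt_id x).const_smul μ)
    rw [h1.fderiv]
    simp [Matrix.trace, fluxMatrix]
  have hparts := integral_mul_divergence hψc hψs hY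
  have hgrad : ∀ x, 0 ≤ fderiv ℝ ψ x (Y x) := by
    intro x
    rcases lt_or_ge ‖x‖ ρ with h | h
    · have h1 : HasFDerivAt w (InnerProductSpace.toDual ℝ _ (gradient u x) -
          InnerProductSpace.toDual ℝ _ ((e.symm (μ * ‖x‖) / ‖x‖) • x)) x :=
        ((hu.differentiable (by norm_num) x).hasGradientAt.hasFDerivAt.sub
          (hasGradientAt_radial_of_deriv_zero hv (by simp [hs0]) x).hasFDerivAt).sub_const M
      have h2 := (hasDerivAt_max_sq (w x)).comp_hasFDerivAt x h1
      have h3 := h2.congr_of_eventuallyEq (hin x h)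
      rw [h3.fderiv, ← map_sub]
      simp only [_root_.smul_apply, InnerProductSpace.toDual_apply_apply, smul_eq_mul]
      refine mul_nonneg (by positivity) ?_
      exact inner_flux_sub_nonneg e he0 (fun h0 => (hApos _ (norm_pos_iff.2 h0)).le) hμ (heu x h)
    · rw [(hout x h).fderiv_eq]
      simp
  have hneg : ∫ x, ψ x * ((fluxMatrix A u x).trace - n * μ) ≤ 0 := by
    simp only [hdivY] at hparts
    rw [hparts]
    have : 0 ≤ ∫ x, fderiv ℝ ψ x (Y x) := integral_nonneg hgrad
    linarith
  have hcont : Continuous (fun x => ψ x * ((fluxMatrix A u x).trace - n * μ)) := by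
    have h1 : Continuous (fderiv ℝ Y) := hY.continuous_fderiv (by norm_num)
    have h2 : Continuous (fun x => ∑ i, (fderiv ℝ Y x (EuclideanSpace.single i 1)) i) := by fun_prop
    simp only [hdivY] at h2
    exact hψc.continuous.mul h2
  have hpos : 0 < ∫ x, ψ x * ((fluxMatrix A u x).trace - n * μ) := by
    refine hcont.integral_pos_of_hasCompactSupport_nonneg_nonzero hψs.mul_right ?_ (x := x₀) ?_
    · intro x
      show 0 ≤ ψ x * ((fluxMatrix A u x).trace - n * μ)
      by_cases h : ‖x‖ < ρ
      · by_cases h2 : M < u x - v ‖x‖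
        · have := hdiv x h h2
          refine mul_nonneg ?_ (by linarith)
          simp only [hψdef, if_pos h]; positivity
        · have : w x ≤ 0 := by simp only [hw]; linarith
          simp [hψdef, max_eq_right this]
      · simp [hψdef, h]
    · have h1 : 0 < w x₀ := by simp only [hw]; linarith
      have h2 := hdiv x₀ hx₀ hM
      refine (mul_pos ?_ (by linarith)).ne'
      simp only [hψdef, if_pos hx₀]
      positivity
  linarith

end WeakComparison

/-! ### The functions `p A(p)` and `Ψ` as order isomorphisms, and the derivative of `(p A(p))ᵏ ∘
Ψ⁻¹`. -/

section LegendreTransform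

lemma exists_orderIso_extending {H : ℝ → ℝ} (hc : ContinuousOn H (Ici 0))
    (hm : StrictMonoOn H (Ici 0)) (h0 : H 0 = 0) (ht : Tendsto H atTop atTop) :
    ∃ e : ℝ ≃o ℝ, ∀ p, 0 ≤ p → e p = H p := by
  -- Extending by the identity to the negative axis gives a bijection of `ℝ`, whose inverse is
  -- continuous without side conditions.
  set E : ℝ → ℝ := fun p => H (max p 0) + min p 0 with hE
  have hpos : ∀ p, 0 ≤ p → E p = H p := by
    intro p hp
    simp [hE, max_eq_left hp, min_eq_right hp]
  have hneg : ∀ p, p ≤ 0 → E p = p := by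
    intro p hp
    simp [hE, max_eq_right hp, min_eq_left hp, h0]
  have hmono : StrictMono E := by
    intro p q hpq
    rcases le_or_gt q 0 with hq | hq
    · rw [hneg p (hpq.le.trans hq), hneg q hq]; exact hpq
    · rcases le_or_gt p 0 with hp | hp
      · rw [hneg p hp, hpos q hq.le]
        have := hm self_mem_Ici (mem_Ici.2 hq.le) hq
        linarith
      · rw [hpos p hp.le, hpos q hq.le]
        exact hm (mem_Ici.2 hp.le) (mem_Ici.2 hq.le) hpq
  have hcont : Continuous E := by
    have : Continuous (fun p : ℝ => H (max p 0)) :=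
      hc.comp_continuous (by fun_prop) fun p => le_max_right p 0
    exact this.add (by fun_prop : Continuous fun p : ℝ => min p 0)
  have hsurj : Function.Surjective E := by
    refine hcont.surjective ?_ ?_
    · refine ht.congr' ?_
      filter_upwards [eventually_ge_atTop 0] with p hp using (hpos p hp).symm
    · refine tendsto_id.congr' ?_
      filter_upwards [eventually_le_atBot 0] with p hp using (hneg p hp).symm
  exact ⟨hmono.orderIsoOfSurjective E hsurj, fun p hp => hpos p hp⟩

lemma strictMonoOn_mul_Ici {A : ℝ → ℝ} (hA_pos : ∀ p : ℝ, 0 < p → 0 < A p)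
    (hA_mono : StrictMonoOn (fun p : ℝ => p * A p) (Ioi 0)) :
    StrictMonoOn (fun p : ℝ => p * A p) (Ici 0) := by
  intro p hp q hq hpq
  have hp : 0 ≤ p := hp
  rcases hp.eq_or_lt with rfl | hp0
  · simpa using mul_pos hpq (hA_pos q hpq)
  · exact hA_mono hp0 (hp0.trans hpq) hpq

/-- `e` extends `p ↦ p A(p)` and `ψ` extends `Ψ` from `[0, ∞)` to the real line. -/
structure IsLegendrePair (A : ℝ → ℝ) (k : ℕ) (e ψ : ℝ ≃o ℝ) : Prop where
  e_eq : ∀ p, 0 ≤ p → e p = p * A p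
  psi_eq : ∀ p, 0 ≤ p → ψ p = Psi A k p

namespace IsLegendrePair

variable {A : ℝ → ℝ} {k : ℕ} {e ψ : ℝ ≃o ℝ}

lemma e_zero (h : IsLegendrePair A k e ψ) : e 0 = 0 := by rw [h.e_eq 0 le_rfl, zero_mul]

lemma psi_zero (h : IsLegendrePair A k e ψ) : ψ 0 = 0 := by
  rw [h.psi_eq 0 le_rfl]; simp [Psi]

lemma symm_zero (h : IsLegendrePair A k e ψ) : ψ.symm 0 = 0 := ψ.symm_apply_eq.2 h.psi_zero.symm

lemma e_symm_zero (h : IsLegendrePair A k e ψ) : e.symm 0 = 0 := e.symm_apply_eq.2 h.e_zero.symm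

lemma symm_nonneg (h : IsLegendrePair A k e ψ) {z : ℝ} (hz : 0 ≤ z) : 0 ≤ ψ.symm z := by
  rw [← h.symm_zero]; exact ψ.symm.monotone hz

lemma symm_pos (h : IsLegendrePair A k e ψ) {z : ℝ} (hz : 0 < z) : 0 < ψ.symm z := by
  rw [← h.symm_zero]; exact ψ.symm.strictMono hz

lemma psiInv_eq (h : IsLegendrePair A k e ψ) {z : ℝ} (hz : 0 ≤ z) : PsiInv A k z = ψ.symm z := by
  have hex : ∃ p ∈ Ici (0 : ℝ), Psi A k p = z :=
    ⟨ψ.symm z, h.symm_nonneg hz, by rw [← h.psi_eq _ (h.symm_nonneg hz), ψ.apply_symm_apply]⟩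
  have h1 : PsiInv A k z ∈ Ici (0 : ℝ) := Function.invFunOn_mem hex
  have h2 : Psi A k (PsiInv A k z) = z := Function.invFunOn_eq hex
  rw [← h.psi_eq _ h1] at h2
  exact (ψ.symm_apply_eq.2 h2.symm).symm

lemma e_pos (h : IsLegendrePair A k e ψ) {p : ℝ} (hp : 0 < p) : 0 < e p := by
  rw [← h.e_zero]; exact e.strictMono hp

end IsLegendrePair

lemma Psi_eq_of_extension {A : ℝ → ℝ} {k : ℕ} {e : ℝ ≃o ℝ} (he : ∀ p, 0 ≤ p → e p = p * A p)
    {p : ℝ} (hp : 0 ≤ p) :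
    Psi A k p = p * (e (max p 0)) ^ k - ∫ t in (0 : ℝ)..p, (e (max t 0)) ^ k := by
  rw [Psi, max_eq_left hp, he p hp]
  congr 1
  refine intervalIntegral.integral_congr fun t ht => ?_
  rw [uIcc_of_le hp] at ht
  rw [max_eq_left ht.1, he t ht.1]

/-- With `G = eᵏ`, the difference is `∫ t dG(t)` over `[p, q]`, so the endpoints bound it; no
derivative of `e` enters. -/
lemma Psi_sub_bounds {A : ℝ → ℝ} {k : ℕ} {e : ℝ ≃o ℝ} (he : ∀ p, 0 ≤ p → e p = p * A p)
    {p q : ℝ} (hp : 0 ≤ p) (hpq : p ≤ q) :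
    p * (e q ^ k - e p ^ k) ≤ Psi A k q - Psi A k p ∧
      Psi A k q - Psi A k p ≤ q * (e q ^ k - e p ^ k) := by
  have hq := hp.trans hpq
  have he0 : e 0 = 0 := by rw [he 0 le_rfl, zero_mul]
  set G : ℝ → ℝ := fun t => (e (max t 0)) ^ k with hG
  have hGc : Continuous G := by
    have := e.continuous
    fun_prop
  have hGm : Monotone G := by
    intro s t hst
    have h1 : 0 ≤ e (max s 0) := he0.symm.le.trans (e.monotone (le_max_right s 0))
    exact pow_le_pow_left₀ h1 (e.monotone (max_le_max hst le_rfl)) k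
  have hint : ∀ a b, IntervalIntegrable G volume a b := fun a b => hGc.intervalIntegrable a b
  have h1 : Psi A k q - Psi A k p = q * G q - p * G p - ∫ t in p..q, G t := by
    rw [Psi_eq_of_extension he hp, Psi_eq_of_extension he hq]
    have := intervalIntegral.integral_add_adjacent_intervals (hint 0 p) (hint p q)
    simp only [hG] at this ⊢
    linarith
  have hl : (q - p) * G p ≤ ∫ t in p..q, G t := by
    have := intervalIntegral.integral_mono_on hpq (intervalIntegrable_const (c := G p)) (hint p q)
      fun t ht => hGm ht.1
    simpa using this
  have hu : ∫ t in p..q, G t ≤ (q - p) * G q := by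
    have := intervalIntegral.integral_mono_on hpq (hint p q) (intervalIntegrable_const (c := G q))
      fun t ht => hGm ht.2
    simpa using this
  have e1 : e q ^ k = G q := by simp only [hG, max_eq_left hq]
  have e2 : e p ^ k = G p := by simp only [hG, max_eq_left hp]
  rw [h1, e1, e2]
  constructor <;> nlinarith

lemma exists_legendrePair {A : ℝ → ℝ} {k : ℕ} (hk : 1 ≤ k)
    (hA_pos : ∀ p : ℝ, 0 < p → 0 < A p)
    (hA_cont : ContinuousOn (fun p : ℝ => p * A p) (Ici 0))
    (hA_mono : StrictMonoOn (fun p : ℝ => p * A p) (Ioi 0))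
    (ht : Tendsto (fun p : ℝ => p * A p) atTop atTop) :
    ∃ e ψ : ℝ ≃o ℝ, IsLegendrePair A k e ψ := by
  obtain ⟨e, he⟩ := exists_orderIso_extending hA_cont (strictMonoOn_mul_Ici hA_pos hA_mono)
    (by simp) ht
  have he0 : e 0 = 0 := by rw [he 0 le_rfl, zero_mul]
  have hGlt : ∀ p q, 0 ≤ p → p < q → e p ^ k < e q ^ k := by
    intro p q hp hpq
    refine pow_lt_pow_left₀ (e.strictMono hpq) ?_ (by omega)
    rw [← he0]; exact e.monotone hp
  have hP0 : Psi A k 0 = 0 := by simp [Psi]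
  have hlt : ∀ p q, 0 < p → p < q → Psi A k p < Psi A k q := by
    intro p q hp hpq
    have h1 := (Psi_sub_bounds (k := k) he hp.le hpq.le).1
    have h2 := hGlt p q hp.le hpq
    nlinarith [mul_pos hp (sub_pos.2 h2)]
  have hm : StrictMonoOn (Psi A k) (Ici 0) := by
    intro p hp q _ hpq
    have hp : 0 ≤ p := hp
    rcases hp.eq_or_lt with rfl | hp0
    · have h1 := hlt (q / 2) q (by linarith) (by linarith)
      have h2 := (Psi_sub_bounds (k := k) he (le_refl (0 : ℝ)) (show (0 : ℝ) ≤ q / 2 by linarith)).1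
      linarith
    · exact hlt p q hp0 hpq
  have hc : ContinuousOn (Psi A k) (Ici 0) := by
    have hGc : Continuous (fun t : ℝ => (e (max t 0)) ^ k) := by
      have := e.continuous
      fun_prop
    have h1 : Continuous (fun p : ℝ => p * (e (max p 0)) ^ k -
        ∫ t in (0 : ℝ)..p, (e (max t 0)) ^ k) :=
      (continuous_id.mul hGc).sub (intervalIntegral.continuous_primitive
        (fun a b => hGc.intervalIntegrable a b) 0)
    exact h1.continuousOn.congr fun p hp => Psi_eq_of_extension he hp
  have htop : Tendsto (Psi A k) atTop atTop := by
    have h1 : Tendsto (fun p => e p ^ k - e 1 ^ k + Psi A k 1) atTop atTop := by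
      refine tendsto_atTop_add_const_right _ _ (tendsto_atTop_add_const_right _ _ ?_)
      exact (tendsto_pow_atTop (by omega)).comp e.tendsto_atTop
    refine tendsto_atTop_mono' _ ?_ h1
    filter_upwards [eventually_ge_atTop 1] with p hp
    have := (Psi_sub_bounds (k := k) he zero_le_one hp).1
    linarith
  obtain ⟨ψ, hψ⟩ := exists_orderIso_extending hc hm hP0 htop
  exact ⟨e, ψ, he, hψ⟩

/-- `Psi_sub_bounds` traps the difference quotient between the reciprocals of `ψ.symm` at the two
points. Formally `dΨ = p dG`; `ψ.symm` itself need not be differentiable. -/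
lemma IsLegendrePair.hasDerivAt {A : ℝ → ℝ} {k : ℕ} {e ψ : ℝ ≃o ℝ} (h : IsLegendrePair A k e ψ)
    {z : ℝ} (hz : 0 < z) : HasDerivAt (fun z => e (ψ.symm z) ^ k) (ψ.symm z)⁻¹ z := by
  set P : ℝ → ℝ := fun z => ψ.symm z with hP
  have hPpos : ∀ x, 0 < x → 0 < P x := fun x hx => h.symm_pos hx
  have hkey : ∀ x y, 0 < x → x < y →
      (P y)⁻¹ ≤ (e (P y) ^ k - e (P x) ^ k) / (y - x) ∧
      (e (P y) ^ k - e (P x) ^ k) / (y - x) ≤ (P x)⁻¹ := by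
    intro x y hx hxy
    have hy := hx.trans hxy
    have h1 := Psi_sub_bounds (k := k) h.e_eq (hPpos x hx).le (ψ.symm.monotone hxy.le)
    rw [← h.psi_eq _ (hPpos x hx).le, ← h.psi_eq _ (hPpos y hy).le, ψ.apply_symm_apply,
      ψ.apply_symm_apply] at h1
    have hd : 0 < y - x := sub_pos.2 hxy
    have := hPpos x hx
    have := hPpos y hy
    constructor
    · rw [inv_le_iff_one_le_mul₀ (by assumption), div_mul_eq_mul_div, le_div_iff₀ hd]
      linarith [h1.2]
    · rw [div_le_iff₀ hd, inv_mul_eq_div, le_div_iff₀ (by assumption)]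
      linarith [h1.1]
  rw [hasDerivAt_iff_tendsto_slope]
  have hc : Tendsto (fun y => (P y)⁻¹) (𝓝[≠] z) (𝓝 (P z)⁻¹) := by
    have : ContinuousAt (fun y => (P y)⁻¹) z :=
      (ψ.symm.continuous.continuousAt).inv₀ (hPpos z hz).ne'
    exact this.tendsto.mono_left nhdsWithin_le_nhds
  have hmin : Tendsto (fun y => min (P y)⁻¹ (P z)⁻¹) (𝓝[≠] z) (𝓝 (P z)⁻¹) := by
    simpa using hc.min (tendsto_const_nhds (x := (P z)⁻¹))
  have hmax : Tendsto (fun y => max (P y)⁻¹ (P z)⁻¹) (𝓝[≠] z) (𝓝 (P z)⁻¹) := by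
    simpa using hc.max (tendsto_const_nhds (x := (P z)⁻¹))
  have hev : ∀ᶠ y in 𝓝[≠] z, min (P y)⁻¹ (P z)⁻¹ ≤ slope (fun z => e (P z) ^ k) z y ∧
      slope (fun z => e (P z) ^ k) z y ≤ max (P y)⁻¹ (P z)⁻¹ := by
    filter_upwards [self_mem_nhdsWithin, nhdsWithin_le_nhds (Ioi_mem_nhds hz)] with y hne hy
    rcases lt_or_gt_of_ne (show y ≠ z from hne) with hlt | hlt
    · rw [slope_comm, slope_def_field]
      have := hkey y z hy hlt
      exact ⟨(min_le_right _ _).trans this.1, this.2.trans (le_max_left _ _)⟩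
    · rw [slope_def_field]
      have := hkey z y hz hlt
      exact ⟨(min_le_left _ _).trans this.1, this.2.trans (le_max_right _ _)⟩
  exact tendsto_of_tendsto_of_tendsto_of_le_of_le' hmin hmax (hev.mono fun _ h => h.1)
    (hev.mono fun _ h => h.2)

end LegendreTransform

/-! ### Independence of the Keller–Osserman integral from its constants. -/

section KellerOsserman

lemma integrableOn_Ioi_comp_affine {q : ℝ → ℝ} {θ a b : ℝ} (hθ : 0 < θ)
    (h : IntegrableOn q (Ioi b)) :
    IntegrableOn (fun s => q (a + θ * (s - a))) (Ioi (a + (b - a) / θ)) := by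
  rw [← integrable_indicator_iff measurableSet_Ioi] at h ⊢
  have h1 := ((h.comp_add_left a).comp_mul_left' hθ.ne').comp_sub_right a
  refine h1.congr (Eventually.of_forall fun s => ?_)
  simp only [indicator, mem_Ioi]
  have : b < a + θ * (s - a) ↔ a + (b - a) / θ < s := by
    rw [← sub_lt_iff_lt_add', ← lt_sub_iff_add_lt', div_lt_iff₀' hθ]
  simp only [this]

variable {w : ℝ → ℝ}

lemma cumul_add (hwc : Continuous w) (a b s : ℝ) :
    ∫ t in a..s, w t = (∫ t in a..b, w t) + ∫ t in b..s, w t :=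
  (intervalIntegral.integral_add_adjacent_intervals (hwc.intervalIntegrable a b)
    (hwc.intervalIntegrable b s)).symm

lemma le_cumul (hwc : Continuous w) (hwm : Monotone w) {a s : ℝ} (h : a ≤ s) :
    w a * (s - a) ≤ ∫ t in a..s, w t := by
  have := intervalIntegral.integral_mono_on (μ := volume) h (intervalIntegrable_const (c := w a))
    (hwc.intervalIntegrable a s) fun t ht => hwm ht.1
  simpa [mul_comm] using this

lemma cumul_le (hwc : Continuous w) (hwm : Monotone w) {a s : ℝ} (h : a ≤ s) :
    ∫ t in a..s, w t ≤ w s * (s - a) := by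
  have := intervalIntegral.integral_mono_on (μ := volume) h (hwc.intervalIntegrable a s)
    (intervalIntegrable_const (c := w s)) fun t ht => hwm ht.2
  simpa [mul_comm] using this

lemma continuous_cumul (hwc : Continuous w) (a : ℝ) : Continuous fun s => ∫ t in a..s, w t :=
  intervalIntegral.continuous_primitive (fun a b => hwc.intervalIntegrable a b) a

lemma cumul_pos (hwc : Continuous w) (hwm : Monotone w) (hwp : ∀ t, 0 < w t) {a s : ℝ}
    (h : a < s) : 0 < ∫ t in a..s, w t :=
  (mul_pos (hwp a) (sub_pos.2 h)).trans_le (le_cumul hwc hwm h.le)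

lemma cumul_nonneg (hwp : ∀ t, 0 < w t) {a s : ℝ} (h : a ≤ s) : 0 ≤ ∫ t in a..s, w t :=
  intervalIntegral.integral_nonneg h fun t _ => (hwp t).le

/-- Convexity of the primitive of a nondecreasing function which vanishes at `a`. -/
lemma cumul_contract (hwc : Continuous w) (hwm : Monotone w) {a s θ : ℝ} (h : a ≤ s)
    (h0 : 0 ≤ θ) (h1 : θ ≤ 1) : ∫ t in a..(a + θ * (s - a)), w t ≤ θ * ∫ t in a..s, w t := by
  set τ := a + θ * (s - a) with hτ
  have h2 := cumul_le hwc hwm (show a ≤ τ by nlinarith)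
  have h3 := le_cumul hwc hwm (show τ ≤ s by nlinarith)
  rw [cumul_add hwc a τ s]
  have h4 : τ - a = θ * (s - a) := by rw [hτ]; ring
  have h5 : s - τ = (1 - θ) * (s - a) := by rw [hτ]; ring
  rw [h4] at h2
  rw [h5] at h3
  nlinarith [mul_le_mul_of_nonneg_left h3 h0, mul_le_mul_of_nonneg_left h2 (sub_nonneg.2 h1)]

lemma tendsto_cumul (hwc : Continuous w) (hwm : Monotone w) (hwp : ∀ t, 0 < w t) (a : ℝ) :
    Tendsto (fun s => ∫ t in a..s, w t) atTop atTop := by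
  have h1 : Tendsto (fun s => w a * (s - a)) atTop atTop :=
    (tendsto_atTop_add_const_right _ _ tendsto_id).const_mul_atTop (hwp a)
  refine tendsto_atTop_mono' _ ?_ h1
  filter_upwards [eventually_ge_atTop a] with s hs using le_cumul hwc hwm hs

/-- A positive continuous nonincreasing function on `(0, ∞)` with a primitive which is continuous
up to `0`. -/
structure IsKernel (Q Y : ℝ → ℝ) : Prop where
  pos : ∀ z, 0 < z → 0 < Q z
  anti : AntitoneOn Q (Ioi 0)
  cont : ContinuousOn Q (Ioi 0)
  contY : ContinuousOn Y (Ici 0)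
  deriv : ∀ z, 0 < z → HasDerivAt Y (Q z) z

variable {Q Y : ℝ → ℝ}

lemma IsKernel.continuousOn_comp (hQ : IsKernel Q Y) (hwc : Continuous w) (hwm : Monotone w)
    (hwp : ∀ t, 0 < w t) {E C a : ℝ} (hE : 0 ≤ E) (hC : 0 < C) :
    ContinuousOn (fun s => Q (E + C * ∫ t in a..s, w t)) (Ioi a) := by
  have h1 : Continuous (fun s => E + C * ∫ t in a..s, w t) := by
    have := continuous_cumul hwc a
    fun_prop
  refine hQ.cont.comp h1.continuousOn fun s hs => ?_
  have := mul_pos hC (cumul_pos hwc hwm hwp (show a < s from hs))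
  rw [mem_Ioi]
  linarith

/-- By `cumul_contract`, shrinking `s - a` by a factor `θ` absorbs any ratio of `C` to `C'`, at the
price of a linear change of variable. The shifts `E` and `a` are absorbed because the primitive
tends to infinity. -/
lemma IsKernel.tail_transfer (hQ : IsKernel Q Y) (hwc : Continuous w) (hwm : Monotone w)
    (hwp : ∀ t, 0 < w t) {E C a E' C' a' : ℝ} (hE : 0 ≤ E) (hC : 0 < C) (hE' : 0 ≤ E')
    (hC' : 0 < C') (h : ∃ b, IntegrableOn (fun s => Q (E + C * ∫ t in a..s, w t)) (Ioi b)) :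
    ∃ b, IntegrableOn (fun s => Q (E' + C' * ∫ t in a'..s, w t)) (Ioi b) := by
  obtain ⟨b, hb⟩ := h
  set θ := min 1 (C' / (2 * C)) with hθ
  have hθ0 : 0 < θ := lt_min one_pos (by positivity)
  have hθ1 : θ ≤ 1 := min_le_left _ _
  have hθC : C * θ ≤ C' / 2 := by
    calc C * θ ≤ C * (C' / (2 * C)) := by gcongr; exact min_le_right _ _
      _ = C' / 2 := by field_simp
  have h1 := integrableOn_Ioi_comp_affine (a := a) hθ0 hb
  obtain ⟨s₁, hs₁⟩ := eventually_atTop.1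
    ((tendsto_cumul hwc hwm hwp a).eventually_ge_atTop
      ((E - C' * ∫ t in a'..a, w t) / (C' / 2)))
  set b' := max (max (a + (b - a) / θ) s₁) (max a a') with hb'
  have hb1 : a + (b - a) / θ ≤ b' := (le_max_left _ _).trans (le_max_left _ _)
  have hb2 : s₁ ≤ b' := (le_max_right _ _).trans (le_max_left _ _)
  have hb3 : a ≤ b' := (le_max_left _ _).trans (le_max_right _ _)
  have hb4 : a' ≤ b' := (le_max_right _ _).trans (le_max_right _ _)
  refine ⟨b', Integrable.mono' (h1.mono_set (Ioi_subset_Ioi hb1)) ?_ ?_⟩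
  · exact ((hQ.continuousOn_comp hwc hwm hwp hE' hC').mono
      (Ioi_subset_Ioi hb4)).aestronglyMeasurable measurableSet_Ioi
  · refine (ae_restrict_iff' measurableSet_Ioi).2 (Eventually.of_forall fun s hs => ?_)
    have hs : b' < s := hs
    have has : a < s := hb3.trans_lt hs
    have has' : a' < s := hb4.trans_lt hs
    have hp' : 0 < E' + C' * ∫ t in a'..s, w t := by
      have := mul_pos hC' (cumul_pos hwc hwm hwp has')
      linarith
    have hp : 0 < E + C * ∫ t in a..(a + θ * (s - a)), w t := by
      have := mul_pos hC (cumul_pos hwc hwm hwp (show a < a + θ * (s - a) by nlinarith))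
      linarith
    rw [Real.norm_of_nonneg (hQ.pos _ hp').le]
    refine hQ.anti hp hp' ?_
    have h2 := cumul_contract hwc hwm has.le hθ0.le hθ1
    have h3 := hs₁ s (hb2.trans hs.le)
    rw [div_le_iff₀ (by positivity)] at h3
    have h4 := cumul_add hwc a' a s
    have h5 : 0 ≤ ∫ t in a..s, w t := cumul_nonneg hwp has.le
    calc E + C * ∫ t in a..(a + θ * (s - a)), w t
        ≤ E + C * (θ * ∫ t in a..s, w t) := by gcongr
      _ = E + C * θ * ∫ t in a..s, w t := by ring
      _ ≤ E + C' / 2 * ∫ t in a..s, w t := by gcongr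
      _ ≤ C' * ∫ t in a'..s, w t := by rw [h4]; linarith
      _ ≤ _ := by linarith

/-- Only the tail matters. Near `a` the argument is at least `C * w a * (s - a)`, and `Q` is
integrable at `0` because its primitive `Y` is continuous there. -/
lemma IsKernel.integrableOn_Ioi (hQ : IsKernel Q Y) (hwc : Continuous w) (hwm : Monotone w)
    (hwp : ∀ t, 0 < w t) {E C a : ℝ} (hE : 0 ≤ E) (hC : 0 < C)
    (h : ∃ b, IntegrableOn (fun s => Q (E + C * ∫ t in a..s, w t)) (Ioi b)) :
    IntegrableOn (fun s => Q (E + C * ∫ t in a..s, w t)) (Ioi a) := by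
  obtain ⟨b, hb⟩ := h
  set b' := max a b
  have h1 : IntegrableOn (fun s => Q (E + C * ∫ t in a..s, w t)) (Ioi b') :=
    hb.mono_set (Ioi_subset_Ioi (le_max_right _ _))
  have hab : a ≤ b' := le_max_left _ _
  have hκ : 0 < C * w a := mul_pos hC (hwp a)
  have h2 : IntegrableOn (fun s => Q (C * w a * (s - a))) (Ioc a b') := by
    refine intervalIntegral.integrableOn_deriv_of_nonneg
      (g := fun s => Y (C * w a * (s - a)) / (C * w a)) ?_ ?_ ?_
    · refine ContinuousOn.div_const (hQ.contY.comp (by fun_prop) fun s hs => ?_) _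
      exact mul_nonneg hκ.le (sub_nonneg.2 hs.1)
    · intro s hs
      have h3 := hQ.deriv (C * w a * (s - a)) (mul_pos hκ (sub_pos.2 hs.1))
      have h4 : HasDerivAt (fun s => C * w a * (s - a)) (C * w a) s := by
        simpa using ((hasDerivAt_id s).sub_const a).const_mul (C * w a)
      have h5 := (h3.comp s h4).div_const (C * w a)
      rw [mul_div_cancel_right₀ _ hκ.ne'] at h5
      exact h5
    · intro s hs
      exact (hQ.pos _ (mul_pos hκ (sub_pos.2 hs.1))).le
  have h3 : IntegrableOn (fun s => Q (E + C * ∫ t in a..s, w t)) (Ioc a b') := by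
    refine Integrable.mono' h2 ?_ ?_
    · exact ((hQ.continuousOn_comp hwc hwm hwp hE hC).mono
        Ioc_subset_Ioi_self).aestronglyMeasurable measurableSet_Ioc
    · refine (ae_restrict_iff' measurableSet_Ioc).2 (Eventually.of_forall fun s hs => ?_)
      have hp : 0 < C * w a * (s - a) := mul_pos hκ (sub_pos.2 hs.1)
      have h4 : C * w a * (s - a) ≤ E + C * ∫ t in a..s, w t := by
        have := mul_le_mul_of_nonneg_left (le_cumul hwc hwm hs.1.le) hC.le
        linarith
      have hp' := hp.trans_le h4
      rw [Real.norm_of_nonneg (hQ.pos _ hp').le]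
      exact hQ.anti hp hp' h4
  rw [← Ioc_union_Ioi_eq_Ioi hab]
  exact h3.union h1

lemma IsKernel.lintegral_ne_top_iff (hQ : IsKernel Q Y) (hwc : Continuous w) (hwm : Monotone w)
    (hwp : ∀ t, 0 < w t) {b c : ℝ} (hcb : c ≤ b) :
    ∫⁻ s in Ioi b, ENNReal.ofReal (Q (∫ t in c..s, w t)) ≠ ⊤ ↔
      ∃ b', IntegrableOn (fun s => Q (∫ t in c..s, w t)) (Ioi b') := by
  have hcont : ContinuousOn (fun s => Q (∫ t in c..s, w t)) (Ioi c) := by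
    simpa using hQ.continuousOn_comp hwc hwm hwp (a := c) le_rfl one_pos
  have hint : (∃ b', IntegrableOn (fun s => Q (∫ t in c..s, w t)) (Ioi b')) →
      IntegrableOn (fun s => Q (∫ t in c..s, w t)) (Ioi c) := by
    simpa using hQ.integrableOn_Ioi hwc hwm hwp (a := c) le_rfl one_pos
  rw [lintegral_ofReal_ne_top_iff_integrable]
  · exact ⟨fun h => ⟨b, h⟩, fun h => (hint h).mono_set (Ioi_subset_Ioi hcb)⟩
  · exact (hcont.mono (Ioi_subset_Ioi hcb)).aestronglyMeasurable measurableSet_Ioi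
  · refine (ae_restrict_iff' measurableSet_Ioi).2 (Eventually.of_forall fun s hs => ?_)
    exact (hQ.pos _ (cumul_pos hwc hwm hwp (hcb.trans_lt hs))).le

lemma IsKernel.tail_compare {Q' Y' : ℝ → ℝ} (hQ' : IsKernel Q' Y')
    (hwc : Continuous w) (hwm : Monotone w) (hwp : ∀ t, 0 < w t) {c κ z₀ : ℝ}
    (hle : ∀ z, z₀ ≤ z → Q' z ≤ κ * Q z)
    (h : ∃ b, IntegrableOn (fun s => Q (∫ t in c..s, w t)) (Ioi b)) :
    ∃ b, IntegrableOn (fun s => Q' (∫ t in c..s, w t)) (Ioi b) := by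
  obtain ⟨b, hb⟩ := h
  obtain ⟨s₁, hs₁⟩ := eventually_atTop.1 ((tendsto_cumul hwc hwm hwp c).eventually_ge_atTop z₀)
  set b' := max (max b s₁) c
  have hb1 : b ≤ b' := (le_max_left _ _).trans (le_max_left _ _)
  have hb2 : s₁ ≤ b' := (le_max_right _ _).trans (le_max_left _ _)
  have hb3 : c ≤ b' := le_max_right _ _
  refine ⟨b', Integrable.mono' ((hb.mono_set (Ioi_subset_Ioi hb1)).const_mul κ) ?_ ?_⟩
  · have hcont : ContinuousOn (fun s => Q' (∫ t in c..s, w t)) (Ioi c) := by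
      simpa using hQ'.continuousOn_comp hwc hwm hwp (a := c) le_rfl one_pos
    exact (hcont.mono (Ioi_subset_Ioi hb3)).aestronglyMeasurable measurableSet_Ioi
  · refine (ae_restrict_iff' measurableSet_Ioi).2 (Eventually.of_forall fun s hs => ?_)
    have hs : b' < s := hs
    rw [Real.norm_of_nonneg (hQ'.pos _ (cumul_pos hwc hwm hwp (hb3.trans_lt hs))).le]
    exact hle _ (hs₁ s (hb2.trans hs.le))

lemma IsLegendrePair.isKernel {A : ℝ → ℝ} {k : ℕ} {e ψ : ℝ ≃o ℝ} (h : IsLegendrePair A k e ψ) :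
    IsKernel (fun z => (ψ.symm z)⁻¹) (fun z => e (ψ.symm z) ^ k) where
  pos _ hz := inv_pos.2 (h.symm_pos hz)
  anti _ hx _ _ hxy := inv_anti₀ (h.symm_pos hx) (ψ.symm.monotone hxy)
  cont := ψ.symm.continuous.continuousOn.inv₀ fun _ hz => (h.symm_pos hz).ne'
  contY := ((e.continuous.comp ψ.symm.continuous).pow k).continuousOn
  deriv _ hz := h.hasDerivAt hz

lemma isKernel_rpow {γ : ℝ} (h0 : 0 < γ) (h1 : γ < 1) :
    IsKernel (fun z => z ^ (-γ)) (fun z => z ^ (1 - γ) / (1 - γ)) where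
  pos _ hz := Real.rpow_pos_of_pos hz _
  anti _ hx _ _ hxy := Real.rpow_le_rpow_of_nonpos hx hxy (by linarith)
  cont := fun _ hz => (Real.continuousAt_rpow_const _ _ (Or.inl (ne_of_gt hz))).continuousWithinAt
  contY := by
    refine ContinuousOn.div_const (fun _ _ => ?_) _
    exact (Real.continuousAt_rpow_const _ _ (Or.inr (by linarith))).continuousWithinAt
  deriv _ hz := by
    have h2 := (Real.hasDerivAt_rpow_const (p := 1 - γ) (Or.inl hz.ne')).div_const (1 - γ)
    rw [mul_div_cancel_left₀ _ (by linarith : 1 - γ ≠ 0)] at h2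
    rwa [show 1 - γ - 1 = -γ by ring] at h2

lemma PsiKellerOsserman_iff {A f : ℝ → ℝ} {k : ℕ} {e ψ : ℝ ≃o ℝ} (h : IsLegendrePair A k e ψ)
    (hf_cont : Continuous f) (hf_pos : ∀ t : ℝ, 0 < f t) (hf_mono : Monotone f) {b c : ℝ}
    (hcb : c ≤ b) : PsiKellerOsserman A f k c b ↔
      ¬ ∃ b', IntegrableOn (fun s => (ψ.symm (∫ t in c..s, f t ^ k))⁻¹) (Ioi b') := by
  have hwp : ∀ t, 0 < f t ^ k := fun t => pow_pos (hf_pos t) k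
  rw [← h.isKernel.lintegral_ne_top_iff (w := fun t => f t ^ k) (hf_cont.pow k)
    (fun s t hst => pow_le_pow_left₀ (hf_pos s).le (hf_mono hst) k) hwp hcb, not_not,
    PsiKellerOsserman]
  have : ∫⁻ s in Ioi b, ENNReal.ofReal (PsiInv A k (∫ t in c..s, f t ^ k))⁻¹ =
      ∫⁻ s in Ioi b, ENNReal.ofReal (ψ.symm (∫ t in c..s, f t ^ k))⁻¹ := by
    refine setLIntegral_congr_fun measurableSet_Ioi fun s hs => ?_
    have hs : b < s := hs
    rw [h.psiInv_eq (cumul_nonneg hwp (hcb.trans hs.le))]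
  rw [this]

lemma PowerKellerOsserman_iff {f : ℝ → ℝ} {k : ℕ} {m : ℝ} (hk : 1 ≤ k) (hm : 1 < m)
    (hf_cont : Continuous f) (hf_pos : ∀ t : ℝ, 0 < f t) (hf_mono : Monotone f) {b c : ℝ}
    (hcb : c ≤ b) : PowerKellerOsserman f k m c b ↔
      ¬ ∃ b', IntegrableOn
        (fun s => (∫ t in c..s, f t ^ k) ^ (-(1 / ((k : ℝ) * (m - 1) + 1)))) (Ioi b') := by
  have hk0 : (0 : ℝ) < k := by exact_mod_cast hk
  have h1 : 1 < (k : ℝ) * (m - 1) + 1 := by nlinarith [mul_pos hk0 (sub_pos.2 hm)]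
  have hK := isKernel_rpow (γ := 1 / ((k : ℝ) * (m - 1) + 1)) (by positivity)
    (by rw [div_lt_one (by linarith)]; exact h1)
  rw [← hK.lintegral_ne_top_iff (w := fun t => f t ^ k) (hf_cont.pow k)
    (fun s t hst => pow_le_pow_left₀ (hf_pos s).le (hf_mono hst) k)
    (fun t => pow_pos (hf_pos t) k) hcb, not_not]
  rfl

end KellerOsserman

/-! ### Power growth and the equivalence of the two integral conditions. -/

section PowerGrowthComparison

lemma PowerGrowth.exists_bounds {A : ℝ → ℝ} {m : ℝ} (h : PowerGrowth A m) :
    ∃ c₁ c₂ p₀ : ℝ, 0 < c₁ ∧ 0 < c₂ ∧ 0 < p₀ ∧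
      ∀ p, p₀ ≤ p → c₁ * p ^ (m - 1) ≤ p * A p ∧ p * A p ≤ c₂ * p ^ (m - 1) := by
  obtain ⟨h1, h2⟩ := h
  obtain ⟨c₁, hc0, hc1⟩ := EReal.lt_iff_exists_real_btwn.1 h1
  obtain ⟨c₂, hc2, -⟩ := EReal.lt_iff_exists_real_btwn.1 h2
  have e1 := eventually_lt_of_lt_liminf hc1
  have e2 := eventually_lt_of_limsup_lt hc2
  obtain ⟨p₀, hp₀⟩ := eventually_atTop.1 (e1.and e2)
  have hc0' : 0 < c₁ := by exact_mod_cast hc0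
  refine ⟨c₁, max c₂ 1, max p₀ 1, hc0', by positivity, by positivity, fun p hp => ?_⟩
  have hp1 : 0 < p := lt_of_lt_of_le (by positivity) hp
  obtain ⟨h3, h4⟩ := hp₀ p ((le_max_left _ _).trans hp)
  have h3 : c₁ < A p / p ^ (m - 2) := by exact_mod_cast h3
  have h4 : A p / p ^ (m - 2) < c₂ := by exact_mod_cast h4
  have hpp : 0 < p ^ (m - 2) := Real.rpow_pos_of_pos hp1 _
  rw [lt_div_iff₀ hpp] at h3
  rw [div_lt_iff₀ hpp] at h4
  have h5 : p ^ (m - 1) = p * p ^ (m - 2) := by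
    rw [show m - 1 = 1 + (m - 2) by ring, Real.rpow_add hp1, Real.rpow_one]
  rw [h5]
  constructor
  · nlinarith
  · calc p * A p ≤ p * (c₂ * p ^ (m - 2)) := by gcongr
      _ ≤ p * (max c₂ 1 * p ^ (m - 2)) := by gcongr; exact le_max_left _ _
      _ = _ := by ring

lemma PowerGrowth.tendsto {A : ℝ → ℝ} {m : ℝ} (hm : 1 < m) (h : PowerGrowth A m) :
    Tendsto (fun p : ℝ => p * A p) atTop atTop := by
  obtain ⟨c₁, c₂, p₀, hc₁, -, -, hb⟩ := h.exists_bounds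
  have h1 : Tendsto (fun p : ℝ => c₁ * p ^ (m - 1)) atTop atTop :=
    (tendsto_rpow_atTop (by linarith)).const_mul_atTop hc₁
  refine tendsto_atTop_mono' _ ?_ h1
  filter_upwards [eventually_ge_atTop p₀] with p hp using (hb p hp).1

lemma exists_rpow_small {N ε : ℝ} (hN : 0 < N) (hε : 0 < ε) :
    ∃ θ : ℝ, 0 < θ ∧ θ < 1 ∧ θ ^ N ≤ ε := by
  have h1 : Tendsto (fun θ : ℝ => θ ^ N) (𝓝[>] 0) (𝓝 0) := by
    have := (Real.continuousAt_rpow_const 0 N (Or.inr hN.le)).tendsto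
    rw [Real.zero_rpow hN.ne'] at this
    exact this.mono_left nhdsWithin_le_nhds
  have h2 := h1.eventually (ge_mem_nhds hε)
  have h3 : ∀ᶠ θ : ℝ in 𝓝[>] 0, 0 < θ := self_mem_nhdsWithin
  have h4 : ∀ᶠ θ : ℝ in 𝓝[>] 0, θ < 1 := nhdsWithin_le_nhds (gt_mem_nhds one_pos)
  obtain ⟨θ, h2, h3, h4⟩ := (h2.and (h3.and h4)).exists
  exact ⟨θ, h3, h4, h2⟩

lemma IsLegendrePair.power_bounds {A : ℝ → ℝ} {k : ℕ} {e ψ : ℝ ≃o ℝ} (h : IsLegendrePair A k e ψ)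
    (hk : 1 ≤ k) {m : ℝ} (hm : 1 < m) (hA : PowerGrowth A m) :
    ∃ κ₁ κ₂ z₀ : ℝ, ∀ z, z₀ ≤ z →
      (ψ.symm z)⁻¹ ≤ κ₁ * z ^ (-(1 / ((k : ℝ) * (m - 1) + 1))) ∧
      z ^ (-(1 / ((k : ℝ) * (m - 1) + 1))) ≤ κ₂ * (ψ.symm z)⁻¹ := by
  obtain ⟨c₁, c₂, p₀, hc₁, hc₂, hp₀, hb⟩ := hA.exists_bounds
  have hk0 : (0 : ℝ) < k := by exact_mod_cast hk
  set N : ℝ := k * (m - 1) with hN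
  have hN0 : 0 < N := mul_pos hk0 (by linarith)
  have hG : ∀ p, p₀ ≤ p → c₁ ^ k * p ^ N ≤ e p ^ k ∧ e p ^ k ≤ c₂ ^ k * p ^ N := by
    intro p hp
    have hp0 : 0 < p := hp₀.trans_le hp
    have h1 : p ^ N = (p ^ (m - 1)) ^ k := by
      rw [← Real.rpow_natCast, ← Real.rpow_mul hp0.le, hN, mul_comm]
    rw [h1, ← mul_pow, ← mul_pow, h.e_eq p hp0.le]
    have h2 := hb p hp
    have h3 : 0 ≤ c₁ * p ^ (m - 1) := by positivity
    exact ⟨pow_le_pow_left₀ h3 h2.1 k, pow_le_pow_left₀ (h3.trans h2.1) h2.2 k⟩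
  -- This `θ` makes `e (θ P) ^ k` at most `c₁ ^ k / 2 * P ^ N`, half the lower bound for `e P ^ k`;
  -- the increment of `Ψ` from `θ P` to `P` is then at least `c₃ P ^ (N + 1)`.
  obtain ⟨θ, hθ0, hθ1, hθ⟩ := exists_rpow_small hN0 (show 0 < c₁ ^ k / (2 * c₂ ^ k) by positivity)
  set c₃ := θ * (c₁ ^ k / 2) with hc₃
  have hc₃0 : 0 < c₃ := by positivity
  set γ := 1 / (N + 1) with hγ
  have hγ0 : 0 < γ := by positivity
  obtain ⟨z₁, hz₁⟩ := eventually_atTop.1 (ψ.symm.tendsto_atTop.eventually_ge_atTop (p₀ / θ))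
  refine ⟨(c₂ ^ k) ^ γ, (c₃ ^ γ)⁻¹, max z₁ 1, fun z hz => ?_⟩
  have hz0 : 0 < z := lt_of_lt_of_le one_pos ((le_max_right _ _).trans hz)
  set P := ψ.symm z with hP
  have hP0 : 0 < P := h.symm_pos hz0
  have hPθ : p₀ ≤ θ * P := by
    have := hz₁ z ((le_max_left _ _).trans hz)
    rwa [div_le_iff₀' hθ0] at this
  have hPp : p₀ ≤ P := hPθ.trans (by nlinarith)
  have hψ : Psi A k P = z := by rw [← h.psi_eq P hP0.le, hP, ψ.apply_symm_apply]
  have hPN : P ^ (N + 1) = P * P ^ N := by rw [Real.rpow_add hP0, Real.rpow_one, mul_comm]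
  have hroot : ∀ c : ℝ, 0 ≤ c → (c * P ^ (N + 1)) ^ γ = c ^ γ * P := by
    intro c hc
    rw [Real.mul_rpow hc (by positivity), ← Real.rpow_mul hP0.le, hγ, mul_one_div_cancel (by positivity),
      Real.rpow_one]
  have hup : z ≤ c₂ ^ k * P ^ (N + 1) := by
    have h1 := (Psi_sub_bounds (k := k) h.e_eq le_rfl hP0.le).2
    rw [h.e_zero, zero_pow (by omega), sub_zero, ← h.psi_eq 0 le_rfl, h.psi_zero, sub_zero, hψ] at h1
    rw [hPN]
    nlinarith [mul_le_mul_of_nonneg_left (hG P hPp).2 hP0.le]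
  have hlow : c₃ * P ^ (N + 1) ≤ z := by
    have h1 := (Psi_sub_bounds (k := k) h.e_eq (by positivity : 0 ≤ θ * P)
      (by nlinarith : θ * P ≤ P)).1
    have h2 : 0 ≤ Psi A k (θ * P) := by
      rw [← h.psi_eq _ (by positivity), ← h.psi_zero]; exact ψ.monotone (by positivity)
    have h3 : e (θ * P) ^ k ≤ c₁ ^ k / 2 * P ^ N := by
      calc e (θ * P) ^ k ≤ c₂ ^ k * (θ * P) ^ N := (hG _ hPθ).2
        _ = c₂ ^ k * θ ^ N * P ^ N := by rw [Real.mul_rpow hθ0.le hP0.le]; ring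
        _ ≤ c₂ ^ k * (c₁ ^ k / (2 * c₂ ^ k)) * P ^ N := by gcongr
        _ = _ := by field_simp
    have h4 : c₁ ^ k / 2 * P ^ N ≤ e P ^ k - e (θ * P) ^ k := by linarith [(hG P hPp).1]
    calc c₃ * P ^ (N + 1) = θ * P * (c₁ ^ k / 2 * P ^ N) := by rw [hPN, hc₃]; ring
      _ ≤ θ * P * (e P ^ k - e (θ * P) ^ k) := by gcongr
      _ ≤ z := by rw [← hψ]; linarith
  have h1 := Real.rpow_le_rpow hz0.le hup hγ0.le
  have h2 := Real.rpow_le_rpow (by positivity) hlow hγ0.le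
  rw [hroot _ (by positivity)] at h1
  rw [hroot _ hc₃0.le] at h2
  have hzγ : 0 < z ^ γ := Real.rpow_pos_of_pos hz0 _
  have hcγ : 0 < c₃ ^ γ := Real.rpow_pos_of_pos hc₃0 _
  rw [Real.rpow_neg hz0.le]
  constructor
  · rw [← div_eq_mul_inv, le_div_iff₀ hzγ, inv_mul_le_iff₀ hP0, mul_comm P]
    exact h1
  · rw [← mul_inv]
    exact inv_anti₀ (by positivity) h2

lemma powerKellerOsserman_iff_psi {A f : ℝ → ℝ} {k : ℕ} {e ψ : ℝ ≃o ℝ}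
    (h : IsLegendrePair A k e ψ) (hk : 1 ≤ k) {m : ℝ} (hm : 1 < m) (hA : PowerGrowth A m)
    (hf_cont : Continuous f) (hf_pos : ∀ t : ℝ, 0 < f t) (hf_mono : Monotone f) {b c : ℝ}
    (hcb : c ≤ b) : PowerKellerOsserman f k m c b ↔ PsiKellerOsserman A f k c b := by
  have hk0 : (0 : ℝ) < k := by exact_mod_cast hk
  have h1 : 1 < (k : ℝ) * (m - 1) + 1 := by nlinarith [mul_pos hk0 (sub_pos.2 hm)]
  have hK := isKernel_rpow (γ := 1 / ((k : ℝ) * (m - 1) + 1)) (by positivity)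
    (by rw [div_lt_one (by linarith)]; exact h1)
  have hwm : Monotone fun t => f t ^ k :=
    fun s t hst => pow_le_pow_left₀ (hf_pos s).le (hf_mono hst) k
  have hwp : ∀ t, 0 < f t ^ k := fun t => pow_pos (hf_pos t) k
  obtain ⟨κ₁, κ₂, z₀, hz⟩ := h.power_bounds hk hm hA
  rw [PowerKellerOsserman_iff hk hm hf_cont hf_pos hf_mono hcb,
    PsiKellerOsserman_iff h hf_cont hf_pos hf_mono hcb, not_iff_not]
  constructor
  · exact fun hint => h.isKernel.tail_compare (hf_cont.pow k) hwm hwp (fun z hz' => (hz z hz').1) hint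
  · exact fun hint => hK.tail_compare (hf_cont.pow k) hwm hwp (fun z hz' => (hz z hz').2) hint

end PowerGrowthComparison

/-! ### Radial profiles with linear flux inside and `Ψ(v') = z(v)` outside. -/

section RadialProfile

/-- A `C¹` profile `v` with derivative `vp`, whose flux is `μ r` for `r ≤ r₀`, and which satisfies
`Ψ(v') = z(v)` for `r ≥ r₀`. -/
structure IsGluedProfile (e ψ : ℝ ≃o ℝ) (z : ℝ → ℝ) (s₀ r₀ μ : ℝ) (v vp : ℝ → ℝ) : Prop where
  cont : Continuous vp
  deriv : ∀ r, HasDerivAt v (vp r) r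
  inner : ∀ r, r ≤ r₀ → vp r = e.symm (μ * r)
  base : v r₀ = s₀
  outer : ∀ r, r₀ ≤ r → vp r = ψ.symm (z (v r))
  le_outer : ∀ r, r₀ ≤ r → s₀ ≤ v r
  param : ∀ s, s₀ ≤ s → v (r₀ + ∫ t in s₀..s, (ψ.symm (z t))⁻¹) = s

/-- Separation of variables: the outer profile is the inverse of `R(s) = r₀ + ∫ (ψ.symm (z t))⁻¹`.
Keeping `z` constant below `s₀` makes `R` affine there, hence onto `ℝ`; `hmatch` makes the glued
derivative continuous. -/
lemma exists_gluedProfile {A : ℝ → ℝ} {k : ℕ} {e ψ : ℝ ≃o ℝ} (h : IsLegendrePair A k e ψ)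
    {z : ℝ → ℝ} (hzc : Continuous z) (hzp : ∀ s, 0 < z s) {s₀ r₀ μ : ℝ}
    (hz0 : ∀ s, s ≤ s₀ → z s = z s₀) (hmatch : e.symm (μ * r₀) = ψ.symm (z s₀))
    (htop : Tendsto (fun s => r₀ + ∫ t in s₀..s, (ψ.symm (z t))⁻¹) atTop atTop) :
    ∃ v vp : ℝ → ℝ, IsGluedProfile e ψ z s₀ r₀ μ v vp := by
  set q : ℝ → ℝ := fun t => (ψ.symm (z t))⁻¹ with hq
  have hqp : ∀ t, 0 < q t := fun t => inv_pos.2 (h.symm_pos (hzp t))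
  have hqc : Continuous q :=
    (ψ.symm.continuous.comp hzc).inv₀ fun t => (h.symm_pos (hzp t)).ne'
  set R : ℝ → ℝ := fun s => r₀ + ∫ t in s₀..s, q t with hR
  have hRd : ∀ s, HasDerivAt R (q s) s := fun s =>
    (intervalIntegral.integral_hasDerivAt_right (hqc.intervalIntegrable _ _)
      (hqc.stronglyMeasurableAtFilter _ _) hqc.continuousAt).const_add r₀
  have hRc : Continuous R := continuous_iff_continuousAt.2 fun s => (hRd s).continuousAt
  have hRm : StrictMono R := strictMono_of_deriv_pos fun s => by rw [(hRd s).deriv]; exact hqp s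
  have hRbot : Tendsto R atBot atBot := by
    have h1 : Tendsto (fun s => r₀ + q s₀ * (s - s₀)) atBot atBot :=
      tendsto_atBot_add_const_left _ _
        ((tendsto_atBot_add_const_right _ _ tendsto_id).const_mul_atBot (hqp s₀))
    refine h1.congr' ?_
    filter_upwards [eventually_le_atBot s₀] with s hs
    have : ∫ t in s₀..s, q t = ∫ t in s₀..s, q s₀ := by
      refine intervalIntegral.integral_congr fun t ht => ?_
      rw [uIcc_of_ge hs] at ht
      simp only [hq]
      rw [hz0 t ht.2]
    simp only [hR]
    rw [this]
    simp [mul_comm]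
  set V : ℝ ≃o ℝ := (hRm.orderIsoOfSurjective R (hRc.surjective htop hRbot)).symm with hV
  have hRV : ∀ r, R (V r) = r := fun r =>
    (hRm.orderIsoOfSurjective R (hRc.surjective htop hRbot)).apply_symm_apply r
  have hVR : ∀ s, V (R s) = s := fun s =>
    (hRm.orderIsoOfSurjective R (hRc.surjective htop hRbot)).symm_apply_apply s
  have hVd : ∀ r, HasDerivAt V (ψ.symm (z (V r))) r := by
    intro r
    have := HasDerivAt.of_local_left_inverse (f := R) (g := V) V.continuous.continuousAt
      (hRd (V r)) (hqp _).ne' (Eventually.of_forall hRV)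
    rwa [hq, inv_inv] at this
  have hR0 : R s₀ = r₀ := by simp [hR]
  have hV0 : V r₀ = s₀ := by rw [← hR0, hVR]
  set vp : ℝ → ℝ := fun r => if r ≤ r₀ then e.symm (μ * r) else ψ.symm (z (V r)) with hvp
  have hvpc : Continuous vp := by
    refine Continuous.if_le ?_ ?_ continuous_id continuous_const ?_
    · exact e.symm.continuous.comp (by fun_prop)
    · exact ψ.symm.continuous.comp (hzc.comp V.continuous)
    · rintro r rfl
      rw [hmatch, hV0]
  have hvout : ∀ r, r₀ ≤ r → vp r = ψ.symm (z (V r)) := by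
    intro r hr
    rcases hr.eq_or_lt with rfl | hr
    · simp only [hvp, le_refl, if_true]
      rw [hmatch, hV0]
    · simp [hvp, not_le.2 hr]
  set v : ℝ → ℝ := fun r => s₀ + ∫ ρ in r₀..r, vp ρ with hv
  have hvV : ∀ r, r₀ ≤ r → v r = V r := by
    intro r hr
    have h1 : ∫ ρ in r₀..r, vp ρ = ∫ ρ in r₀..r, ψ.symm (z (V ρ)) := by
      refine intervalIntegral.integral_congr fun t ht => ?_
      rw [uIcc_of_le hr] at ht
      exact hvout t ht.1
    have h2 : ∫ ρ in r₀..r, ψ.symm (z (V ρ)) = V r - V r₀ :=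
      intervalIntegral.integral_eq_sub_of_hasDerivAt (fun t _ => hVd t)
        ((ψ.symm.continuous.comp (hzc.comp V.continuous)).intervalIntegrable _ _)
    simp only [hv]
    rw [h1, h2, hV0]
    ring
  refine ⟨v, vp, hvpc, ?_, ?_, by simp [hv], ?_, ?_, ?_⟩
  · intro r
    exact (intervalIntegral.integral_hasDerivAt_right (hvpc.intervalIntegrable _ _)
      (hvpc.stronglyMeasurableAtFilter _ _) hvpc.continuousAt).const_add s₀
  · intro r hr
    simp [hvp, hr]
  · intro r hr
    rw [hvV r hr, hvout r hr]
  · intro r hr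
    rw [hvV r hr, ← hV0]
    exact V.monotone hr
  · intro s hs
    have : r₀ ≤ R s := by rw [← hR0]; exact hRm.monotone hs
    exact (hvV _ this).trans (hVR s)

lemma hasDerivWithinAt_of_pow {g : ℝ → ℝ} {S : Set ℝ} {r d : ℝ} {k : ℕ} (hk : 1 ≤ k)
    (hr : r ∈ S) (hg : ∀ ρ ∈ S, 0 < g ρ) (h : HasDerivWithinAt (fun ρ => g ρ ^ k) d S r) :
    HasDerivWithinAt g (d / (k * g r ^ (k - 1))) S r := by
  have hk0 : (k : ℝ) ≠ 0 := by positivity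
  have h1 := h.rpow_const (p := 1 / (k : ℝ)) (Or.inl (pow_pos (hg r hr) k).ne')
  have h2 : ∀ ρ ∈ S, (g ρ ^ k) ^ (1 / (k : ℝ)) = g ρ := by
    intro ρ hρ
    rw [← Real.rpow_natCast, ← Real.rpow_mul (hg ρ hρ).le, mul_one_div_cancel hk0, Real.rpow_one]
  have h3 := h1.congr (fun ρ hρ => (h2 ρ hρ).symm) (h2 r hr).symm
  refine h3.congr_deriv ?_
  have hgr := hg r hr
  have h4 : (g r ^ k) ^ (1 / (k : ℝ) - 1) = (g r ^ (k - 1))⁻¹ := by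
    rw [Real.rpow_sub (pow_pos hgr k), h2 r hr, Real.rpow_one]
    obtain ⟨j, rfl⟩ : ∃ j, k = j + 1 := ⟨k - 1, by omega⟩
    rw [pow_succ, Nat.add_sub_cancel]
    field_simp
  rw [h4]
  field_simp

namespace IsGluedProfile

variable {A : ℝ → ℝ} {k : ℕ} {e ψ : ℝ ≃o ℝ} {z : ℝ → ℝ} {s₀ r₀ μ : ℝ} {v vp : ℝ → ℝ}

lemma vp_pos (h : IsLegendrePair A k e ψ) (hv : IsGluedProfile e ψ z s₀ r₀ μ v vp) (hμ : 0 < μ)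
    (hzp : ∀ s, 0 < z s) {r : ℝ} (hr : 0 < r) : 0 < vp r := by
  rcases le_total r r₀ with h1 | h1
  · rw [hv.inner r h1, ← h.e_symm_zero]
    exact e.symm.strictMono (mul_pos hμ hr)
  · rw [hv.outer r h1]
    exact h.symm_pos (hzp _)

lemma v_mono (h : IsLegendrePair A k e ψ) (hv : IsGluedProfile e ψ z s₀ r₀ μ v vp) (hμ : 0 < μ)
    (hzp : ∀ s, 0 < z s) : MonotoneOn v (Ici 0) := by
  refine monotoneOn_of_deriv_nonneg (convex_Ici 0) ?_ ?_ ?_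
  · exact fun r _ => (hv.deriv r).continuousAt.continuousWithinAt
  · exact fun r _ => (hv.deriv r).differentiableAt.differentiableWithinAt
  · intro r hr
    rw [interior_Ici] at hr
    rw [(hv.deriv r).deriv]
    exact (hv.vp_pos h hμ hzp hr).le

/-- In the chain rule `v' = ψ.symm (z v)` cancels the factor `(ψ.symm (z v))⁻¹` of
`IsLegendrePair.hasDerivAt`. The derivative is one-sided because `z` may have a corner at `s₀`. -/
lemma flux_pow_hasDerivWithinAt (h : IsLegendrePair A k e ψ)
    (hv : IsGluedProfile e ψ z s₀ r₀ μ v vp) (hr₀ : 0 < r₀) (hμ : 0 < μ)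
    (hzp : ∀ s, 0 < z s) {r d : ℝ} (hr : r₀ ≤ r) (hd : HasDerivWithinAt z d (Ici (v r)) (v r)) :
    HasDerivWithinAt (fun ρ => e (vp ρ) ^ k) d (Ici r) r := by
  have hmaps : MapsTo v (Ici r) (Ici (v r)) := fun ρ hρ =>
    hv.v_mono h hμ hzp (mem_Ici.2 (hr₀.le.trans hr)) (mem_Ici.2 ((hr₀.le.trans hr).trans hρ)) hρ
  have h1 := hd.comp r (hv.deriv r).hasDerivWithinAt hmaps
  have h2 := (h.hasDerivAt (hzp (v r))).comp_hasDerivWithinAt r h1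
  have hpos : ψ.symm (z (v r)) ≠ 0 := (h.symm_pos (hzp _)).ne'
  rw [hv.outer r hr, mul_comm d, inv_mul_cancel_left₀ hpos] at h2
  refine h2.congr (fun ρ hρ => ?_) ?_
  · rw [hv.outer ρ (hr.trans hρ)]; rfl
  · rw [hv.outer r hr]; rfl

lemma flux_hasDerivWithinAt (h : IsLegendrePair A k e ψ) (hk : 1 ≤ k)
    (hv : IsGluedProfile e ψ z s₀ r₀ μ v vp) (hr₀ : 0 < r₀) (hμ : 0 < μ)
    (hzp : ∀ s, 0 < z s) {r d : ℝ} (hr : r₀ ≤ r) (hd : HasDerivWithinAt z d (Ici (v r)) (v r)) :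
    HasDerivWithinAt (fun ρ => e (vp ρ)) (d / (k * e (vp r) ^ (k - 1))) (Ici r) r := by
  refine hasDerivWithinAt_of_pow hk self_mem_Ici (fun ρ hρ => ?_)
    (hv.flux_pow_hasDerivWithinAt h hr₀ hμ hzp hr hd)
  exact h.e_pos (hv.vp_pos h hμ hzp (hr₀.trans_le (hr.trans hρ)))

end IsGluedProfile

end RadialProfile

/-! ### Nonexistence for bounded flux, and necessity of the integral condition. -/

section Necessity

open scoped InnerProductSpace

variable {n k : ℕ} {A f : ℝ → ℝ} {u : EuclideanSpace ℝ (Fin n) → ℝ}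

lemma IsEntireSolution.esymmPos (hu : IsEntireSolution n k A f u) (x : EuclideanSpace ℝ (Fin n)) :
    EsymmPos k (eigenvalueMultiset (fluxMatrix A u x)) := (hu.2.1.2.2 x).2

lemma IsEntireSolution.pow_le_esymm (hu : IsEntireSolution n k A f u) (hk : 1 ≤ k)
    (hf_pos : ∀ t : ℝ, 0 < f t) (x : EuclideanSpace ℝ (Fin n)) :
    f (u x) ^ k ≤ (eigenvalueMultiset (fluxMatrix A u x)).esymm k := by
  have h1 := pow_le_pow_left₀ (hf_pos (u x)).le (hu.2.2 x) k
  have h2 := (hu.esymmPos x).of_le le_rfl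
  rwa [one_div, Real.rpow_inv_natCast_pow h2.le (by omega)] at h1

lemma IsEntireSolution.le_trace (hu : IsEntireSolution n k A f u) (hk : 1 ≤ k)
    (hf_pos : ∀ t : ℝ, 0 < f t) (x : EuclideanSpace ℝ (Fin n)) :
    f (u x) ≤ (fluxMatrix A u x).trace := by
  have h1 := hu.pow_le_esymm hk hf_pos x
  have h2 := (hu.esymmPos x).esymm_le_pow hk
  have h3 := (hu.esymmPos x).of_le hk
  rw [trace_eq_esymm_one_roots (hu.2.1.2.2 x).1]
  exact (pow_le_pow_iff_left₀ (hf_pos _).le h3.le (by omega)).1 (h1.trans h2)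

lemma IsCompact.exists_strict_bound {X : Type*} [TopologicalSpace X] {S : Set X} (hS : IsCompact S)
    {w : X → ℝ} (hw : ContinuousOn w S) {c : ℝ} (hc : 0 < c) (h : ∀ x ∈ S, w x < c) :
    ∃ M, 0 ≤ M ∧ M < c ∧ ∀ x ∈ S, w x < M := by
  rcases S.eq_empty_or_nonempty with rfl | hne
  · exact ⟨0, le_rfl, hc, by simp⟩
  · obtain ⟨x₀, hx₀, hmax⟩ := hS.exists_isMaxOn hne hw
    have h0 := h x₀ hx₀
    refine ⟨(max (w x₀) 0 + c) / 2, by positivity, ?_, fun x hx => ?_⟩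
    · have : max (w x₀) 0 < c := max_lt h0 hc
      linarith
    · have h1 : w x ≤ w x₀ := hmax hx
      have : w x₀ ≤ max (w x₀) 0 := le_max_left _ _
      linarith [max_lt h0 hc]

lemma continuous_gradient {E : Type*} [NormedAddCommGroup E] [InnerProductSpace ℝ E]
    [CompleteSpace E] {u : E → ℝ} (hu : ContDiff ℝ 1 u) : Continuous (gradient u) :=
  (InnerProductSpace.toDual ℝ E).symm.continuous.comp (hu.continuous_fderiv (by norm_num))

lemma hasDerivAt_base_integral {q : ℝ → ℝ} (hq : Continuous q) (a b r : ℝ) :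
    HasDerivAt (fun r => a + ∫ s in b..r, q s) (q r) r :=
  (intervalIntegral.integral_hasDerivAt_right (hq.intervalIntegrable _ _)
    (hq.stronglyMeasurableAtFilter _ _) hq.continuousAt).const_add a

/-- There is no entire solution when `p A(p)` is bounded. -/
theorem not_isEntireSolution_of_tendsto (hk : 1 ≤ k) (hkn : k ≤ n)
    (hA_pos : ∀ p : ℝ, 0 < p → 0 < A p)
    (hA_cont : ContinuousOn (fun p : ℝ => p * A p) (Ici 0))
    (hA_mono : StrictMonoOn (fun p : ℝ => p * A p) (Ioi 0))
    (hf_pos : ∀ t : ℝ, 0 < f t) (hf_mono : Monotone f) {L : ℝ}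
    (hL : Tendsto (fun p : ℝ => p * A p) atTop (𝓝 L)) : ¬ IsEntireSolution n k A f u := by
  intro hu
  have hm := strictMonoOn_mul_Ici hA_pos hA_mono
  have hn : (0 : ℝ) < n := by exact_mod_cast (by omega : 0 < n)
  set a := u 0 - 1 with ha
  set μ := f a / (2 * n) with hμdef
  have hμ : 0 < μ := div_pos (hf_pos a) (by positivity)
  have hu1 : ContDiff ℝ 1 u := hu.2.1.1
  obtain ⟨K, hK⟩ := (isCompact_closedBall (0 : EuclideanSpace ℝ (Fin n)) (L / μ)).exists_bound_of_continuousOn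
    (continuous_gradient hu1).continuousOn
  -- A slope larger than `|Du|` on the ball of radius `L / μ`. The radius `ρ` at which `v'` reaches
  -- it satisfies `μ ρ = p A(p) < L`, so it lies inside that ball.
  set p := max K 0 + 1 with hp
  have hp0 : 0 < p := by positivity
  have hpL : p * A p < L := by
    have h1 : p * A p < (p + 1) * A (p + 1) := hm hp0.le (by simp; linarith) (by linarith)
    refine h1.trans_le (ge_of_tendsto hL ?_)
    filter_upwards [eventually_ge_atTop (p + 1)] with q hq
    exact hm.monotoneOn (by simp; linarith) (by simp; linarith) hq
  -- Continuing linearly beyond `p` makes the bounded flux onto; only slopes up to `p` occur on the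
  -- ball of radius `ρ`.
  set H : ℝ → ℝ := fun q => min q p * A (min q p) + max (q - p) 0 with hH
  have hHc : ContinuousOn H (Ici 0) := by
    have h1 : ContinuousOn (fun q : ℝ => min q p * A (min q p)) (Ici 0) :=
      hA_cont.comp (f := fun q : ℝ => min q p) (by fun_prop) fun q hq => le_min hq hp0.le
    exact h1.add (by fun_prop)
  have hHm : StrictMonoOn H (Ici 0) := by
    intro q hq q' hq' hlt
    have hq0 : 0 ≤ q := hq
    have hq0' : 0 ≤ q' := hq'
    rcases lt_or_ge q p with h1 | h1
    · have h2 : min q p * A (min q p) < min q' p * A (min q' p) := by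
        rw [min_eq_left h1.le]
        exact hm hq (le_min hq0' hp0.le) (lt_min hlt h1)
      have h3 : max (q - p) 0 ≤ max (q' - p) 0 := max_le_max (by linarith) le_rfl
      simp only [hH]
      linarith
    · have h2 : p ≤ q' := h1.trans hlt.le
      simp only [hH, min_eq_right h1, min_eq_right h2, max_eq_left (sub_nonneg.2 h1),
        max_eq_left (sub_nonneg.2 h2)]
      linarith
  have hHt : Tendsto H atTop atTop := by
    have h1 : Tendsto (fun q : ℝ => p * A p + (q - p)) atTop atTop :=
      tendsto_atTop_add_const_left _ _ (tendsto_atTop_add_const_right _ _ tendsto_id)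
    refine h1.congr' ?_
    filter_upwards [eventually_ge_atTop p] with q hq
    simp only [hH, min_eq_right hq, max_eq_left (sub_nonneg.2 hq)]
  obtain ⟨e, he⟩ := exists_orderIso_extending hHc hHm (by simp [hH, hp0.le]) hHt
  have he' : ∀ q, 0 ≤ q → q ≤ p → e q = q * A q := by
    intro q h0 h1
    rw [he q h0]
    simp [hH, h1]
  have he0 : e 0 = 0 := by rw [he' 0 le_rfl hp0.le, zero_mul]
  have hs0 : e.symm 0 = 0 := e.symm_apply_eq.2 he0.symm
  set ρ := p * A p / μ with hρ
  have hρ0 : 0 < ρ := div_pos (mul_pos hp0 (hA_pos p hp0)) hμ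
  have hρL : ρ ≤ L / μ := by rw [hρ]; gcongr
  have hρp : e.symm (μ * ρ) = p := by
    rw [hρ, mul_div_cancel₀ _ hμ.ne', ← he' p hp0.le le_rfl, e.symm_apply_apply]
  have hgradp : ∀ x : EuclideanSpace ℝ (Fin n), ‖x‖ ≤ ρ → ‖gradient u x‖ < p := by
    intro x hx
    have h1 := hK x (mem_closedBall_zero_iff.2 (hx.trans hρL))
    have : K ≤ max K 0 := le_max_left _ _
    linarith
  have hqc : Continuous (fun s => e.symm (μ * s)) := e.symm.continuous.comp (by fun_prop)
  set v : ℝ → ℝ := fun r => a + ∫ s in (0 : ℝ)..r, e.symm (μ * s) with hv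
  have hvd : ∀ r, HasDerivAt v (e.symm (μ * r)) r := fun r => hasDerivAt_base_integral hqc a 0 r
  have hva : ∀ r, 0 ≤ r → a ≤ v r := by
    intro r hr
    have : 0 ≤ ∫ s in (0 : ℝ)..r, e.symm (μ * s) := by
      refine intervalIntegral.integral_nonneg hr fun s hs => ?_
      rw [← hs0]
      exact e.symm.monotone (mul_nonneg hμ.le hs.1)
    simp only [hv]; linarith
  have hv0 : v 0 = a := by simp [hv]
  set w : EuclideanSpace ℝ (Fin n) → ℝ := fun x => u x - v ‖x‖ with hw
  have hVg := hasGradientAt_radial_of_deriv_zero (E := EuclideanSpace ℝ (Fin n))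
    (v := v) (vp := fun r => e.symm (μ * r)) (fun r _ => hvd r) (by simp [hs0])
  have hwc : Continuous w := by
    have h1 : Continuous v := continuous_iff_continuousAt.2 fun r => (hvd r).continuousAt
    have h2 := hu1.continuous
    fun_prop
  obtain ⟨x₁, hx₁, hmax⟩ := (isCompact_closedBall (0 : EuclideanSpace ℝ (Fin n)) ρ).exists_isMaxOn
    ⟨0, by simp [hρ0.le]⟩ hwc.continuousOn
  have hw1 : 0 < w x₁ := by
    have : w 0 ≤ w x₁ := hmax (by simp [hρ0.le])
    have h2 : w 0 = 1 := by simp only [hw, norm_zero, hv0, ha]; ring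
    linarith
  -- On the sphere `v' = p > |Du|`, so `w` increases strictly on moving inward.
  have hsphere : ∀ x ∈ Metric.sphere (0 : EuclideanSpace ℝ (Fin n)) ρ, w x < w x₁ := by
    intro x hx
    rw [mem_sphere_zero_iff_norm] at hx
    by_contra hcon
    push Not at hcon
    have hmax' : ∀ y, ‖y‖ ≤ ρ → w y ≤ w x := fun y hy =>
      (hmax (mem_closedBall_zero_iff.2 hy)).trans hcon
    have hl : HasDerivAt (fun t : ℝ => (1 - t) • x) (-x) 0 := by
      simpa using ((hasDerivAt_id (0 : ℝ)).const_sub 1).smul_const x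
    have hwd : HasFDerivAt w (InnerProductSpace.toDual ℝ _ (gradient u x) -
        InnerProductSpace.toDual ℝ _ ((e.symm (μ * ‖x‖) / ‖x‖) • x)) ((1 - (0 : ℝ)) • x) := by
      rw [sub_zero, one_smul]
      exact (hu1.differentiable (by norm_num) x).hasGradientAt.hasFDerivAt.sub
        (hVg x).hasFDerivAt
    have h1 := hwd.comp_hasDerivAt (0 : ℝ) hl
    rw [← map_sub, InnerProductSpace.toDual_apply_apply, inner_neg_right, inner_sub_left,
      inner_smul_left, real_inner_self_eq_norm_sq, hx, hρp] at h1
    have h2 : ⟪gradient u x, x⟫_ℝ < p * ρ := by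
      calc ⟪gradient u x, x⟫_ℝ ≤ ‖gradient u x‖ * ‖x‖ := real_inner_le_norm _ _
        _ < p * ρ := by rw [hx]; exact mul_lt_mul_of_pos_right (hgradp x hx.le) hρ0
    have h3 : 0 < -(⟪gradient u x, x⟫_ℝ - (starRingEnd ℝ) (p / ρ) * ρ ^ 2) := by
      simp only [conj_trivial]
      field_simp
      linarith
    have h4 := (hasDerivWithinAt_iff_tendsto_slope' (s := Ioi (0 : ℝ)) (by simp)).1
      (h1.hasDerivWithinAt (s := Ioi 0))
    have h5 : ∀ᶠ t in 𝓝[>] (0 : ℝ), slope (w ∘ fun t : ℝ => (1 - t) • x) 0 t ≤ 0 := by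
      filter_upwards [self_mem_nhdsWithin, nhdsWithin_le_nhds (gt_mem_nhds one_pos)] with t ht ht1
      have ht : (0 : ℝ) < t := ht
      rw [slope_def_field, sub_zero]
      refine div_nonpos_of_nonpos_of_nonneg ?_ ht.le
      simp only [Function.comp_apply, sub_zero, one_smul]
      rw [sub_nonpos]
      refine hmax' _ ?_
      rw [norm_smul, Real.norm_of_nonneg (by linarith), hx]
      nlinarith
    exact absurd (le_of_tendsto h4 h5) (not_le.2 h3)
  have hx₁ρ : ‖x₁‖ < ρ := by
    rcases (mem_closedBall_zero_iff.1 hx₁).lt_or_eq with h | h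
    · exact h
    · exact absurd (hsphere x₁ (mem_sphere_zero_iff_norm.2 h)) (lt_irrefl _)
  obtain ⟨M, hM0, hM1, hM⟩ := (isCompact_sphere (0 : EuclideanSpace ℝ (Fin n)) ρ).exists_strict_bound
    hwc.continuousOn hw1 hsphere
  refine weak_comparison hA_pos hu1 hu.2.1.2.1 e he0 (M := M) hμ.le (fun r _ => hvd r)
    (fun x hx => he' _ (norm_nonneg _) (hgradp x hx.le).le) ?_
    (fun x hx => hM x (mem_sphere_zero_iff_norm.2 hx)) hx₁ρ hM1
  intro x _ hMx
  have h1 : a ≤ u x := by linarith [hva ‖x‖ (norm_nonneg x)]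
  have h2 := hu.le_trace hk hf_pos x
  have h3 : n * μ < f a := by
    rw [hμdef]
    have := hf_pos a
    field_simp
    linarith
  linarith [hf_mono h1]

lemma esymm_le_of_rel_replicate (hk : 1 ≤ k) (hkn : k ≤ n) {s : Multiset ℝ} (hs : EsymmPos k s)
    {d t : ℝ} (h : Multiset.Rel (· ≤ ·) s ((d + t) ::ₘ Multiset.replicate (n - 1) t))
    (hd : 0 ≤ d) (ht : 0 ≤ t) :
    s.esymm k ≤ n.choose k * (d * t ^ (k - 1) + t ^ k) := by
  refine (hs.esymm_le_of_rel h).trans ?_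
  obtain ⟨j, rfl⟩ : ∃ j, k = j + 1 := ⟨k - 1, by omega⟩
  obtain ⟨m, rfl⟩ : ∃ m, n = m + 1 := ⟨n - 1, by omega⟩
  rw [Nat.add_sub_cancel, Nat.add_sub_cancel, Multiset.esymm_cons_replicate, Nat.choose_succ_succ]
  push_cast
  have : 0 ≤ (m.choose (j + 1) : ℝ) * (d * t ^ j) := by positivity
  rw [pow_succ]
  nlinarith

/-- At a contact point outside the inner ball, the glued profile bounds `σ_k`. -/
lemma esymm_le_at_contact {e ψ : ℝ ≃o ℝ} (h : IsLegendrePair A k e ψ) (hk : 1 ≤ k) (hkn : k ≤ n)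
    (hA_pos : ∀ p : ℝ, 0 < p → 0 < A p) (hA_smooth : ContDiffOn ℝ 1 A (Ioi 0))
    (hu : IsEntireSolution n k A f u) {z hz : ℝ → ℝ} (hzp : ∀ s, 0 < z s) {s₀ μ sm : ℝ} (hμ : 0 < μ)
    {v vp : ℝ → ℝ} (hv : IsGluedProfile e ψ z s₀ 1 μ v vp)
    (hd : ∀ s, s₀ ≤ s → s < sm → HasDerivWithinAt z (hz s) (Ici s) s)
    (hz0 : ∀ s, 0 ≤ hz s) (hzm : Monotone hz)
    {x : EuclideanSpace ℝ (Fin n)} (hx : 1 ≤ ‖x‖) (hxm : v ‖x‖ < sm)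
    (hmax : IsLocalMax (fun y => u y - v ‖y‖) x) :
    (eigenvalueMultiset (fluxMatrix A u x)).esymm k ≤ n.choose k * (2 * hz (v ‖x‖) + μ ^ k) := by
  have hx0 : x ≠ 0 := norm_pos_iff.1 (one_pos.trans_le hx)
  have hr : 0 < ‖x‖ := norm_pos_iff.2 hx0
  have hvm := hv.v_mono h hμ hzp
  have hp := hv.vp_pos h hμ hzp hr
  set r := ‖x‖ with hrdef
  set W := hz (v r) with hW
  have hW0 : 0 ≤ W := hz0 _
  have hD := hd (v r) (hv.le_outer r hx) hxm
  have hgd := hv.flux_hasDerivWithinAt h hk one_pos hμ hzp hx hD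
  set g := e (vp r) with hg
  have hg0 : 0 < g := h.e_pos hp
  have hdpos : 0 ≤ W / (k * g ^ (k - 1)) := by positivity
  have hrel := RadialContact.rel_eigenvalues (hk.trans hkn) e hx0
    (hu.1.contDiffAt (isOpen_compl_singleton.mem_nhds hx0))
    (Eventually.of_forall hv.deriv) hv.cont.continuousAt hp (hA_pos _ hp)
    ((hA_smooth.contDiffAt (Ioi_mem_nhds hp)).differentiableAt (by norm_num)).hasDerivAt
    (by filter_upwards [Ioi_mem_nhds hp] with p hp' using h.e_eq p (le_of_lt hp')) hgd hdpos hmax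
  have h1 := esymm_le_of_rel_replicate hk hkn (hu.esymmPos x) hrel hdpos (by positivity)
  refine h1.trans ?_
  -- Integrates `(gᵏ)' = hz(v) ≤ W` outward from radius `1`, where the flux equals `μ`.
  have hpow : g ^ k ≤ μ ^ k + W * (r - 1) := by
    refine image_le_of_deriv_right_le_deriv_boundary (f := fun ρ => e (vp ρ) ^ k) (a := 1) (b := r)
      (f' := fun ρ => hz (v ρ)) (B := fun ρ => μ ^ k + W * (ρ - 1)) (B' := fun _ => W)
      ((e.continuous.comp hv.cont).pow k).continuousOn ?_ ?_ (by fun_prop) ?_ ?_ (right_mem_Icc.2 hx)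
    · intro ρ hρ
      have h2 : v ρ ≤ v r := hvm (mem_Ici.2 (by linarith [hρ.1])) (mem_Ici.2 hr.le) hρ.2.le
      exact hv.flux_pow_hasDerivWithinAt h one_pos hμ hzp hρ.1
        (hd _ (hv.le_outer ρ hρ.1) (h2.trans_lt hxm))
    · simp [hv.inner 1 le_rfl]
    · intro ρ _
      have : HasDerivAt (fun ρ : ℝ => μ ^ k + W * (ρ - 1)) (W * 1) ρ :=
        (((hasDerivAt_id ρ).sub_const 1).const_mul W).const_add _
      rw [mul_one] at this
      exact this.hasDerivWithinAt
    · intro ρ hρ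
      exact hzm (hvm (mem_Ici.2 (by linarith [hρ.1])) (mem_Ici.2 hr.le) hρ.2.le)
  have hrk : 1 ≤ r ^ (k - 1) := one_le_pow₀ hx
  have hk1 : (1 : ℝ) ≤ k := by exact_mod_cast hk
  have e1 : W / (k * g ^ (k - 1)) * (g / r) ^ (k - 1) ≤ W := by
    have : W / (k * g ^ (k - 1)) * (g / r) ^ (k - 1) = W / (k * r ^ (k - 1)) := by
      rw [div_pow]; field_simp
    rw [this]
    exact div_le_self hW0 (one_le_mul_of_one_le_of_one_le hk1 hrk)
  have e2 : (g / r) ^ k ≤ μ ^ k + W := by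
    rw [div_pow, div_le_iff₀ (by positivity)]
    have hrr : r ≤ r ^ k := le_self_pow₀ hx (by omega)
    have hμk : 0 ≤ μ ^ k := by positivity
    nlinarith [mul_le_mul_of_nonneg_left hrr hW0, mul_le_mul_of_nonneg_left (hx.trans hrr) hμk]
  have : (0 : ℝ) ≤ n.choose k := by positivity
  refine mul_le_mul_of_nonneg_left ?_ this
  linarith

/-- The Keller–Osserman condition is necessary for the existence of an entire solution. -/
theorem IsEntireSolution.psiKellerOsserman {e ψ : ℝ ≃o ℝ} (h : IsLegendrePair A k e ψ) (hk : 1 ≤ k)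
    (hkn : k ≤ n) (hA_pos : ∀ p : ℝ, 0 < p → 0 < A p) (hA_smooth : ContDiffOn ℝ 1 A (Ioi 0))
    (hf_cont : Continuous f) (hf_pos : ∀ t : ℝ, 0 < f t) (hf_mono : Monotone f)
    (hu : IsEntireSolution n k A f u) {b c : ℝ} (hcb : c ≤ b) : PsiKellerOsserman A f k c b := by
  rw [PsiKellerOsserman_iff h hf_cont hf_pos hf_mono hcb]
  intro hint
  have hwc : Continuous fun t => f t ^ k := hf_cont.pow k
  have hwm : Monotone fun t => f t ^ k :=
    fun s t hst => pow_le_pow_left₀ (hf_pos s).le (hf_mono hst) k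
  have hwp : ∀ t, 0 < f t ^ k := fun t => pow_pos (hf_pos t) k
  have hu1 : ContDiff ℝ 1 u := hu.2.1.1
  set a₁ := u 0 - 1 with ha₁
  -- A lower bound for `v` known before `μ`: `v 1 = a₁`, and on `[0, 1]` the slope is at most
  -- `e.symm 1` because `μ ≤ 1`.
  set a := a₁ - e.symm 1 with ha
  set N : ℝ := ((n.choose k : ℕ) : ℝ) with hN
  have hN1 : 1 ≤ N := by
    rw [hN]; exact_mod_cast Nat.choose_pos hkn
  have hfa := hf_pos a
  set D : ℝ := 8 * (n + 1) * N with hD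
  have hD1 : 8 ≤ D := by
    rw [hD]
    have : (0 : ℝ) ≤ n := by positivity
    nlinarith
  set μ := min 1 (f a / D) with hμdef
  have hμ : 0 < μ := lt_min one_pos (by positivity)
  have hμ1 : μ ≤ 1 := min_le_left _ _
  have hμD : μ ≤ f a / D := min_le_right _ _
  have hμf : n * μ < f a := by
    have h1 : μ * D ≤ f a := (le_div_iff₀ (by positivity)).1 hμD
    have : n * μ < μ * D := by
      rw [hD]
      have : (0 : ℝ) ≤ n := by positivity
      nlinarith [mul_pos hμ (show (0 : ℝ) < n + 1 by positivity)]
    linarith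
  have hμk : N * μ ^ k ≤ f a ^ k / 8 := by
    calc N * μ ^ k ≤ N * (f a / D) ^ k := by gcongr
      _ = N * f a ^ k / D ^ k := by rw [div_pow]; ring
      _ ≤ N * f a ^ k / D := by
          gcongr
          exact le_self_pow₀ (by linarith) (by omega)
      _ ≤ N * f a ^ k / (8 * N) := by
          gcongr
          rw [hD]
          have : (0 : ℝ) ≤ n := by positivity
          nlinarith
      _ = f a ^ k / 8 := by field_simp
  -- At a contact `σ_k ≤ N (2 ε f(v)ᵏ + μᵏ)`; this `ε` and the size of `D` bound it by `(1/4 + 1/8)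
  -- f(v)ᵏ`.
  set ε := 1 / (8 * N) with hε
  have hε0 : 0 < ε := by positivity
  have hes : 0 < e.symm (μ * 1) := by
    rw [← h.e_symm_zero]; exact e.symm.strictMono (by linarith)
  set E := ψ (e.symm (μ * 1)) with hE
  have hE0 : 0 < E := by rw [hE, ← h.psi_zero]; exact ψ.strictMono hes
  have hI : IntegrableOn (fun s => (ψ.symm (E + ε * ∫ t in a₁..s, f t ^ k))⁻¹) (Ioi a₁) := by
    refine h.isKernel.integrableOn_Ioi hwc hwm hwp hE0.le hε0 ?_
    refine h.isKernel.tail_transfer hwc hwm hwp (E := 0) (C := 1) (a := c) le_rfl one_pos hE0.le hε0 ?_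
    simpa using hint
  set J := ∫ s in Ioi a₁, (ψ.symm (E + ε * ∫ t in a₁..s, f t ^ k))⁻¹ with hJ
  obtain ⟨U, hU⟩ := (isCompact_closedBall (0 : EuclideanSpace ℝ (Fin n)) (1 + J)).exists_bound_of_continuousOn
    hu1.continuous.continuousOn
  -- A height above `u` on the ball of radius `1 + J`. Freezing `z` beyond `sm` makes the profile
  -- global, and the radius at which it reaches `sm` is still at most `1 + J`, as `J` does not
  -- depend on `sm`.
  set sm := max U a₁ + 1 with hsm
  have hsma : a₁ < sm := by have := le_max_right U a₁; linarith
  have hsmU : U < sm := by have := le_max_left U a₁; linarith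
  set z : ℝ → ℝ := fun s => E + ε * ∫ t in a₁..(min (max s a₁) sm), f t ^ k with hzdef
  have hzc : Continuous z := by
    have h1 : Continuous (fun s : ℝ => min (max s a₁) sm) := by fun_prop
    have h2 := (continuous_cumul hwc a₁).comp h1
    exact continuous_const.add (continuous_const.mul h2)
  have hz_eq : ∀ s, a₁ ≤ s → s ≤ sm → z s = E + ε * ∫ t in a₁..s, f t ^ k := by
    intro s h1 h2
    simp only [hzdef]
    rw [max_eq_left h1, min_eq_left h2]
  have hclamp : ∀ s, a₁ ≤ min (max s a₁) sm := fun s => le_min (le_max_right _ _) hsma.le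
  have hzp : ∀ s, 0 < z s := fun s => by
    have := mul_nonneg hε0.le (cumul_nonneg hwp (hclamp s))
    simp only [hzdef]
    linarith
  have hz0 : ∀ s, s ≤ a₁ → z s = z a₁ := by
    intro s hs
    simp only [hzdef]
    rw [max_eq_right hs, max_self]
  have hza : z a₁ = E := by rw [hz_eq a₁ le_rfl hsma.le]; simp
  have hzle : ∀ s, z s ≤ z sm := by
    intro s
    have h1 := cumul_add hwc a₁ (min (max s a₁) sm) sm
    have h2 := cumul_nonneg hwp (min_le_right (max s a₁) sm)
    rw [hz_eq sm hsma.le le_rfl]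
    simp only [hzdef]
    rw [h1]
    nlinarith
  have hqc : Continuous fun t => (ψ.symm (z t))⁻¹ :=
    (ψ.symm.continuous.comp hzc).inv₀ fun t => (h.symm_pos (hzp t)).ne'
  have htop : Tendsto (fun s => 1 + ∫ t in a₁..s, (ψ.symm (z t))⁻¹) atTop atTop := by
    have hq0 : 0 < (ψ.symm (z sm))⁻¹ := inv_pos.2 (h.symm_pos (hzp sm))
    have h1 : Tendsto (fun s => 1 + (ψ.symm (z sm))⁻¹ * (s - a₁)) atTop atTop :=
      tendsto_atTop_add_const_left _ _
        ((tendsto_atTop_add_const_right _ _ tendsto_id).const_mul_atTop hq0)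
    refine tendsto_atTop_mono' _ ?_ h1
    filter_upwards [eventually_ge_atTop a₁] with s hs
    have h2 := intervalIntegral.integral_mono_on (μ := volume) hs
      (intervalIntegrable_const (c := (ψ.symm (z sm))⁻¹)) (hqc.intervalIntegrable a₁ s)
      fun t _ => inv_anti₀ (h.symm_pos (hzp t)) (ψ.symm.monotone (hzle t))
    simp only [intervalIntegral.integral_const, smul_eq_mul] at h2
    linarith
  obtain ⟨v, vp, hv⟩ := exists_gluedProfile h hzc hzp hz0 (r₀ := 1) (μ := μ)
    (by rw [hza, hE, ψ.symm_apply_apply]) htop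
  have hvm := hv.v_mono h hμ hzp
  set rm := 1 + ∫ t in a₁..sm, (ψ.symm (z t))⁻¹ with hrm
  have hvrm : v rm = sm := hv.param sm hsma.le
  have hrmJ : rm ≤ 1 + J := by
    rw [hrm, hJ, intervalIntegral.integral_of_le hsma.le]
    gcongr
    calc ∫ t in Ioc a₁ sm, (ψ.symm (z t))⁻¹
        = ∫ t in Ioc a₁ sm, (ψ.symm (E + ε * ∫ t in a₁..t, f t ^ k))⁻¹ := by
          refine setIntegral_congr_fun measurableSet_Ioc fun t ht => ?_
          rw [hz_eq t ht.1.le ht.2]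
      _ ≤ _ := by
          refine setIntegral_mono_set hI ?_ (Eventually.of_forall fun t ht => ht.1)
          refine (ae_restrict_iff' measurableSet_Ioi).2 (Eventually.of_forall fun t ht => ?_)
          have := mul_nonneg hε0.le (cumul_nonneg hwp (le_of_lt (mem_Ioi.1 ht)))
          exact inv_nonneg.2 (h.symm_nonneg (by linarith))
  have hrm1 : 1 ≤ rm := by
    have : 0 ≤ ∫ t in a₁..sm, (ψ.symm (z t))⁻¹ :=
      intervalIntegral.integral_nonneg hsma.le fun t _ => inv_nonneg.2 (h.symm_pos (hzp t)).le
    linarith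
  have hrm0 : 0 ≤ rm := by linarith
  set q : ℝ → ℝ := fun s => e.symm (μ * s) with hq
  have hqc' : Continuous q := e.symm.continuous.comp (by fun_prop)
  -- `weak_comparison` asks for linear flux at every radius, so the inner part of `v` is continued
  -- with flux `μ r`.
  set v₂ : ℝ → ℝ := fun r => a₁ + ∫ s in (1 : ℝ)..r, q s with hv₂
  have hv₂d : ∀ r, HasDerivAt v₂ (q r) r := fun r => hasDerivAt_base_integral hqc' a₁ 1 r
  have hvv₂ : ∀ r, r ≤ 1 → v r = v₂ r := by
    intro r hr
    have h1 : ∫ s in (1 : ℝ)..r, vp s = v r - v 1 :=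
      intervalIntegral.integral_eq_sub_of_hasDerivAt (fun t _ => hv.deriv t)
        (hv.cont.intervalIntegrable _ _)
    have h2 : ∫ s in (1 : ℝ)..r, vp s = ∫ s in (1 : ℝ)..r, q s := by
      refine intervalIntegral.integral_congr fun t ht => ?_
      rw [uIcc_of_ge hr] at ht
      exact hv.inner t ht.2
    simp only [hv₂]
    rw [← h2, h1, hv.base]
    ring
  have hva : ∀ r, 0 ≤ r → a ≤ v r := by
    intro r hr
    refine le_trans ?_ (hvm self_mem_Ici hr hr)
    rw [hvv₂ 0 zero_le_one]
    have h1 : ∫ s in (0 : ℝ)..1, q s ≤ ∫ s in (0 : ℝ)..1, e.symm 1 := by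
      refine intervalIntegral.integral_mono_on zero_le_one (hqc'.intervalIntegrable _ _)
        intervalIntegrable_const fun s hs => e.symm.monotone ?_
      nlinarith [hs.1, hs.2]
    simp only [intervalIntegral.integral_const, smul_eq_mul, sub_zero, one_mul] at h1
    simp only [hv₂]
    rw [intervalIntegral.integral_symm]
    linarith
  set w : EuclideanSpace ℝ (Fin n) → ℝ := fun x => u x - v ‖x‖ with hw
  have hwcont : Continuous w := by
    have h1 : Continuous v := continuous_iff_continuousAt.2 fun r => (hv.deriv r).continuousAt
    have h2 := hu1.continuous
    fun_prop
  obtain ⟨x₁, hx₁, hmax⟩ := (isCompact_closedBall (0 : EuclideanSpace ℝ (Fin n)) rm).exists_isMaxOn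
    ⟨0, by simp [hrm0]⟩ hwcont.continuousOn
  have hw1 : 0 < w x₁ := by
    have h1 : w 0 ≤ w x₁ := hmax (by simp [hrm0])
    have h2 : v 0 ≤ v 1 := hvm self_mem_Ici (mem_Ici.2 zero_le_one) zero_le_one
    rw [hv.base] at h2
    have h3 : w 0 = u 0 - v 0 := by simp only [hw, norm_zero]
    linarith
  have houter : ∀ x : EuclideanSpace ℝ (Fin n), 1 ≤ ‖x‖ → ‖x‖ ≤ rm → w x < w x₁ := by
    intro x hx1 hxr
    by_contra hcon
    push Not at hcon
    have hux : u x ≤ U := (le_abs_self _).trans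
      (hU x (mem_closedBall_zero_iff.2 (hxr.trans hrmJ)))
    have hvx : v ‖x‖ < u x := by
      have : 0 < u x - v ‖x‖ := hw1.trans_le hcon
      linarith
    have hxlt : ‖x‖ < rm := by
      rcases hxr.lt_or_eq with h1 | h1
      · exact h1
      · rw [h1, hvrm] at hvx; linarith
    have hlm : IsLocalMax w x := by
      filter_upwards [continuous_norm.continuousAt.eventually_lt continuousAt_const hxlt] with y hy
      exact (hmax (mem_closedBall_zero_iff.2 hy.le)).trans hcon
    have h1 := esymm_le_at_contact h hk hkn hA_pos hA_smooth hu (hz := fun s => ε * f s ^ k) hzp hμ hv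
      (sm := sm) (by
        intro s hs1 hs2
        have h2 : HasDerivAt (fun s => E + ε * ∫ t in a₁..s, f t ^ k) (ε * f s ^ k) s :=
          ((intervalIntegral.integral_hasDerivAt_right (hwc.intervalIntegrable _ _)
            (hwc.stronglyMeasurableAtFilter _ _) hwc.continuousAt).const_mul ε).const_add E
        refine h2.hasDerivWithinAt.congr_of_eventuallyEq_of_mem ?_ self_mem_Ici
        filter_upwards [self_mem_nhdsWithin, nhdsWithin_le_nhds (gt_mem_nhds hs2)] with t ht ht2
        exact hz_eq t (hs1.trans ht) ht2.le)
      (fun s => (mul_pos hε0 (hwp s)).le)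
      (fun s t hst => mul_le_mul_of_nonneg_left (hwm hst) hε0.le) hx1 (by linarith) hlm
    have h2 := hu.pow_le_esymm hk hf_pos x
    have h3 : f (v ‖x‖) ^ k ≤ f (u x) ^ k := hwm hvx.le
    have h4 : f a ^ k ≤ f (v ‖x‖) ^ k := hwm (hva _ (norm_nonneg _))
    have h5 := hwp (v ‖x‖)
    have h6 : N * (2 * (ε * f (v ‖x‖) ^ k) + μ ^ k) = f (v ‖x‖) ^ k / 4 + N * μ ^ k := by
      rw [hε]; field_simp; ring
    rw [h6] at h1
    linarith
  have hx₁1 : ‖x₁‖ < 1 := by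
    by_contra hcon
    push Not at hcon
    exact absurd (houter x₁ hcon (mem_closedBall_zero_iff.1 hx₁)) (lt_irrefl _)
  obtain ⟨M, hM0, hM1, hM⟩ :=
    (isCompact_sphere (0 : EuclideanSpace ℝ (Fin n)) 1).exists_strict_bound hwcont.continuousOn hw1
      fun x hx => by
        rw [mem_sphere_zero_iff_norm] at hx
        exact houter x hx.ge (hx.le.trans hrm1)
  refine weak_comparison hA_pos hu1 hu.2.1.2.1 e h.e_zero (M := M) (ρ := 1) hμ.le
    (fun r _ => hv₂d r) (fun x _ => h.e_eq _ (norm_nonneg _)) ?_ ?_ hx₁1 ?_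
  · intro x hx hMx
    rw [← hvv₂ _ hx.le] at hMx
    have h1 : a ≤ u x := by linarith [hva ‖x‖ (norm_nonneg x)]
    linarith [hu.le_trace hk hf_pos x, hf_mono h1]
  · intro x hx
    rw [← hvv₂ _ hx.le]
    exact hM x (mem_sphere_zero_iff_norm.2 hx)
  · rw [← hvv₂ _ hx₁1.le]
    exact hM1

end Necessity

/-! ### A delay equation solved by stepwise iteration. -/

section DelayEquation

/-- Method of steps: each application of `T` extends by one unit the half-line on which the iterates
have stabilised, so their eventual value is a fixed point. No contraction is needed. -/
lemma exists_continuous_fixedPoint_of_delay (T : (ℝ → ℝ) → ℝ → ℝ)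
    (h0 : ∀ r r' s, s ≤ 0 → T r s = T r' s)
    (hstep : ∀ r r' a, (∀ t, t ≤ a → r t = r' t) → ∀ s, s ≤ a + 1 → T r s = T r' s)
    (hcont : ∀ r, Continuous r → Continuous (T r)) : ∃ r, Continuous r ∧ T r = r := by
  set R : ℕ → ℝ → ℝ := fun j => T^[j + 1] 0 with hR
  have hRs : ∀ j, R (j + 1) = T (R j) := fun j => Function.iterate_succ_apply' T (j + 1) 0
  have hRc : ∀ j, Continuous (R j) := by
    intro j
    induction j with
    | zero => exact hcont 0 continuous_const
    | succ j ih => rw [hRs]; exact hcont _ ih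
  have h1 : ∀ (j : ℕ) (s : ℝ), s ≤ j → R (j + 1) s = R j s := by
    intro j
    induction j with
    | zero =>
      intro s hs
      rw [hRs]
      exact h0 _ _ s (by simpa using hs)
    | succ j ih =>
      intro s hs
      rw [hRs (j + 1), hRs j]
      exact hstep _ _ j ((hRs j) ▸ ih) s (by simpa using hs)
  have h2 : ∀ (i j : ℕ) (s : ℝ), s ≤ i → i ≤ j → R j s = R i s := by
    intro i j s hs hij
    induction j, hij using Nat.le_induction with
    | base => rfl
    | succ j hij ih =>
      rw [h1 j s (hs.trans (by exact_mod_cast hij)), ih]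
  set r : ℝ → ℝ := fun s => R ⌈s⌉₊ s with hr
  have h3 : ∀ (j : ℕ) (s : ℝ), s ≤ j → r s = R j s := fun j s hs =>
    (h2 _ _ s (Nat.le_ceil s) (Nat.ceil_le.2 hs)).symm
  refine ⟨r, continuous_iff_continuousAt.2 fun s => ?_, ?_⟩
  · obtain ⟨j, hj⟩ := exists_nat_gt s
    refine (hRc j).continuousAt.congr ?_
    filter_upwards [gt_mem_nhds hj] with t ht using (h3 j t (le_of_lt ht)).symm
  · funext s
    have h4 := hstep r (R ⌈s⌉₊) ⌈s⌉₊ (h3 _) s ((Nat.le_ceil s).trans (by simp))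
    rw [h4, ← hRs, h1 _ _ (Nat.le_ceil s)]

/-- Here `r s` is the radius at which the profile has height `s`. The required `z'` involves that
radius, whose delayed value plus `δ` stands in for it. -/
lemma exists_delay_profile {A : ℝ → ℝ} {k : ℕ} {e ψ : ℝ ≃o ℝ} (h : IsLegendrePair A k e ψ)
    {w : ℝ → ℝ} (hw : Continuous w) (hwp : ∀ t, 0 < w t) {E K r₀ δ : ℝ} (hE : 0 < E) (hK : 0 < K)
    (hr₀ : 0 < r₀) (hδ : 0 < δ) (j : ℕ) :
    ∃ r z hz : ℝ → ℝ, Continuous r ∧ Continuous z ∧ Continuous hz ∧ (∀ s, E ≤ z s) ∧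
      (∀ t, hz t = K * (max (r (t - 1)) r₀ + δ) ^ j * w t) ∧
      (∀ s, z s = E + ∫ t in (0 : ℝ)..(max s 0), hz t) ∧
      ∀ s, r s = r₀ + ∫ t in (0 : ℝ)..s, (ψ.symm (z t))⁻¹ := by
  set H : (ℝ → ℝ) → ℝ → ℝ := fun r t => K * (max (r (t - 1)) r₀ + δ) ^ j * w t with hH
  set Z : (ℝ → ℝ) → ℝ → ℝ := fun r s => E + ∫ t in (0 : ℝ)..(max s 0), H r t with hZ
  set T : (ℝ → ℝ) → ℝ → ℝ := fun r s => r₀ + ∫ t in (0 : ℝ)..s, (ψ.symm (Z r t))⁻¹ with hT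
  have hHc : ∀ r, Continuous r → Continuous (H r) := fun r hr => by
    have : Continuous fun t => r (t - 1) := hr.comp (by fun_prop)
    fun_prop
  have hHp : ∀ r t, 0 < H r t := fun r t => by
    have : 0 < max (r (t - 1)) r₀ := lt_max_of_lt_right hr₀
    have := hwp t
    simp only [hH]
    positivity
  have hZc : ∀ r, Continuous r → Continuous (Z r) := fun r hr =>
    continuous_const.add ((continuous_cumul (hHc r hr) 0).comp (by fun_prop))
  have hZE : ∀ r s, E ≤ Z r s := fun r s =>
    le_add_of_nonneg_right
      (intervalIntegral.integral_nonneg (le_max_right _ _) fun t _ => (hHp r t).le)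
  have hTc : ∀ r, Continuous r → Continuous (T r) := fun r hr =>
    continuous_const.add (continuous_cumul ((ψ.symm.continuous.comp (hZc r hr)).inv₀
      fun t => (h.symm_pos (hE.trans_le (hZE r t))).ne') 0)
  have hZ0 : ∀ r t, t ≤ 0 → Z r t = E := fun r t ht => by simp [hZ, max_eq_right ht]
  have hZs : ∀ r r' a, (∀ t, t ≤ a → r t = r' t) → ∀ s, s ≤ a + 1 → Z r s = Z r' s := by
    intro r r' a hrr s hs
    rcases le_total s 0 with h0 | h0
    · rw [hZ0 r s h0, hZ0 r' s h0]
    · simp only [hZ, max_eq_left h0]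
      congr 1
      refine intervalIntegral.integral_congr fun t ht => ?_
      rw [uIcc_of_le h0] at ht
      simp only [hH]
      rw [hrr (t - 1) (by linarith [ht.2])]
  have hT0 : ∀ r r' s, s ≤ 0 → T r s = T r' s := by
    intro r r' s hs
    simp only [hT]
    congr 1
    refine intervalIntegral.integral_congr fun t ht => ?_
    rw [uIcc_of_ge hs] at ht
    simp only [hZ0 _ t ht.2]
  obtain ⟨r, hrc, hr⟩ := exists_continuous_fixedPoint_of_delay T hT0 (by
    intro r r' a hrr s hs
    rcases le_total s 0 with h0 | h0
    · exact hT0 _ _ s h0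
    · simp only [hT]
      congr 1
      refine intervalIntegral.integral_congr fun t ht => ?_
      rw [uIcc_of_le h0] at ht
      simp only [hZs r r' a hrr t (ht.2.trans hs)]) hTc
  exact ⟨r, Z r, H r, hrc, hZc r hrc, hHc r hrc, hZE r, fun _ => rfl, fun _ => rfl,
    fun s => (congrFun hr s).symm⟩

end DelayEquation

/-! ### From a radial profile to an entire solution. -/

section RadialSolution

open scoped InnerProductSpace Matrix

lemma cons_replicate_mem_gammaCone {n k : ℕ} (hn : 1 ≤ n) (hkn : k ≤ n) {D d : ℝ} (hD : 0 < D)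
    (hd : 0 < d) : D ::ₘ Multiset.replicate (n - 1) d ∈ gammaCone n k := by
  refine ⟨by rw [Multiset.card_cons, Multiset.card_replicate]; omega, fun l hl hlk => ?_⟩
  obtain ⟨l, rfl⟩ : ∃ j, l = j + 1 := ⟨l - 1, by omega⟩
  rw [Multiset.esymm_cons_replicate]
  have : 0 < (n - 1).choose l := Nat.choose_pos (by omega)
  positivity

lemma mul_pow_le_esymm_cons_replicate {n k : ℕ} (hk : 1 ≤ k) (hkn : k ≤ n) {D d : ℝ} (hD : 0 < D)
    (hd : 0 < d) : D * d ^ (k - 1) ≤ (D ::ₘ Multiset.replicate (n - 1) d).esymm k := by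
  obtain ⟨k, rfl⟩ : ∃ j, k = j + 1 := ⟨k - 1, by omega⟩
  rw [Multiset.esymm_cons_replicate, Nat.add_sub_cancel]
  have h1 : (1 : ℝ) ≤ (n - 1).choose k := by exact_mod_cast Nat.choose_pos (by omega)
  have h2 : 0 ≤ ((n - 1).choose (k + 1) : ℝ) * d ^ (k + 1) := by positivity
  have h3 : 0 < D * d ^ k := by positivity
  nlinarith

lemma eigenvalueMultiset_fluxMatrix_of_rankOne {n : ℕ} (hn : 1 ≤ n) {A : ℝ → ℝ}
    {u : EuclideanSpace ℝ (Fin n) → ℝ} {x e : EuclideanSpace ℝ (Fin n)}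
    {L : EuclideanSpace ℝ (Fin n) →L[ℝ] EuclideanSpace ℝ (Fin n)} {c d : ℝ} (he : ‖e‖ = 1)
    (hL : HasFDerivAt (fluxField A u) L x) (hLe : ∀ y, L y = d • y + (c * ⟪e, y⟫_ℝ) • e) :
    eigenvalueMultiset (fluxMatrix A u x) = (d + c) ::ₘ Multiset.replicate (n - 1) d := by
  have he2 : e.ofLp ⬝ᵥ e.ofLp = 1 := by
    have := EuclideanSpace.real_norm_sq_eq e
    rw [he] at this
    simp only [dotProduct]
    rw [← one_pow 2, this]
    exact Finset.sum_congr rfl fun i _ => (sq _).symm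
  rw [eigenvalueMultiset_fluxMatrix_eq hL, ← roots_charpoly_scalar_add_rankOne hn e.ofLp he2]
  congr 2
  ext i j
  simp [LinearMap.toMatrix_apply, hLe, Matrix.vecMulVec_apply, Matrix.one_apply,
    EuclideanSpace.inner_single_right]
  ring

lemma hasFDerivAt_radial_field {E : Type*} [NormedAddCommGroup E] [InnerProductSpace ℝ E]
    {g : ℝ → ℝ} {g' : ℝ} {x : E} (hx : x ≠ 0) (hg : HasDerivAt g g' ‖x‖) :
    ∃ L : E →L[ℝ] E, HasFDerivAt (fun y => (g ‖y‖ / ‖y‖) • y) L x ∧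
      ∀ y, L y = (g ‖x‖ / ‖x‖) • y +
        ((g' - g ‖x‖ / ‖x‖) * ⟪‖x‖⁻¹ • x, y⟫_ℝ) • (‖x‖⁻¹ • x) := by
  have hr : ‖x‖ ≠ 0 := norm_ne_zero_iff.2 hx
  have h1 : HasDerivAt (fun ρ => g ρ / ρ) ((g' * ‖x‖ - g ‖x‖ * 1) / ‖x‖ ^ 2) ‖x‖ :=
    hg.div (hasDerivAt_id ‖x‖) hr
  have h2 := h1.comp_hasFDerivAt x (hasFDerivAt_norm_of_ne_zero hx)
  have h3 := h2.smul (hasFDerivAt_id x)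
  refine ⟨_, h3, fun y => ?_⟩
  simp only [add_apply, smul_apply,
    ContinuousLinearMap.smulRight_apply, Function.comp_apply, inner_smul_left, conj_trivial,
    smul_smul, smul_eq_mul, innerSL_apply_apply, ContinuousLinearMap.id_apply, id_eq]
  congr 2
  field_simp

lemma contDiffOn_one_of_hasDerivAt {v vp : ℝ → ℝ} {s : Set ℝ} (hs : IsOpen s)
    (hv : ∀ r ∈ s, HasDerivAt v (vp r) r) (hc : ContinuousOn vp s) : ContDiffOn ℝ 1 v s := by
  have := (contDiffOn_succ_iff_deriv_of_isOpen (𝕜 := ℝ) (n := 0) (f := v) hs).2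
    ⟨fun r hr => (hv r hr).differentiableAt.differentiableWithinAt, by simp, by
      rw [contDiffOn_zero]; exact hc.congr fun r hr => (hv r hr).deriv⟩
  simpa using this

lemma contDiffOn_two_of_hasDerivAt {v vp : ℝ → ℝ} {s : Set ℝ} (hs : IsOpen s)
    (hv : ∀ r ∈ s, HasDerivAt v (vp r) r) (hc : ContDiffOn ℝ 1 vp s) : ContDiffOn ℝ 2 v s := by
  have := (contDiffOn_succ_iff_deriv_of_isOpen (𝕜 := ℝ) (n := 1) (f := v) hs).2
    ⟨fun r hr => (hv r hr).differentiableAt.differentiableWithinAt, by simp,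
      hc.congr fun r hr => (hv r hr).deriv⟩
  simpa [one_add_one_eq_two] using this

variable {n k : ℕ} {A f : ℝ → ℝ}

lemma fluxField_radial {e : ℝ ≃o ℝ} (he : ∀ p, 0 ≤ p → e p = p * A p) {v vp : ℝ → ℝ}
    (hvd : ∀ r, 0 ≤ r → HasDerivAt v (vp r) r) (hvp0 : vp 0 = 0) (hvp : ∀ r, 0 < r → 0 < vp r) :
    fluxField A (fun x : EuclideanSpace ℝ (Fin n) => v ‖x‖) =
      fun x => (e (vp ‖x‖) / ‖x‖) • x := by
  funext x
  simp only [fluxField, (hasGradientAt_radial_of_deriv_zero hvd hvp0 x).gradient]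
  rcases eq_or_ne x 0 with rfl | hx
  · simp
  · have hr : 0 < ‖x‖ := norm_pos_iff.2 hx
    have hp := hvp _ hr
    rw [norm_smul, Real.norm_of_nonneg (by positivity), div_mul_cancel₀ _ hr.ne', smul_smul,
      he _ hp.le]
    congr 1
    ring

/-- A radial profile whose flux `g = e ∘ v'` is linear near the origin and satisfies
`f(v)ᵏ ≤ g' (g / r)ᵏ⁻¹` gives an entire solution. -/
theorem isEntireSolution_radial (hk : 1 ≤ k) (hkn : k ≤ n) (hA_smooth : ContDiffOn ℝ 1 A (Ioi 0))
    (hA_deriv : ∀ p : ℝ, 0 < p → 0 < deriv (fun t : ℝ => t * A t) p) (hf_pos : ∀ t, 0 < f t)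
    {e : ℝ ≃o ℝ} (he : ∀ p, 0 ≤ p → e p = p * A p) {v vp gp : ℝ → ℝ} {r₀ μ : ℝ} (hr₀ : 0 < r₀)
    (hμ : 0 < μ) (hvd : ∀ r, HasDerivAt v (vp r) r) (hvc : Continuous vp)
    (hinner : ∀ r, r ≤ r₀ → e (vp r) = μ * r) (hvp : ∀ r, 0 < r → 0 < vp r)
    (hg : ∀ r, 0 < r → HasDerivAt (fun ρ => e (vp ρ)) (gp r) r) (hgc : ContinuousOn gp (Ioi 0))
    (hgp : ∀ r, 0 < r → 0 < gp r) (hf0 : f (v 0) ^ k ≤ μ ^ k)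
    (hf : ∀ r, 0 < r → f (v r) ^ k ≤ gp r * (e (vp r) / r) ^ (k - 1)) :
    IsEntireSolution n k A f (fun x => v ‖x‖) := by
  have hn : 1 ≤ n := hk.trans hkn
  have he0 : e 0 = 0 := by rw [he 0 le_rfl, zero_mul]
  have hvp0 : vp 0 = 0 := by
    have := hinner 0 hr₀.le
    rw [mul_zero] at this
    exact e.injective (this.trans he0.symm)
  have hflux := fluxField_radial (n := n) he (fun r _ => hvd r) hvp0 hvp
  have hinner' : ∀ x : EuclideanSpace ℝ (Fin n), ‖x‖ ≤ r₀ → (e (vp ‖x‖) / ‖x‖) • x = μ • x := by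
    intro x hx
    rcases eq_or_ne x 0 with rfl | hx0
    · simp
    · rw [hinner _ hx, mul_div_cancel_right₀ _ (norm_ne_zero_iff.2 hx0)]
  -- The exactly linear flux gives regularity at the origin.
  have hloc : fluxField A (fun x : EuclideanSpace ℝ (Fin n) => v ‖x‖) =ᶠ[𝓝 0] fun x => μ • x := by
    rw [hflux]
    filter_upwards [Metric.ball_mem_nhds (0 : EuclideanSpace ℝ (Fin n)) hr₀] with x hx
    exact hinner' x (mem_ball_zero_iff.1 hx).le
  have hspec : ∀ x, ∃ D d : ℝ, 0 < D ∧ 0 < d ∧ f (v ‖x‖) ^ k ≤ D * d ^ (k - 1) ∧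
      eigenvalueMultiset (fluxMatrix A (fun x : EuclideanSpace ℝ (Fin n) => v ‖x‖) x) =
        D ::ₘ Multiset.replicate (n - 1) d := by
    intro x
    rcases eq_or_ne x 0 with rfl | hx
    · refine ⟨μ, μ, hμ, hμ, ?_, ?_⟩
      · rw [norm_zero, mul_comm, ← pow_succ, Nat.sub_add_cancel hk]
        exact hf0
      · have h1 : HasFDerivAt (fun x : EuclideanSpace ℝ (Fin n) => μ • x)
            (μ • ContinuousLinearMap.id ℝ _) 0 := (hasFDerivAt_id 0).const_smul μ
        have h2 := eigenvalueMultiset_fluxMatrix_of_rankOne hn (c := 0) (d := μ)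
          (e := EuclideanSpace.single ⟨0, hn⟩ 1) (by simp) (h1.congr_of_eventuallyEq hloc) (by simp)
        rwa [add_zero] at h2
    · have hr : 0 < ‖x‖ := norm_pos_iff.2 hx
      have hpos : 0 < e (vp ‖x‖) := by rw [← he0]; exact e.strictMono (hvp _ hr)
      refine ⟨gp ‖x‖, e (vp ‖x‖) / ‖x‖, hgp _ hr, by positivity, hf _ hr, ?_⟩
      obtain ⟨L, hL, hLe⟩ := hasFDerivAt_radial_field hx (hg _ hr)
      have h1 := eigenvalueMultiset_fluxMatrix_of_rankOne (A := A)
        (u := fun x : EuclideanSpace ℝ (Fin n) => v ‖x‖) hn (norm_smul_inv_norm (𝕜 := ℝ) hx)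
        (by rw [hflux]; exact hL) hLe
      rwa [add_sub_cancel] at h1
  -- Here `(p A(p))' > 0` is essential: it makes `e.symm` differentiable, so `v' = e.symm ∘ g` is
  -- `C¹`.
  have hvpC : ContDiffOn ℝ 1 vp (Ioi 0) := by
    have hsm : ContDiffOn ℝ 1 (fun t : ℝ => t * A t) (Ioi 0) := contDiffOn_id.mul hA_smooth
    have hdc : ContinuousOn (deriv fun t : ℝ => t * A t) (Ioi 0) :=
      hsm.continuousOn_deriv_of_isOpen isOpen_Ioi le_rfl
    have hed : ∀ p, 0 < p → HasDerivAt e (deriv (fun t : ℝ => t * A t) p) p := by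
      intro p hp
      refine ((hsm.contDiffAt (Ioi_mem_nhds hp)).differentiableAt
        (by norm_num)).hasDerivAt.congr_of_eventuallyEq ?_
      filter_upwards [Ioi_mem_nhds hp] with q hq using he q (le_of_lt hq)
    refine contDiffOn_one_of_hasDerivAt isOpen_Ioi
      (vp := fun r => (deriv (fun t : ℝ => t * A t) (vp r))⁻¹ * gp r) ?_ ?_
    · intro r hr
      have h1 : HasDerivAt e.symm (deriv (fun t : ℝ => t * A t) (vp r))⁻¹ (e (vp r)) := by
        refine HasDerivAt.of_local_left_inverse (f := e) e.symm.continuous.continuousAt ?_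
          (hA_deriv _ (hvp r hr)).ne' (Eventually.of_forall e.apply_symm_apply)
        rw [e.symm_apply_apply]
        exact hed _ (hvp r hr)
      have h2 := h1.comp r (hg r hr)
      simpa [Function.comp_def] using h2
    · refine ContinuousOn.mul (ContinuousOn.inv₀ ?_ fun r hr => (hA_deriv _ (hvp r hr)).ne') hgc
      exact hdc.comp hvc.continuousOn fun r hr => hvp r hr
  refine ⟨?_, ⟨contDiff_one_radial (fun r _ => hvd r) hvc hvp0, ?_, fun x => ?_⟩, fun x => ?_⟩
  · have h1 : ContDiffOn ℝ 2 v (Ioi 0) :=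
      contDiffOn_two_of_hasDerivAt isOpen_Ioi (fun r _ => hvd r) hvpC
    exact h1.comp (fun x hx => (contDiffAt_norm ℝ hx).contDiffWithinAt)
      fun x hx => norm_pos_iff.2 hx
  · rw [contDiff_iff_contDiffAt]
    intro x
    rcases eq_or_ne x 0 with rfl | hx
    · exact ContDiffAt.congr_of_eventuallyEq (by fun_prop) hloc
    · rw [hflux]
      have hr : 0 < ‖x‖ := norm_pos_iff.2 hx
      have h1 : ContDiffAt ℝ 1 (fun ρ => e (vp ρ)) ‖x‖ :=
        (contDiffOn_one_of_hasDerivAt isOpen_Ioi hg hgc).contDiffAt (Ioi_mem_nhds hr)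
      have h2 : ContDiffAt ℝ 1 (fun y : EuclideanSpace ℝ (Fin n) => ‖y‖) x := contDiffAt_norm ℝ hx
      exact ((h1.comp x h2).div h2 hr.ne').smul contDiffAt_id
  · obtain ⟨D, d, hD, hd, -, hs⟩ := hspec x
    rw [hs]
    exact cons_replicate_mem_gammaCone hn hkn hD hd
  · obtain ⟨D, d, hD, hd, hfD, hs⟩ := hspec x
    rw [hs]
    have h1 := hfD.trans (mul_pow_le_esymm_cons_replicate hk hkn hD hd)
    have hk0 : (k : ℝ) ≠ 0 := by positivity
    calc f (v ‖x‖) = (f (v ‖x‖) ^ k) ^ (1 / (k : ℝ)) := by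
          rw [one_div, Real.pow_rpow_inv_natCast (hf_pos _).le (by omega)]
      _ ≤ _ := Real.rpow_le_rpow (pow_pos (hf_pos _) k).le h1 (by positivity)

end RadialSolution

/-! ### Sufficiency of the integral condition. -/

section Sufficiency

variable {n k : ℕ} {A f : ℝ → ℝ}

lemma IsGluedProfile.v_strictMono {e ψ : ℝ ≃o ℝ} {z v vp : ℝ → ℝ} {s₀ r₀ μ : ℝ}
    (h : IsLegendrePair A k e ψ) (hv : IsGluedProfile e ψ z s₀ r₀ μ v vp) (hμ : 0 < μ)
    (hzp : ∀ s, 0 < z s) : StrictMonoOn v (Ici 0) := by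
  refine strictMonoOn_of_deriv_pos (convex_Ici 0)
    (fun r _ => (hv.deriv r).continuousAt.continuousWithinAt) fun r hr => ?_
  rw [interior_Ici] at hr
  rw [(hv.deriv r).deriv]
  exact hv.vp_pos h hμ hzp hr

lemma not_integrableOn_of_psiKellerOsserman {e ψ : ℝ ≃o ℝ} (h : IsLegendrePair A k e ψ)
    (hf_cont : Continuous f) (hf_pos : ∀ t : ℝ, 0 < f t) (hf_mono : Monotone f) {b c : ℝ}
    (hcb : c ≤ b) (hKO : PsiKellerOsserman A f k c b) {E C : ℝ} (hE : 0 ≤ E) (hC : 0 < C) (a : ℝ) :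
    ¬ IntegrableOn (fun s => (ψ.symm (E + C * ∫ t in a..s, f t ^ k))⁻¹) (Ioi a) := by
  intro hint
  refine (PsiKellerOsserman_iff h hf_cont hf_pos hf_mono hcb).1 hKO ?_
  have := h.isKernel.tail_transfer (hf_cont.pow k)
    (fun s t hst => pow_le_pow_left₀ (hf_pos s).le (hf_mono hst) k) (fun t => pow_pos (hf_pos t) k)
    hE hC le_rfl one_pos (a' := c) ⟨a, hint⟩
  simpa using this

/-- The Keller–Osserman condition is sufficient for the existence of an entire solution. -/
theorem exists_isEntireSolution {e ψ : ℝ ≃o ℝ} (h : IsLegendrePair A k e ψ) (hk : 1 ≤ k)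
    (hkn : k ≤ n) (hA_smooth : ContDiffOn ℝ 1 A (Ioi 0))
    (hA_deriv : ∀ p : ℝ, 0 < p → 0 < deriv (fun t : ℝ => t * A t) p)
    (hf_cont : Continuous f) (hf_pos : ∀ t : ℝ, 0 < f t) (hf_mono : Monotone f) {b c : ℝ}
    (hcb : c ≤ b) (hKO : PsiKellerOsserman A f k c b) :
    ∃ u : EuclideanSpace ℝ (Fin n) → ℝ, IsEntireSolution n k A f u := by
  have hwc : Continuous fun t => f t ^ k := hf_cont.pow k
  have hwp : ∀ t, 0 < f t ^ k := fun t => pow_pos (hf_pos t) k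
  have hk0 : (0 : ℝ) < k := by exact_mod_cast hk
  -- The flux at the gluing radius `r₀ = μ⁻¹` is normalised to `1`. Thus `p₀`, `δ` and `E` do not
  -- depend on `μ`, which can be taken large afterwards.
  set p₀ := e.symm 1 with hp₀
  have hp₀0 : 0 < p₀ := by rw [hp₀, ← h.e_symm_zero]; exact e.symm.strictMono one_pos
  set δ := p₀⁻¹ with hδ
  have hδ0 : 0 < δ := inv_pos.2 hp₀0
  set E := ψ p₀ with hE
  have hE0 : 0 < E := by rw [hE, ← h.psi_zero]; exact ψ.strictMono hp₀0
  set μ := max 1 (max ((1 + δ) ^ (k - 1) * f 0 ^ k) (f 0)) with hμdef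
  have hμ1 : 1 ≤ μ := le_max_left _ _
  have hμK : (1 + δ) ^ (k - 1) * f 0 ^ k ≤ μ := (le_max_left _ _).trans (le_max_right _ _)
  have hμf : f 0 ≤ μ := (le_max_right _ _).trans (le_max_right _ _)
  have hμ : 0 < μ := one_pos.trans_le hμ1
  set r₀ := μ⁻¹ with hr₀def
  have hr₀ : 0 < r₀ := inv_pos.2 hμ
  have hμr₀ : μ * r₀ = 1 := mul_inv_cancel₀ hμ.ne'
  have hr₀1 : r₀ ≤ 1 := inv_le_one_of_one_le₀ hμ1
  have hden : 0 < (r₀ + δ) ^ (k - 1) * f 0 ^ k := mul_pos (by positivity) (hwp 0)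
  -- Chosen so that `hz 0 = k μ`: the outer `g'` starts at the inner value `μ`. The size of `μ`
  -- gives `K ≥ k`.
  set K := k * μ / ((r₀ + δ) ^ (k - 1) * f 0 ^ k) with hKdef
  have hK0 : 0 < K := by positivity
  have hKk : k ≤ K := by
    rw [hKdef, le_div_iff₀ hden]
    refine mul_le_mul_of_nonneg_left (le_trans ?_ hμK) hk0.le
    have := hwp 0
    gcongr
  obtain ⟨R, z, hz, hRc, hzc, hhc, hzE, hhz, hzz, hRR⟩ :=
    exists_delay_profile h hwc hwp hE0 hK0 hr₀ hδ0 (k - 1)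
  have hzp : ∀ s, 0 < z s := fun s => hE0.trans_le (hzE s)
  have hqc : Continuous fun t => (ψ.symm (z t))⁻¹ :=
    (ψ.symm.continuous.comp hzc).inv₀ fun t => (h.symm_pos (hzp t)).ne'
  have hq0 : ∀ t, 0 < (ψ.symm (z t))⁻¹ := fun t => inv_pos.2 (h.symm_pos (hzp t))
  have hqδ : ∀ t, (ψ.symm (z t))⁻¹ ≤ δ := fun t => by
    refine inv_anti₀ hp₀0 ?_
    rw [← ψ.symm_apply_apply p₀]
    exact ψ.symm.monotone (hzE t)
  have hRsub : ∀ s t, R t = R s + ∫ τ in s..t, (ψ.symm (z τ))⁻¹ := fun s t => by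
    rw [hRR s, hRR t, cumul_add hqc 0 s t]; ring
  have hRm : Monotone R := fun s t hst => by
    rw [hRsub s t]
    exact le_add_of_nonneg_right (cumul_nonneg hq0 hst)
  have hRlip : ∀ s t, s ≤ t → R t ≤ R s + δ * (t - s) := fun s t hst => by
    rw [hRsub s t]
    have := intervalIntegral.integral_mono_on (μ := volume) hst (hqc.intervalIntegrable s t)
      (intervalIntegrable_const (c := δ)) fun τ _ => hqδ τ
    simp only [intervalIntegral.integral_const, smul_eq_mul] at this
    linarith
  have hR0 : R 0 = r₀ := by rw [hRR]; simp
  -- `R` has slope at most `δ`, so one unit of height costs at most `δ` in radius.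
  have hRdelay : ∀ s, 0 ≤ s → R s ≤ max (R (s - 1)) r₀ + δ := by
    intro s hs
    rcases le_total s 1 with h1 | h1
    · have h2 := hRlip 0 s hs
      have h3 : δ * (s - 0) ≤ δ * 1 := by gcongr; linarith
      have h4 := le_max_right (R (s - 1)) r₀
      rw [hR0] at h2
      linarith
    · have h2 := hRlip (s - 1) s (by linarith)
      have h4 := le_max_left (R (s - 1)) r₀
      have h5 : s - (s - 1) = 1 := by ring
      rw [h5] at h2
      linarith
  have hhp : ∀ t, 0 < hz t := fun t => by
    rw [hhz]
    have := lt_max_of_lt_right (b := R (t - 1)) hr₀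
    have := hwp t
    positivity
  have hh0 : hz 0 = k * μ := by
    have h1 : R (0 - 1) ≤ r₀ := by rw [← hR0]; exact hRm (by norm_num)
    rw [hhz, max_eq_right h1, mul_assoc, hKdef, div_mul_cancel₀ _ hden.ne']
  have hz0 : ∀ s, s ≤ 0 → z s = E := fun s hs => by rw [hzz, max_eq_right hs]; simp
  have hzpos : ∀ s, 0 ≤ s → z s = E + ∫ t in (0 : ℝ)..s, hz t := fun s hs => by
    rw [hzz, max_eq_left hs]
  have hzd : ∀ s, 0 ≤ s → HasDerivWithinAt z (hz s) (Ici s) s := fun s hs =>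
    (hasDerivAt_base_integral hhc E 0 s).hasDerivWithinAt.congr
      (fun t ht => hzpos t (hs.trans ht)) (hzpos s hs)
  -- If `R` stayed below `l`, then `hz ≤ C fᵏ` and `∫ (ψ.symm (z t))⁻¹` would be bounded, making the
  -- Keller–Osserman integral finite.
  have htop : Tendsto R atTop atTop := by
    rcases tendsto_atTop_of_monotone hRm with h1 | ⟨l, hl⟩
    · exact h1
    exfalso
    have hRl : ∀ s, R s ≤ l := fun s => hRm.ge_of_tendsto hl s
    have hmax : 0 < max l r₀ := lt_max_of_lt_right hr₀
    set C := K * (max l r₀ + δ) ^ (k - 1) with hC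
    have hC0 : 0 < C := by positivity
    have hhC : ∀ t, hz t ≤ C * f t ^ k := fun t => by
      rw [hhz, hC]
      have h2 := hwp t
      have h3 : 0 < max (R (t - 1)) r₀ := lt_max_of_lt_right hr₀
      have h4 := hRl (t - 1)
      gcongr
    set Q : ℝ → ℝ := fun s => (ψ.symm (E + C * ∫ t in (0 : ℝ)..s, f t ^ k))⁻¹ with hQ
    have hpos : ∀ s, 0 ≤ s → 0 < E + C * ∫ t in (0 : ℝ)..s, f t ^ k := fun s hs =>
      add_pos_of_pos_of_nonneg hE0 (mul_nonneg hC0.le (cumul_nonneg hwp hs))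
    have hQq : ∀ s, 0 ≤ s → Q s ≤ (ψ.symm (z s))⁻¹ := by
      intro s hs
      refine inv_anti₀ (h.symm_pos (hzp s)) (ψ.symm.monotone ?_)
      rw [hzpos s hs, ← intervalIntegral.integral_const_mul]
      gcongr
      exact intervalIntegral.integral_mono_on hs (hhc.intervalIntegrable _ _)
        ((hwc.const_mul C).intervalIntegrable _ _) fun t _ => hhC t
    have hQ0 : ∀ s, 0 ≤ s → 0 ≤ Q s := fun s hs => inv_nonneg.2 (h.symm_pos (hpos s hs)).le
    have hQc : ContinuousOn Q (Ici 0) := by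
      refine ContinuousOn.inv₀ (Continuous.continuousOn ?_) fun s hs => (h.symm_pos (hpos s hs)).ne'
      exact ψ.symm.continuous.comp
        (continuous_const.add (continuous_const.mul (continuous_cumul hwc 0)))
    have hQint : ∀ s, 0 ≤ s → IntervalIntegrable Q volume 0 s := fun s hs =>
      (hQc.mono (by rw [uIcc_of_le hs]; exact Icc_subset_Ici_self)).intervalIntegrable
    refine not_integrableOn_of_psiKellerOsserman h hf_cont hf_pos hf_mono hcb hKO hE0.le hC0 0 ?_
    refine integrableOn_Ioi_of_intervalIntegral_norm_bounded (l - r₀) 0 (b := id) (l := atTop)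
      (fun s => ?_) tendsto_id ?_
    · rcases le_total 0 s with hs | hs
      · exact (intervalIntegrable_iff_integrableOn_Ioc_of_le hs).1 (hQint s hs)
      · simp [Ioc_eq_empty (not_lt.2 hs)]
    · filter_upwards [eventually_ge_atTop 0] with s hs
      have h2 : ∫ t in (0 : ℝ)..s, ‖Q t‖ ≤ ∫ t in (0 : ℝ)..s, (ψ.symm (z t))⁻¹ := by
        refine intervalIntegral.integral_mono_on hs (hQint s hs).norm
          (hqc.intervalIntegrable _ _) fun t ht => ?_
        rw [Real.norm_of_nonneg (hQ0 t ht.1)]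
        exact hQq t ht.1
      have h3 := hRR s
      have h4 := hRl s
      exact h2.trans (by linarith)
  obtain ⟨v, vp, hv⟩ := exists_gluedProfile h hzc hzp (s₀ := 0) (r₀ := r₀) (μ := μ)
    (fun s hs => by rw [hz0 s hs, hz0 0 le_rfl])
    (by rw [hμr₀, hz0 0 le_rfl, hE, ψ.symm_apply_apply]) (htop.congr hRR)
  have hvm := hv.v_mono h hμ hzp
  have hvp := fun r hr => hv.vp_pos h hμ hzp (r := r) hr
  have hgpos : ∀ r, 0 < r → 0 < e (vp r) := fun r hr => h.e_pos (hvp r hr)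
  have hinner : ∀ r, r ≤ r₀ → e (vp r) = μ * r := fun r hr => by
    rw [hv.inner r hr, e.apply_symm_apply]
  have hRv : ∀ r, r₀ ≤ r → R (v r) = r := by
    intro r hr
    have h1 : v (R (v r)) = v r := by
      rw [hRR]; exact hv.param _ (hv.le_outer r hr)
    have h2 : r₀ ≤ R (v r) := by
      rw [← hR0]; exact hRm (hv.le_outer r hr)
    exact (hv.v_strictMono h hμ hzp).injOn (mem_Ici.2 (hr₀.le.trans h2))
      (mem_Ici.2 (hr₀.le.trans hr)) h1
  set gp : ℝ → ℝ := fun r => hz (v (max r r₀)) / (k * e (vp (max r r₀)) ^ (k - 1)) with hgp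
  have hmaxpos : ∀ r, 0 < max r r₀ := fun r => lt_max_of_lt_right hr₀
  have hvc : Continuous v := continuous_iff_continuousAt.2 fun r => (hv.deriv r).continuousAt
  have hec : Continuous fun r => e (vp r) := e.continuous.comp hv.cont
  have hgpc : Continuous gp := by
    refine (hhc.comp (hvc.comp (by fun_prop))).div
      (continuous_const.mul ((hec.comp (by fun_prop : Continuous fun r => max r r₀)).pow _)) fun r => ?_
    exact (mul_pos hk0 (pow_pos (hgpos _ (hmaxpos r)) _)).ne'
  have hgppos : ∀ r, 0 < gp r := fun r =>
    div_pos (hhp _) (mul_pos hk0 (pow_pos (hgpos _ (hmaxpos r)) _))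
  have hgpin : ∀ r, r ≤ r₀ → gp r = μ := by
    intro r hr
    simp only [hgp]
    rw [max_eq_right hr, hv.base, hinner r₀ le_rfl, hμr₀, one_pow, mul_one, hh0,
      mul_div_cancel_left₀ _ hk0.ne']
  have hgpout : ∀ r, r₀ ≤ r → gp r = hz (v r) / (k * e (vp r) ^ (k - 1)) := by
    intro r hr
    simp only [hgp]
    rw [max_eq_left hr]
  -- A continuous right derivative determines `g` as an integral, which upgrades it to a two-sided
  -- derivative.
  have hgint : ∀ r, e (vp r) = 1 + ∫ ρ in r₀..r, gp ρ := by
    intro r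
    rcases le_total r r₀ with hr | hr
    · have h1 : ∫ ρ in r₀..r, gp ρ = ∫ _ in r₀..r, μ := by
        refine intervalIntegral.integral_congr fun ρ hρ => ?_
        rw [uIcc_of_ge hr] at hρ
        exact hgpin ρ hρ.2
      rw [h1, hinner r hr, intervalIntegral.integral_const, smul_eq_mul]
      linarith
    · have h1 : ∫ ρ in r₀..r, gp ρ = e (vp r) - e (vp r₀) := by
        refine intervalIntegral.integral_eq_sub_of_hasDeriv_right (f := fun ρ => e (vp ρ))
          hec.continuousOn (fun ρ hρ => ?_) (hgpc.intervalIntegrable _ _)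
        rw [min_eq_left hr] at hρ
        rw [hgpout ρ hρ.1.le]
        exact (hv.flux_hasDerivWithinAt h hk hr₀ hμ hzp hρ.1.le
          (hzd _ (hv.le_outer ρ hρ.1.le))).mono Ioi_subset_Ici_self
      rw [h1, hinner r₀ le_rfl, hμr₀]
      ring
  have hgd : ∀ r, HasDerivAt (fun ρ => e (vp ρ)) (gp r) r := by
    intro r
    rw [show (fun ρ => e (vp ρ)) = fun ρ => 1 + ∫ τ in r₀..ρ, gp τ from funext hgint]
    exact hasDerivAt_base_integral hgpc 1 r₀ r
  have hv0 : ∀ r, 0 ≤ r → r ≤ r₀ → f (v r) ^ k ≤ μ ^ k := by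
    intro r h0 hr
    have h1 : v r ≤ 0 := by rw [← hv.base]; exact hvm h0 hr₀.le hr
    exact pow_le_pow_left₀ (hf_pos _).le ((hf_mono h1).trans hμf) k
  refine ⟨_, isEntireSolution_radial hk hkn hA_smooth hA_deriv hf_pos h.e_eq hr₀ hμ hv.deriv hv.cont
    hinner hvp (fun r _ => hgd r) hgpc.continuousOn (fun r _ => hgppos r) (hv0 0 le_rfl hr₀.le) ?_⟩
  intro r hr
  rcases le_total r r₀ with hr1 | hr1
  · rw [hgpin r hr1, hinner r hr1, mul_div_cancel_right₀ _ hr.ne', ← pow_succ',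
      Nat.sub_add_cancel hk]
    exact hv0 r hr.le hr1
  · have h1 : K * r ^ (k - 1) * f (v r) ^ k ≤ hz (v r) := by
      have h2 := hRdelay (v r) (hv.le_outer r hr1)
      rw [hRv r hr1] at h2
      have h3 := hwp (v r)
      rw [hhz]
      gcongr
    have h4 : gp r * (e (vp r) / r) ^ (k - 1) = hz (v r) / (k * r ^ (k - 1)) := by
      have := hgpos r hr
      rw [hgpout r hr1, div_pow]
      field_simp
    rw [h4, le_div_iff₀ (by positivity)]
    refine le_trans ?_ h1
    have h3 := hwp (v r)
    calc f (v r) ^ k * (k * r ^ (k - 1)) = k * r ^ (k - 1) * f (v r) ^ k := by ring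
      _ ≤ K * r ^ (k - 1) * f (v r) ^ k := by gcongr

end Sufficiency

theorem corollary1p4 (n k : ℕ) (hk : 1 ≤ k) (hkn : k ≤ n) (A f : ℝ → ℝ)
    (hA_pos : ∀ p : ℝ, 0 < p → 0 < A p)
    (hA_smooth : ContDiffOn ℝ 1 A (Set.Ioi 0))
    (hA_cont : ContinuousOn (fun p : ℝ => p * A p) (Set.Ici 0))
    (hA_mono : StrictMonoOn (fun p : ℝ => p * A p) (Set.Ioi 0))
    (hf_cont : Continuous f) (hf_pos : ∀ t : ℝ, 0 < f t) (hf_mono : Monotone f) :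
    -- bounded case
    ((∃ L : ℝ, Filter.Tendsto (fun p : ℝ => p * A p) Filter.atTop (nhds L)) →
      ¬ ∃ u : EuclideanSpace ℝ (Fin n) → ℝ, IsEntireSolution n k A f u) ∧
    -- unbounded case
    (Filter.Tendsto (fun p : ℝ => p * A p) Filter.atTop Filter.atTop →
      ∀ c b : ℝ, 0 < c → c ≤ b →
        ((∃ u : EuclideanSpace ℝ (Fin n) → ℝ, IsEntireSolution n k A f u) →
          PsiKellerOsserman A f k c b) ∧
        ((∀ p : ℝ, 0 < p → 0 < deriv (fun t : ℝ => t * A t) p) →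
          PsiKellerOsserman A f k c b →
          ∃ u : EuclideanSpace ℝ (Fin n) → ℝ, IsEntireSolution n k A f u)) ∧
    -- power growth
    (∀ m : ℝ, 1 < m → PowerGrowth A m →
      ∀ c b : ℝ, 0 < c → c ≤ b →
        ((∃ u : EuclideanSpace ℝ (Fin n) → ℝ, IsEntireSolution n k A f u) →
          PowerKellerOsserman f k m c b) ∧
        ((∀ p : ℝ, 0 < p → 0 < deriv (fun t : ℝ => t * A t) p) →
          PowerKellerOsserman f k m c b →
          ∃ u : EuclideanSpace ℝ (Fin n) → ℝ, IsEntireSolution n k A f u)) := by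
  refine ⟨?_, ?_, ?_⟩
  · rintro ⟨L, hL⟩ ⟨u, hu⟩
    exact not_isEntireSolution_of_tendsto hk hkn hA_pos hA_cont hA_mono hf_pos hf_mono hL hu
  · intro ht c b _ hcb
    obtain ⟨e, ψ, h⟩ := exists_legendrePair hk hA_pos hA_cont hA_mono ht
    exact ⟨fun ⟨_, hu⟩ =>
        hu.psiKellerOsserman h hk hkn hA_pos hA_smooth hf_cont hf_pos hf_mono hcb,
      fun hA_deriv hKO =>
        exists_isEntireSolution h hk hkn hA_smooth hA_deriv hf_cont hf_pos hf_mono hcb hKO⟩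
  · intro m hm hA c b _ hcb
    obtain ⟨e, ψ, h⟩ := exists_legendrePair hk hA_pos hA_cont hA_mono (hA.tendsto hm)
    -- Power growth forces `p A(p) → ∞`, so the third case becomes the second.
    rw [powerKellerOsserman_iff_psi h hk hm hA hf_cont hf_pos hf_mono hcb]
    exact ⟨fun ⟨_, hu⟩ =>
        hu.psiKellerOsserman h hk hkn hA_pos hA_smooth hf_cont hf_pos hf_mono hcb,
      fun hA_deriv hKO =>
        exists_isEntireSolution h hk hkn hA_smooth hA_deriv hf_cont hf_pos hf_mono hcb hKO⟩
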